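/- A compact polyhedron is the underlying set of a finite simplicial complex in a finite-dimensional real normed space. A map between compact polyhedra is PL if it is affine on each simplex of some finite triangulation of its domain; a PL embedding is a PL map which is a PL homeomorphism onto its image. A PL map is non-degenerate if it has no point-inverses of dimension $>0$. A map $e\colon N\to M\times\mathbb R^k$ lifts $f\colon N\to M$ if its composition with the projection onto $M$ is $f$; likewise, for a set $S$, a map $N\times S\to M\times\mathbb R^k\times S$ lifts $f\times\mathrm{id}_S$ if its composition with the projection onto $M\times S$ is $f\times\mathrm{id}_S$. Let $B^n=[-1,1]^n$ and let $\partial B^n$ be its boundary (so $B^0$ is a point and $\partial B^0=\emptyset$). Two maps into a metric space are $r$-close if their values at each point are at distance $<r$; products carry the maximum metric. Let $f\colon N\to M$ be a non-degenerate PL map between compact polyhedra and let $k\ge 0$. (a) The space of topological embeddings $N\to M\times\mathbb R^k$ which lift $f$, with the compact-open topology (equivalently, the topology of uniform convergence), is locally contractible: every neighborhood $U$ of each of its points contains a neighborhood $V$ of that point such that the inclusion $V\to U$ is null-homotopic. (b) Let $e\colon N\to M\times\mathbb R^k$ be a topological embedding which lifts $f$. For each $\varepsilon>0$ there exists a $\delta>0$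 such that for each $n=0,1,2,\dots$, every PL embedding $N\times\partial B^n\to M\times\mathbb R^k\times\partial B^n$ which lifts $f\times\mathrm{id}_{\partial B^n}$ and is $\delta$-close to $e\times\mathrm{id}_{\partial B^n}$ extends to a PL embedding $N\times B^n\to M\times\mathbb R^k\times B^n$ which lifts $f\times\mathrm{id}_{B^n}$ and is $\varepsilon$-close to $e\times\mathrm{id}_{B^n}$. -/

import Mathlib

open Set Topology

section PL

variable {V W : Type*} [AddCommGroup V] [Module ℝ V] [AddCommGroup W] [Module ℝ W]

/-- A compact polyhedron in a real vector space: the underlying set of a finite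
(geometric) simplicial complex. -/
def IsCompactPolyhedron (X : Set V) : Prop :=
  ∃ K : Geometry.SimplicialComplex ℝ V, K.faces.Finite ∧ K.space = X

/-- `F` is piecewise linear on the compact polyhedron `X`: for some finite triangulation of `X`,
it is affine on every simplex. Only the values of `F` on `X` matter. -/
def IsPLOn (F : V → W) (X : Set V) : Prop :=
  ∃ K : Geometry.SimplicialComplex ℝ V, K.faces.Finite ∧ K.space = X ∧
    ∀ s ∈ K.faces, ∃ φ : V →ᵃ[ℝ] W, EqOn F φ (convexHull ℝ (s : Set V))

/-- `F` restricts to a PL embedding of the compact polyhedron `X`: it is PL on `X`, and it has an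
inverse `F(X) → X` which is PL. -/
def IsPLEmbeddingOn (F : V → W) (X : Set V) : Prop :=
  IsPLOn F X ∧ ∃ G : W → V, IsPLOn G (F '' X) ∧ LeftInvOn G F X

/-- The dimension of a polyhedron: the supremum of the dimensions of the simplices contained
in it (`⊥` for the empty polyhedron). -/
noncomputable def polyhedronDim (X : Set V) : WithBot ℕ∞ :=
  ⨆ (s : Finset V) (_ : s.Nonempty) (_ : AffineIndependent ℝ ((↑) : s → V))
    (_ : convexHull ℝ (s : Set V) ⊆ X), (((s.card - 1 : ℕ) : ℕ∞) : WithBot ℕ∞)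

/-- `f` restricts to a PL map `N → M`. -/
def IsPLMap (f : V → W) (N : Set V) (M : Set W) : Prop :=
  IsPLOn f N ∧ MapsTo f N M

/-- `f : N → M` has no point-inverses of dimension `> 0`. -/
def IsNondegenerate (f : V → W) (N : Set V) (M : Set W) : Prop :=
  ∀ y ∈ M, polyhedronDim {x ∈ N | f x = y} ≤ 0

end PL

section Lifts

variable {V W : Type*} [NormedAddCommGroup V] [NormedSpace ℝ V]
  [NormedAddCommGroup W] [NormedSpace ℝ W]

/-- The space of topological embeddings `N → M × ℝᵏ` which lift `f : N → M`, with the topology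
induced from the compact-open topology (that is, of uniform convergence, when `N` is compact). -/
abbrev EmbeddedLifts (f : V → W) (N : Set V) (M : Set W) (k : ℕ) : Type _ :=
  {e : C(N, M × EuclideanSpace ℝ (Fin k)) // IsEmbedding e ∧ ∀ p : N, ((e p).1 : W) = f p}

/-- For `S ⊆ ℝⁿ`, the map `E` restricts to a PL embedding `N × S → M × ℝᵏ × S` which lifts
`f × id_S`. -/
def IsPLEmbeddedLiftOver (f : V → W) (N : Set V) (k n : ℕ) (S : Set (Fin n → ℝ))
    (E : V × (Fin n → ℝ) → W × EuclideanSpace ℝ (Fin k) × (Fin n → ℝ)) : Prop :=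
  IsPLEmbeddingOn E (N ×ˢ S) ∧ ∀ p ∈ N, ∀ b ∈ S, (E (p, b)).1 = f p ∧ (E (p, b)).2.2 = b

/-- `E`, as a map on `N × S`, is `r`-close to `e × id_S`. -/
def IsCloseOver {N : Set V} {M : Set W} {k n : ℕ} (e : N → M × EuclideanSpace ℝ (Fin k))
    (S : Set (Fin n → ℝ)) (E : V × (Fin n → ℝ) → W × EuclideanSpace ℝ (Fin k) × (Fin n → ℝ))
    (r : ℝ) : Prop :=
  ∀ p : N, ∀ b ∈ S, dist (E (p, b)) (((e p).1 : W), (e p).2, b) < r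

/-- The standard PL ball `Bⁿ = [-1, 1]ⁿ`. -/
def plBall (n : ℕ) : Set (Fin n → ℝ) := Metric.closedBall 0 1

/-- The boundary `∂Bⁿ` of the standard PL ball `[-1, 1]ⁿ` (empty for `n = 0`). -/
def plSphere (n : ℕ) : Set (Fin n → ℝ) := Metric.sphere 0 1

end Lifts

/-! A lift of `f` amounts to its `ℝᵏ`-component, a map that separates the points of each fibre of
`f` (`FibInj`). Both assertions say that families of such maps near `e` can be contracted inside a
small neighbourhood of `e`: for (a) along `[-1, 1]`, reaching at parameter `0` a map independent of
the initial one (`ContractsTop`); for (b) by filling a PL family over a sphere with one over the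
ball (`ContractsPL`). One formula, `coneExt`, serves both.

Let `w` be a vertex of a triangulation of the target. Over its closed star the domain consists of
cones `D v` with apexes the preimages `v` of `w`, attached to the part `N₁` over the complement of
the open star. A family given on `N₁ × B` and on `N × ∂B` is extended over `D v × B` conically from
the point `(v, 0)`, which is sent to `e v`. Dilations about `v` cover dilations about `w`, so points
of one cone lying in a common fibre stay separated. Points of different cones stay separated
provided that the values over each `D v` remain in a ball about `e v` and these balls are disjoint.
The values are therefore confined to convex neighbourhoods (`IsSheeted.region`) which coning
respects.

The obstacle is that the distances between the points `e v` tend to zero where sheets of `f` come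
together. So one fixes a triangulation `L₀` of the target compatible with the images of all
intersections of simplices, and argues by induction on its skeleta. A compact `Y` missing all faces
with at most `i` vertices meets the faces with `i + 1` vertices only in their interiors. Sheets do
not come together along such an interior, which gives a uniform gap over this part of `Y`
(`exists_gap`). Take a triangulation of the target so fine that `e` oscillates little, compared with
the gap, on each cell. Removing the open stars of its vertices lying in that skeleton leaves a
polyhedron which misses the skeleton, so the induction applies to it with a smaller `ε`; the stars
are then restored one vertex at a time by coning (`contracts_of_disjoint_skel`). No constant depends
on the dimension of the ball, whence a `δ` uniform in `n`. -/

set_option linter.unusedSectionVars false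

/-! ### Convex weights and barycentres. -/

section Weights

variable {V W : Type*} [AddCommGroup V] [Module ℝ V] [AddCommGroup W] [Module ℝ W]

/-- `w` is a system of convex weights on the finite set `s` with barycentre `x`. -/
structure IsBary (s : Finset V) (w : V → ℝ) (x : V) : Prop where
  nonneg : ∀ v, 0 ≤ w v
  supp : ∀ v, v ∉ s → w v = 0
  sum : ∑ v ∈ s, w v = 1
  eq : ∑ v ∈ s, w v • v = x

theorem IsBary.mono {s t : Finset V} {w : V → ℝ} {x : V} (h : IsBary s w x) (hst : s ⊆ t) :
    IsBary t w x where
  nonneg := h.nonneg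
  supp v hv := h.supp v fun hs => hv (hst hs)
  sum := by
    rw [← h.sum]
    exact (Finset.sum_subset hst fun v _ hv => h.supp v hv).symm
  eq := by
    rw [← h.eq]
    exact (Finset.sum_subset hst fun v _ hv => by rw [h.supp v hv, zero_smul]).symm

theorem IsBary.restrict {s t : Finset V} {w : V → ℝ} {x : V} (h : IsBary s w x) (hst : t ⊆ s)
    (h0 : ∀ v ∈ s, v ∉ t → w v = 0) : IsBary t w x where
  nonneg := h.nonneg
  supp v hv := by
    by_cases hs : v ∈ s
    · exact h0 v hs hv
    · exact h.supp v hs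
  sum := by
    rw [← h.sum]
    exact Finset.sum_subset hst h0
  eq := by
    rw [← h.eq]
    exact Finset.sum_subset hst fun v hs hv => by rw [h0 v hs hv, zero_smul]

theorem IsBary.mem {s : Finset V} {w : V → ℝ} {x : V} (h : IsBary s w x) :
    x ∈ convexHull ℝ (s : Set V) :=
  Finset.mem_convexHull'.2 ⟨w, fun v _ => h.nonneg v, h.sum, h.eq⟩

theorem exists_isBary {s : Finset V} {x : V} (h : x ∈ convexHull ℝ (s : Set V)) :
    ∃ w, IsBary s w x := by
  classical
  obtain ⟨w, h0, h1, h2⟩ := Finset.mem_convexHull'.1 h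
  refine ⟨fun v => if v ∈ s then w v else 0, fun v => ?_, fun v hv => by simp [hv], ?_, ?_⟩
  · by_cases hv : v ∈ s <;> simp [hv, h0]
  · rw [← h1]
    exact Finset.sum_congr rfl fun v hv => by simp [hv]
  · rw [← h2]
    exact Finset.sum_congr rfl fun v hv => by simp [hv]

theorem IsBary.map_affine {s : Finset V} {w : V → ℝ} {x : V} (h : IsBary s w x)
    (φ : V →ᵃ[ℝ] W) : φ x = ∑ v ∈ s, w v • φ v := by
  obtain ⟨c, h1⟩ : ∃ c, ∀ v, φ v = φ.linear v + c := ⟨φ 0, fun v => congrFun φ.decomp v⟩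
  rw [h1 x, ← h.eq, map_sum]
  simp_rw [h1, smul_add, Finset.sum_add_distrib, ← Finset.sum_smul, h.sum, one_smul, map_smul]

theorem AffineIndependent.isBary_unique {s : Finset V}
    (hs : AffineIndependent ℝ ((↑) : s → V)) {w w' : V → ℝ} {x : V}
    (h : IsBary s w x) (h' : IsBary s w' x) : w = w' := by
  rw [affineIndependent_iff] at hs
  have key := hs Finset.univ (fun v => w v - w' v)
    (by rw [Finset.sum_coe_sort s (fun v => w v - w' v), Finset.sum_sub_distrib, h.sum, h'.sum,
          sub_self])
    (by
      rw [Finset.sum_coe_sort s (fun v => (w v - w' v) • v)]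
      simp_rw [sub_smul]
      rw [Finset.sum_sub_distrib, h.eq, h'.eq, sub_self])
  funext v
  by_cases hv : v ∈ s
  · exact sub_eq_zero.1 (key ⟨v, hv⟩ (Finset.mem_univ _))
  · rw [h.supp v hv, h'.supp v hv]

/-- An affine dependency, scaled down, can be added to the uniform weights without moving the
barycentre or losing nonnegativity; uniqueness then forces it to vanish. -/
theorem affineIndependent_of_isBary_unique {s : Finset V}
    (hs : ∀ w w' x, IsBary s w x → IsBary s w' x → w = w') :
    AffineIndependent ℝ ((↑) : s → V) := by
  classical
  rw [affineIndependent_iff]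
  intro t c hc0 hc1 a ha
  set d : V → ℝ := fun v => if h : v ∈ s then (if (⟨v, h⟩ : s) ∈ t then c ⟨v, h⟩ else 0) else 0
    with hd
  have hds : ∀ v : s, d v = if v ∈ t then c v else 0 := fun v => by simp [hd]
  have hd0 : ∑ v ∈ s, d v = 0 := by
    rw [← Finset.sum_coe_sort s d, ← hc0]
    simp [hds, Finset.inter_eq_right.2 (fun x _ => Finset.mem_attach s x : t ⊆ s.attach)]
  have hd1 : ∑ v ∈ s, d v • v = 0 := by
    rw [← Finset.sum_coe_sort s (fun v => d v • v), ← hc1]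
    simp [hds, ite_smul, Finset.inter_eq_right.2 (fun x _ => Finset.mem_attach s x : t ⊆ s.attach)]
  have hpos : (0 : ℝ) < s.card := by
    exact Nat.cast_pos.2 (Finset.card_pos.2 ⟨a.1, a.2⟩)
  set S : ℝ := 1 + ∑ v ∈ s, |d v| with hS
  have hSpos : 0 < S := by
    have : 0 ≤ ∑ v ∈ s, |d v| := Finset.sum_nonneg fun v _ => abs_nonneg _
    linarith
  set u : V → ℝ := fun v => if v ∈ s then (s.card : ℝ)⁻¹ else 0 with hu
  have hu1 : ∑ v ∈ s, u v = 1 := by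
    rw [Finset.sum_congr rfl (fun v hv => by simp only [hu, hv, if_true] : ∀ v ∈ s, u v = (s.card : ℝ)⁻¹)]
    simp [hpos.ne']
  have h1 : IsBary s u (∑ v ∈ s, u v • v) := by
    refine ⟨fun v => ?_, fun v hv => by simp [hu, hv], hu1, rfl⟩
    simp only [hu]; split_ifs <;> positivity
  have h2 : IsBary s (fun v => u v + (s.card : ℝ)⁻¹ * S⁻¹ * d v) (∑ v ∈ s, u v • v) := by
    refine ⟨fun v => ?_, fun v hv => by simp [hu, hd, hv], ?_, ?_⟩
    · by_cases hv : v ∈ s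
      · have h3 : |d v| ≤ S := by
          have := Finset.single_le_sum (f := fun v => |d v|) (fun v _ => abs_nonneg _) hv
          have h' : |d v| ≤ ∑ v ∈ s, |d v| := this
          linarith
        have h4 : -1 ≤ S⁻¹ * d v := by
          have : |S⁻¹ * d v| ≤ 1 := by
            rw [abs_mul, abs_of_pos (inv_pos.2 hSpos), inv_mul_le_iff₀ hSpos]; linarith
          exact (abs_le.1 this).1
        simp only [hu, hv, if_true]
        have : 0 < (s.card : ℝ)⁻¹ := inv_pos.2 hpos
        nlinarith
      · simp [hu, hd, hv]
    · rw [Finset.sum_add_distrib, ← Finset.mul_sum, hd0, hu1]; simp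
    · simp only [add_smul, Finset.sum_add_distrib, mul_smul]
      simp only [← Finset.smul_sum, hd1, smul_zero, add_zero]
  have := congrFun (hs _ _ _ h1 h2) a
  have hda : d a = 0 := by
    have h5 : (s.card : ℝ)⁻¹ * S⁻¹ * d a = 0 := by linarith
    rcases mul_eq_zero.1 h5 with h6 | h6
    · exact absurd h6 (mul_pos (inv_pos.2 hpos) (inv_pos.2 hSpos)).ne'
    · exact h6
  rwa [hds a, if_pos ha] at hda

end Weights

/-! ### Simplicial complexes through uniqueness of weights; carriers. -/

namespace Geometry.SimplicialComplex

variable {V W : Type*} [AddCommGroup V] [Module ℝ V] [AddCommGroup W] [Module ℝ W]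

/-- The point lies in the hull of `s ∩ t`, and both systems of weights must equal its weights there.
This makes barycentric coordinates global on a complex. -/
theorem isBary_unique (K : SimplicialComplex ℝ V) {s t : Finset V} (hs : s ∈ K.faces)
    (ht : t ∈ K.faces) {w w' : V → ℝ} {x : V} (h : IsBary s w x) (h' : IsBary t w' x) :
    w = w' := by
  classical
  have hx := K.inter_subset_convexHull hs ht ⟨h.mem, h'.mem⟩
  rw [← Finset.coe_inter] at hx
  obtain ⟨u, hu⟩ := exists_isBary hx
  rw [(K.indep hs).isBary_unique h (hu.mono Finset.inter_subset_left),
    (K.indep ht).isBary_unique h' (hu.mono Finset.inter_subset_right)]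

/-- A down-closed family of nonempty finite sets of points in which convex weights are determined
by their barycentre is a simplicial complex. -/
def ofUnique (F : Set (Finset V)) (hne : ∀ s ∈ F, s.Nonempty)
    (hdown : ∀ s ∈ F, ∀ t ⊆ s, t.Nonempty → t ∈ F)
    (huniq : ∀ s ∈ F, ∀ t ∈ F, ∀ w w' x, IsBary s w x → IsBary t w' x → w = w') :
    SimplicialComplex ℝ V where
  faces := F
  isRelLowerSet_faces := fun s hs => ⟨hne s hs, fun t hts ht => hdown s hs t hts ht⟩
  indep {s} hs := affineIndependent_of_isBary_unique (huniq s hs s hs)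
  inter_subset_convexHull {s t} hs ht := by
    classical
    rintro x ⟨hxs, hxt⟩
    obtain ⟨w, hw⟩ := exists_isBary hxs
    obtain ⟨w', hw'⟩ := exists_isBary hxt
    obtain rfl := huniq s hs t ht w w' x hw hw'
    rw [← Finset.coe_inter]
    refine (hw.restrict Finset.inter_subset_left fun v hv hv' => ?_).mem
    exact hw'.supp v fun h => hv' (Finset.mem_inter.2 ⟨hv, h⟩)

/-- `s` is the smallest face of `K` whose hull contains `x`. -/
def IsCarrier (K : SimplicialComplex ℝ V) (x : V) (s : Finset V) : Prop :=
  s ∈ K.faces ∧ x ∈ convexHull ℝ (s : Set V) ∧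
    ∀ t ∈ K.faces, x ∈ convexHull ℝ (t : Set V) → s ⊆ t

/-- The carrier is the support of the weights of `x`, which are the same in every face whose hull
contains `x`. -/
theorem exists_isCarrier (K : SimplicialComplex ℝ V) {s : Finset V} {x : V} (hs : s ∈ K.faces)
    (hx : x ∈ convexHull ℝ (s : Set V)) : ∃ t, K.IsCarrier x t := by
  classical
  obtain ⟨w, hw⟩ := exists_isBary hx
  have h : ∀ t ∈ K.faces, x ∈ convexHull ℝ (t : Set V) → s.filter (fun v => w v ≠ 0) ⊆ t := by
    intro t ht hxt v hv
    obtain ⟨w', hw'⟩ := exists_isBary hxt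
    obtain rfl := K.isBary_unique hs ht hw hw'
    by_contra hvt
    exact (Finset.mem_filter.1 hv).2 (hw'.supp v hvt)
  have hb : IsBary (s.filter (fun v => w v ≠ 0)) w x :=
    hw.restrict (Finset.filter_subset _ _) fun v hv hv' => by
      by_contra h0
      exact hv' (Finset.mem_filter.2 ⟨hv, h0⟩)
  refine ⟨_, K.down_closed hs (Finset.filter_subset _ _) ?_, hb.mem, h⟩
  have := hb.mem
  rw [← Finset.coe_nonempty, ← convexHull_nonempty_iff (𝕜 := ℝ)]
  exact ⟨x, this⟩

end Geometry.SimplicialComplex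

/-! ### Edge subdivisions that make affine functions keep their sign on faces. -/

section Stellar

variable {V : Type*} [AddCommGroup V] [Module ℝ V]

open Classical in
/-- Moving weight `m` from `c = α a + β b` to `a` and `b` preserves the barycentre. -/
theorem IsBary.shift {s : Finset V} {w : V → ℝ} {x a b c : V} {α β : ℝ} (m : ℝ)
    (h : IsBary s w x) (ha : a ∈ s) (hb : b ∈ s) (hc : c ∈ s) (hαβ : α + β = 1)
    (hcab : α • a + β • b = c)
    (hnn : ∀ v, 0 ≤ w v - (if v = c then m else 0) + (if v = a then m * α else 0) +
      (if v = b then m * β else 0)) :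
    IsBary s (fun v => w v - (if v = c then m else 0) + (if v = a then m * α else 0) +
      (if v = b then m * β else 0)) x where
  nonneg := hnn
  supp v hv := by
    have h1 : v ≠ a := fun h => hv (h ▸ ha)
    have h2 : v ≠ b := fun h => hv (h ▸ hb)
    have h3 : v ≠ c := fun h => hv (h ▸ hc)
    simp [h1, h2, h3, h.supp v hv]
  sum := by
    simp only [Finset.sum_add_distrib, Finset.sum_sub_distrib, Finset.sum_ite_eq', ha, hb, hc,
      if_true, h.sum]
    linear_combination m * hαβ
  eq := by
    simp only [add_smul, sub_smul, ite_smul, zero_smul, Finset.sum_add_distrib,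
      Finset.sum_sub_distrib, Finset.sum_ite_eq', ha, hb, hc, if_true, h.eq]
    rw [← hcab]
    module

end Stellar

namespace Geometry.SimplicialComplex

variable {V : Type*} [AddCommGroup V] [Module ℝ V]

/-- `K'` is a subdivision of `K`. -/
def Subdivides (K' K : SimplicialComplex ℝ V) : Prop :=
  K'.space = K.space ∧
    ∀ s ∈ K'.faces, ∃ t ∈ K.faces, convexHull ℝ (s : Set V) ⊆ convexHull ℝ (t : Set V)

theorem Subdivides.refl (K : SimplicialComplex ℝ V) : K.Subdivides K :=
  ⟨rfl, fun s hs => ⟨s, hs, Subset.rfl⟩⟩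

theorem Subdivides.trans {K₁ K₂ K₃ : SimplicialComplex ℝ V} (h : K₁.Subdivides K₂)
    (h' : K₂.Subdivides K₃) : K₁.Subdivides K₃ := by
  refine ⟨h.1.trans h'.1, fun s hs => ?_⟩
  obtain ⟨t, ht, hst⟩ := h.2 s hs
  obtain ⟨u, hu, htu⟩ := h'.2 t ht
  exact ⟨u, hu, hst.trans htu⟩

open Classical in
/-- Starring an edge `{a, b}` of a finite simplicial complex at an interior point `c`. -/
theorem exists_stellar (K : SimplicialComplex ℝ V) (hK : K.faces.Finite) {a b c : V} {α β : ℝ}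
    (hab : ({a, b} : Finset V) ∈ K.faces) (hne : a ≠ b) (hα : 0 < α) (hβ : 0 < β)
    (hαβ : α + β = 1) (hcab : α • a + β • b = c) :
    ∃ K' : SimplicialComplex ℝ V, K'.faces.Finite ∧ K'.Subdivides K ∧
      ∀ s, s ∈ K'.faces ↔ ¬ (a ∈ s ∧ b ∈ s) ∧
        (s ∈ K.faces ∨ (c ∈ s ∧ insert a (insert b (s.erase c)) ∈ K.faces)) := by
  have hca : c ≠ a := by
    rintro rfl
    have h1 : β • (b - c) = 0 := by
      have : (α + β) • c = c := by rw [hαβ, one_smul]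
      rw [add_smul] at this
      rw [smul_sub, sub_eq_zero]
      exact add_left_cancel (hcab.trans this.symm)
    rcases smul_eq_zero.1 h1 with h | h
    · exact hβ.ne' h
    · exact hne (sub_eq_zero.1 h).symm
  have hcb : c ≠ b := by
    rintro rfl
    have h1 : α • (a - c) = 0 := by
      have : (α + β) • c = c := by rw [hαβ, one_smul]
      rw [add_smul] at this
      rw [smul_sub, sub_eq_zero]
      exact add_right_cancel (hcab.trans this.symm)
    rcases smul_eq_zero.1 h1 with h | h
    · exact hα.ne' h
    · exact hne (sub_eq_zero.1 h)
  -- On the edge `c` has positive weight at `a`; were it a vertex, it would also have all its weight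
  -- at itself, against uniqueness.
  have hcK : ∀ s ∈ K.faces, c ∉ s := by
    intro s hs hcs
    have h1 : IsBary s (fun v => if v = c then 1 else 0) c := by
      refine ⟨fun v => by split_ifs <;> norm_num, fun v hv => ?_, by simp [hcs], by simp [hcs]⟩
      simp [show v ≠ c from fun h => hv (h ▸ hcs)]
    have h2 : IsBary {a, b} (fun v => if v = a then α else if v = b then β else 0) c := by
      refine ⟨fun v => by split_ifs <;> positivity, fun v hv => ?_, ?_, ?_⟩
      · simp only [Finset.mem_insert, Finset.mem_singleton, not_or] at hv
        simp [hv.1, hv.2]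
      · rw [Finset.sum_pair hne]; simp [hne.symm, hαβ]
      · rw [Finset.sum_pair hne]; simp [hne.symm, hcab]
    have := congrFun (K.isBary_unique hs hab h1 h2) a
    simp [hca.symm] at this
    exact hα.ne this
  set F : Set (Finset V) := {s | ¬ (a ∈ s ∧ b ∈ s) ∧
    (s ∈ K.faces ∨ (c ∈ s ∧ insert a (insert b (s.erase c)) ∈ K.faces))} with hF
  -- Splitting the weight at `c` between `a` and `b` turns weights on a new face into weights on a
  -- face of `K` with the same barycentre.
  let push : (V → ℝ) → V → ℝ := fun w v => w v - (if v = c then w c else 0) +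
      (if v = a then w c * α else 0) + (if v = b then w c * β else 0)
  have hpush : ∀ s ∈ F, ∃ t ∈ K.faces, ∀ w x, IsBary s w x → IsBary t (push w) x := by
    rintro s ⟨-, hs | ⟨hcs, hs⟩⟩
    · refine ⟨s, hs, fun w x hw => ?_⟩
      have : push w = w := by
        funext v
        simp [push, hw.supp c (hcK s hs)]
      rwa [this]
    · refine ⟨_, hs, fun w x hw => ?_⟩
      have hw' := hw.mono (Finset.subset_insert b s)
      have hw'' := hw'.mono (Finset.subset_insert a (insert b s))
      have key := hw''.shift (c := c) (w c) (Finset.mem_insert_self a _) (by simp) (by simp [hcs])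
        hαβ hcab ?_
      · refine key.restrict ?_ ?_
        · intro v; simp only [Finset.mem_insert, Finset.mem_erase]; tauto
        · intro v hv hv'
          have : v = c := by
            simp only [Finset.mem_insert, Finset.mem_erase] at hv hv'; tauto
          subst this
          simp [hca, hcb]
      · intro v
        have h1 := hw.nonneg v
        have h2 := hw.nonneg c
        have h3 := mul_nonneg h2 hα.le
        have h4 := mul_nonneg h2 hβ.le
        by_cases hvc : v = c
        · subst hvc; simp [hca, hcb]
        · simp only [hvc, if_false]; split_ifs <;> linarith
  -- A new face omits `a` or `b`, so `w c` is recovered as the smaller of `push w a / α` and `push w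
  -- b / β`.
  have hpush_inj : ∀ s ∈ F, ∀ t ∈ F, ∀ w w' x, IsBary s w x → IsBary t w' x → push w = push w' →
      w = w' := by
    intro s hs t ht w w' x hw hw' hpp
    have e : ∀ v, push w v = push w' v := congrFun hpp
    have ea := e a
    have eb := e b
    simp only [push, hca.symm, hcb.symm, hne, hne.symm, if_true, if_false] at ea eb
    have za : w a = 0 ∨ w b = 0 := by
      by_cases h : a ∈ s
      · exact Or.inr (hw.supp b fun h' => hs.1 ⟨h, h'⟩)
      · exact Or.inl (hw.supp a h)
    have zb : w' a = 0 ∨ w' b = 0 := by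
      by_cases h : a ∈ t
      · exact Or.inr (hw'.supp b fun h' => ht.1 ⟨h, h'⟩)
      · exact Or.inl (hw'.supp a h)
    have n1 := hw.nonneg a
    have n2 := hw.nonneg b
    have n3 := hw'.nonneg a
    have n4 := hw'.nonneg b
    have hm : w c = w' c := by
      rcases lt_trichotomy (w c) (w' c) with h | h | h
      · have := mul_lt_mul_of_pos_right h hα
        have := mul_lt_mul_of_pos_right h hβ
        rcases za with h | h <;> linarith
      · exact h
      · have := mul_lt_mul_of_pos_right h hα
        have := mul_lt_mul_of_pos_right h hβ
        rcases zb with h | h <;> linarith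
    funext v
    have ev := e v
    simp only [push, hm] at ev
    by_cases hvc : v = c
    · rw [hvc, hm]
    · linarith
  have hFne : ∀ s ∈ F, s.Nonempty := by
    rintro s ⟨-, hs | ⟨hcs, -⟩⟩
    · exact K.nonempty_of_mem_faces hs
    · exact ⟨c, hcs⟩
  have hFdown : ∀ s ∈ F, ∀ t ⊆ s, t.Nonempty → t ∈ F := by
    rintro s ⟨hs1, hs⟩ t hts htne
    refine ⟨fun h => hs1 ⟨hts h.1, hts h.2⟩, ?_⟩
    rcases hs with hs | ⟨hcs, hs⟩
    · exact Or.inl (K.down_closed hs hts htne)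
    · by_cases hct : c ∈ t
      · refine Or.inr ⟨hct, K.down_closed hs ?_ (Finset.insert_nonempty _ _)⟩
        exact Finset.insert_subset_insert _ (Finset.insert_subset_insert _
          (Finset.erase_subset_erase _ hts))
      · refine Or.inl (K.down_closed hs ?_ htne)
        intro v hv
        have h1 : v ≠ c := fun h => hct (h ▸ hv)
        have h2 := hts hv
        simp [h1, h2]
  refine ⟨ofUnique F hFne hFdown ?_, ?_, ⟨?_, ?_⟩, fun s => Iff.rfl⟩
  · intro s hs t ht w w' x hw hw'
    obtain ⟨s', hs', hs''⟩ := hpush s hs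
    obtain ⟨t', ht', ht''⟩ := hpush t ht
    exact hpush_inj s hs t ht w w' x hw hw'
      (K.isBary_unique hs' ht' (hs'' w x hw) (ht'' w' x hw'))
  · refine ((hK.biUnion (t := fun t => ((insert c t).powerset : Set (Finset V)))
      fun t _ => Finset.finite_toSet _)).subset ?_
    rintro s ⟨-, hs | ⟨hcs, hs⟩⟩
    · exact mem_biUnion hs (Finset.mem_coe.2 (Finset.mem_powerset.2 (Finset.subset_insert _ _)))
    · refine mem_biUnion hs (Finset.mem_coe.2 (Finset.mem_powerset.2 ?_))
      intro v hv
      by_cases h1 : v = c <;> simp [h1, hv]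
  · apply Subset.antisymm
    · intro x hx
      obtain ⟨s, hs, hxs⟩ := mem_space_iff.1 hx
      obtain ⟨w, hw⟩ := exists_isBary hxs
      obtain ⟨t, ht, hst⟩ := hpush s hs
      exact mem_space_iff.2 ⟨t, ht, (hst w x hw).mem⟩
    · intro x hx
      obtain ⟨t, ht, hxt⟩ := mem_space_iff.1 hx
      obtain ⟨w, hw⟩ := exists_isBary hxt
      have hct := hcK t ht
      by_cases hcase : a ∈ t ∧ b ∈ t
      · have hw' := hw.mono (Finset.subset_insert c t)
        -- `m` is the largest weight that can be moved from `a` and `b` to `c`; moving it exhausts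
        -- one of the two, which is then dropped from the face.
        have hmin : ∃ m, 0 ≤ m ∧ m * α ≤ w a ∧ m * β ≤ w b ∧ (m * α = w a ∨ m * β = w b) := by
          refine ⟨min (w a / α) (w b / β), le_min (div_nonneg (hw.nonneg a) hα.le)
            (div_nonneg (hw.nonneg b) hβ.le), ?_, ?_, ?_⟩
          · rw [← le_div_iff₀ hα]; exact min_le_left _ _
          · rw [← le_div_iff₀ hβ]; exact min_le_right _ _
          · rcases min_choice (w a / α) (w b / β) with h | h <;> rw [h]
            · left; field_simp
            · right; field_simp
        obtain ⟨m, hm0, hma, hmb, hmab⟩ := hmin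
        have key := hw'.shift (c := c) (-m) (Finset.mem_insert_of_mem hcase.1)
          (Finset.mem_insert_of_mem hcase.2) (Finset.mem_insert_self _ _) hαβ hcab (by
            intro v
            have h1 := hw.nonneg v
            by_cases hva : v = a
            · subst hva; simp [hne, hca.symm]; linarith
            · by_cases hvb : v = b
              · subst hvb; simp [hne.symm, hcb.symm]; linarith
              · simp only [hva, hvb, if_false]; split_ifs <;> linarith)
        rcases hmab with hm | hm
        · refine mem_space_iff.2 ⟨insert c (t.erase a), ?_, (key.restrict ?_ ?_).mem⟩
          · refine ⟨by simp [hca.symm], Or.inr ⟨Finset.mem_insert_self _ _, ?_⟩⟩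
            convert ht using 1
            ext v
            simp only [Finset.mem_insert, Finset.mem_erase]
            constructor
            · rintro (rfl | rfl | h)
              · exact hcase.1
              · exact hcase.2
              · tauto
            · intro hv
              have : v ≠ c := fun h => hct (h ▸ hv)
              tauto
          · exact Finset.insert_subset_insert _ (Finset.erase_subset _ _)
          · intro v hv hv'
            have : v = a := by
              simp only [Finset.mem_insert, Finset.mem_erase] at hv hv'; tauto
            subst this
            simp [hca.symm, hne, hm]
        · refine mem_space_iff.2 ⟨insert c (t.erase b), ?_, (key.restrict ?_ ?_).mem⟩
          · refine ⟨by simp [hcb.symm], Or.inr ⟨Finset.mem_insert_self _ _, ?_⟩⟩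
            convert ht using 1
            ext v
            simp only [Finset.mem_insert, Finset.mem_erase]
            constructor
            · rintro (rfl | rfl | h)
              · exact hcase.1
              · exact hcase.2
              · tauto
            · intro hv
              have : v ≠ c := fun h => hct (h ▸ hv)
              tauto
          · exact Finset.insert_subset_insert _ (Finset.erase_subset _ _)
          · intro v hv hv'
            have : v = b := by
              simp only [Finset.mem_insert, Finset.mem_erase] at hv hv'; tauto
            subst this
            simp [hcb.symm, hne.symm, hm]
      · exact mem_space_iff.2 ⟨t, ⟨hcase, Or.inl ht⟩, hxt⟩
  · intro s hs
    obtain ⟨t, ht, hst⟩ := hpush s hs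
    refine ⟨t, ht, fun x hx => ?_⟩
    obtain ⟨w, hw⟩ := exists_isBary hx
    exact (hst w x hw).mem

/-- `h` does not change sign on any face of `K`. -/
def SignConst (K : SimplicialComplex ℝ V) (h : V →ᵃ[ℝ] ℝ) : Prop :=
  ∀ s ∈ K.faces, (∀ v ∈ convexHull ℝ (s : Set V), 0 ≤ h v) ∨
    (∀ v ∈ convexHull ℝ (s : Set V), h v ≤ 0)

theorem SignConst.mono {K K' : SimplicialComplex ℝ V} {h : V →ᵃ[ℝ] ℝ} (hK : K.SignConst h)
    (hKK : K'.Subdivides K) : K'.SignConst h := by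
  intro s hs
  obtain ⟨t, ht, hst⟩ := hKK.2 s hs
  exact (hK t ht).imp (fun H v hv => H v (hst hv)) (fun H v hv => H v (hst hv))

theorem affine_nonneg_on_convexHull {s : Set V} {h : V →ᵃ[ℝ] ℝ} (hs : ∀ v ∈ s, 0 ≤ h v) :
    ∀ v ∈ convexHull ℝ s, 0 ≤ h v :=
  convexHull_min (t := h ⁻¹' Ici 0) hs ((convex_Ici 0).affine_preimage h)

theorem affine_nonpos_on_convexHull {s : Set V} {h : V →ᵃ[ℝ] ℝ} (hs : ∀ v ∈ s, h v ≤ 0) :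
    ∀ v ∈ convexHull ℝ s, h v ≤ 0 :=
  convexHull_min (t := h ⁻¹' Iic 0) hs ((convex_Iic 0).affine_preimage h)

/-- Starring an edge at the zero of `h` on it removes a pair of vertices of opposite signs and
creates none, since `h` vanishes at the new vertex. Hence induction on the number of such pairs. -/
theorem exists_subdivision_signConst_one (h : V →ᵃ[ℝ] ℝ) (n : ℕ) :
    ∀ K : SimplicialComplex ℝ V, K.faces.Finite →
    {p : V × V | ∃ s ∈ K.faces, p.1 ∈ s ∧ p.2 ∈ s ∧ 0 < h p.1 ∧ h p.2 < 0}.ncard ≤ n →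
    ∃ K' : SimplicialComplex ℝ V, K'.faces.Finite ∧ K'.Subdivides K ∧ K'.SignConst h := by
  classical
  have hfin : ∀ K : SimplicialComplex ℝ V, K.faces.Finite →
      {p : V × V | ∃ s ∈ K.faces, p.1 ∈ s ∧ p.2 ∈ s ∧ 0 < h p.1 ∧ h p.2 < 0}.Finite := by
    intro K hK
    refine (hK.biUnion (t := fun s => ((s ×ˢ s : Finset (V × V)) : Set (V × V)))
      fun t _ => Finset.finite_toSet _).subset ?_
    rintro p ⟨s, hs, h1, h2, -, -⟩
    exact mem_biUnion hs (by simp [h1, h2])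
  induction n with
  | zero =>
    intro K hK hn
    refine ⟨K, hK, Subdivides.refl K, fun s hs => ?_⟩
    have hempty := (Set.ncard_eq_zero (hfin K hK)).1 (Nat.le_zero.1 hn)
    by_cases hp : ∃ a ∈ s, 0 < h a
    · obtain ⟨a, ha, ha0⟩ := hp
      left
      refine affine_nonneg_on_convexHull fun v hv => ?_
      by_contra hv0
      have : (a, v) ∈ (∅ : Set (V × V)) := hempty ▸ ⟨s, hs, ha, hv, ha0, not_le.1 hv0⟩
      exact this
    · push Not at hp
      exact Or.inr (affine_nonpos_on_convexHull hp)
  | succ n ih =>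
    intro K hK hn
    set C := {p : V × V | ∃ s ∈ K.faces, p.1 ∈ s ∧ p.2 ∈ s ∧ 0 < h p.1 ∧ h p.2 < 0} with hC
    by_cases hCe : C = ∅
    · exact ih K hK (by rw [← hC, hCe]; simp)
    obtain ⟨⟨a, b⟩, s, hs, ha, hb, ha0, hb0⟩ := nonempty_iff_ne_empty.2 hCe
    simp only at ha hb ha0 hb0
    have hab : ({a, b} : Finset V) ∈ K.faces := by
      refine K.down_closed hs ?_ (Finset.insert_nonempty _ _)
      intro v hv
      rcases Finset.mem_insert.1 hv with rfl | hv
      · exact ha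
      · rw [Finset.mem_singleton.1 hv]; exact hb
    have hne : a ≠ b := by rintro rfl; exact lt_asymm ha0 hb0
    have hd : 0 < h a - h b := by linarith
    obtain ⟨K', hK'f, hK's, hK'⟩ := K.exists_stellar hK (α := -h b / (h a - h b))
      (β := h a / (h a - h b)) hab hne (div_pos (by linarith) hd) (div_pos ha0 hd)
      (by field_simp; ring) rfl
    set c := (-h b / (h a - h b)) • a + (h a / (h a - h b)) • b with hc
    have hc0 : h c = 0 := by
      have h1 : c = AffineMap.lineMap a b (h a / (h a - h b)) := by
        rw [AffineMap.lineMap_apply_module, hc]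
        congr 2
        field_simp; ring
      rw [h1, AffineMap.apply_lineMap, AffineMap.lineMap_apply_module, smul_eq_mul, smul_eq_mul]
      field_simp; ring
    have hsub : {p : V × V | ∃ s ∈ K'.faces, p.1 ∈ s ∧ p.2 ∈ s ∧ 0 < h p.1 ∧ h p.2 < 0} ⊆
        C \ {(a, b)} := by
      rintro ⟨p, q⟩ ⟨t, ht, hp, hq, hp0, hq0⟩
      simp only at hp hq hp0 hq0
      obtain ⟨h1, h2⟩ := (hK' t).1 ht
      refine ⟨?_, ?_⟩
      · rcases h2 with h2 | ⟨-, h2⟩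
        · exact ⟨t, h2, hp, hq, hp0, hq0⟩
        · have hpc : p ≠ c := by rintro rfl; linarith
          have hqc : q ≠ c := by rintro rfl; linarith
          exact ⟨_, h2, by simp [hpc, hp], by simp [hqc, hq], hp0, hq0⟩
      · intro h3
        obtain ⟨rfl, rfl⟩ := Prod.mk.inj (mem_singleton_iff.1 h3)
        exact h1 ⟨hp, hq⟩
    have hlt : (C \ {(a, b)}).ncard < C.ncard :=
      Set.ncard_lt_ncard (sdiff_singleton_ssubset.2 ⟨s, hs, ha, hb, ha0, hb0⟩) (hfin K hK)
    have hle := Set.ncard_le_ncard hsub ((hfin K hK).sdiff)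
    obtain ⟨K'', h1, h2, h3⟩ := ih K' hK'f (by omega)
    exact ⟨K'', h1, h2.trans hK's, h3⟩

theorem exists_subdivision_signConst (K : SimplicialComplex ℝ V) (hK : K.faces.Finite)
    (H : Set (V →ᵃ[ℝ] ℝ)) (hH : H.Finite) :
    ∃ K' : SimplicialComplex ℝ V, K'.faces.Finite ∧ K'.Subdivides K ∧
      ∀ h ∈ H, K'.SignConst h := by
  induction H, hH using Set.Finite.induction_on with
  | empty => exact ⟨K, hK, Subdivides.refl K, by simp⟩
  | insert _ _ ih =>
    rename_i h H _ _
    obtain ⟨K₁, h1, h2, h3⟩ := ih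
    obtain ⟨K₂, h4, h5, h6⟩ := exists_subdivision_signConst_one h _ K₁ h1 le_rfl
    refine ⟨K₂, h4, h5.trans h2, fun g hg => ?_⟩
    rcases hg with rfl | hg
    · exact h6
    · exact (h3 g hg).mono h5

end Geometry.SimplicialComplex

/-! ### Simplices as intersections of half-spaces. -/

section Halfspaces

variable {V W : Type*} [AddCommGroup V] [Module ℝ V] [AddCommGroup W] [Module ℝ W]

theorem AffineIndependent.exists_affineMap {s : Finset V}
    (hs : AffineIndependent ℝ ((↑) : s → V)) (g : V → W) :
    ∃ φ : V →ᵃ[ℝ] W, ∀ v ∈ s, φ v = g v := by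
  classical
  rcases s.eq_empty_or_nonempty with rfl | ⟨a, ha⟩
  · exact ⟨AffineMap.const ℝ V 0, by simp⟩
  have hli := (affineIndependent_iff_linearIndependent_vsub ℝ _ (⟨a, ha⟩ : s)).1 hs
  obtain ⟨L, hL⟩ : ∃ L : V →ₗ[ℝ] W, ∀ v : {x : s // x ≠ ⟨a, ha⟩},
      L ((v : V) -ᵥ a) = g v - g a := by
    obtain ⟨L, hL⟩ := LinearMap.exists_extend
      ((Module.Basis.span hli).constr ℝ fun v : {x : s // x ≠ ⟨a, ha⟩} => g v - g a)
    refine ⟨L, fun v => ?_⟩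
    have h1 := congrArg (fun f => f (Module.Basis.span hli v)) hL
    simp only [LinearMap.comp_apply, Submodule.subtype_apply] at h1
    rwa [Module.Basis.constr_basis, Module.Basis.span_apply] at h1
  refine ⟨L.toAffineMap.comp (AffineMap.id ℝ V - AffineMap.const ℝ V a) +
    AffineMap.const ℝ V (g a), fun v hv => ?_⟩
  by_cases hva : v = a
  · subst hva; simp
  · have := hL ⟨⟨v, hv⟩, fun h => hva (congrArg Subtype.val h)⟩
    simp only [vsub_eq_sub] at this
    simp [← map_sub, this]

/-- A nondegenerate simplex is an intersection of finitely many half-spaces. -/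
theorem AffineIndependent.exists_halfspaces [FiniteDimensional ℝ V] {s : Finset V}
    (hs : AffineIndependent ℝ ((↑) : s → V)) :
    ∃ H : Set (V →ᵃ[ℝ] ℝ), H.Finite ∧ ∀ x, x ∈ convexHull ℝ (s : Set V) ↔ ∀ h ∈ H, 0 ≤ h x := by
  classical
  obtain ⟨t, hst, ht, htop⟩ := exists_subset_affineIndependent_affineSpan_eq_top hs
  have htfin : t.Finite := finite_set_of_fin_dim_affineIndependent ℝ ht
  have : Fintype t := htfin.fintype
  let b : AffineBasis t ℝ V := ⟨((↑) : t → V), ht, by simpa using htop⟩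
  have hb : ∀ i : t, b i = i := fun i => rfl
  -- With `s` completed to an affine basis, its hull is where all coordinates are nonnegative and
  -- those outside `s` are also nonpositive.
  refine ⟨range (fun i => b.coord i) ∪ (fun i => -b.coord i) '' {i : t | (i : V) ∉ s},
    (finite_range _).union ((toFinite _).image _), fun x => ⟨fun hx => ?_, fun hx => ?_⟩⟩
  · rintro h (⟨i, rfl⟩ | ⟨i, hi, rfl⟩)
    · refine affine_nonneg_of hx fun v hv => ?_
      have := b.coord_apply i ⟨v, hst hv⟩
      rw [hb] at this
      simp only at this
      rw [this]; split_ifs <;> norm_num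
    · refine affine_nonneg_of hx fun v hv => ?_
      have := b.coord_apply i ⟨v, hst hv⟩
      rw [hb] at this
      simp only at this
      have hne : i ≠ ⟨v, hst hv⟩ := by rintro rfl; exact hi hv
      simp [this, hne]
  · have h0 : ∀ i, 0 ≤ b.coord i x := fun i => hx _ (Or.inl ⟨i, rfl⟩)
    have h1 : ∀ i : t, (i : V) ∉ s → b.coord i x = 0 := fun i hi =>
      le_antisymm (by simpa using hx _ (Or.inr ⟨i, hi, rfl⟩)) (h0 i)
    have h2 : ∑ i ∈ Finset.univ.filter (fun i : t => (i : V) ∈ s), b.coord i x = 1 := by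
      rw [← b.sum_coord_apply_eq_one x]
      refine Finset.sum_subset (Finset.filter_subset _ _) fun i _ hi => h1 i ?_
      simpa using hi
    have h3 : ∑ i ∈ Finset.univ.filter (fun i : t => (i : V) ∈ s), b.coord i x • b i = x := by
      conv_rhs => rw [← b.linear_combination_coord_eq_self x]
      refine Finset.sum_subset (Finset.filter_subset _ _) fun i _ hi => ?_
      rw [h1 i (by simpa using hi), zero_smul]
    rw [← h3]
    refine (convex_convexHull ℝ _).sum_mem (fun i _ => h0 i) h2 fun i hi => ?_
    exact subset_convexHull ℝ _ (Finset.mem_filter.1 hi).2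
where
  affine_nonneg_of {s : Set V} {h : V →ᵃ[ℝ] ℝ} {x : V} (hx : x ∈ convexHull ℝ s)
    (hs : ∀ v ∈ s, 0 ≤ h v) : 0 ≤ h x :=
  Geometry.SimplicialComplex.affine_nonneg_on_convexHull hs x hx

end Halfspaces

/-! ### Complexes compatible with a set. -/

namespace Geometry.SimplicialComplex

variable {V : Type*} [AddCommGroup V] [Module ℝ V]

/-- Every face of `K` whose relative interior meets `R` lies in `R`. -/
def Compat (K : SimplicialComplex ℝ V) (R : Set V) : Prop :=
  ∀ x s, x ∈ R → K.IsCarrier x s → convexHull ℝ (s : Set V) ⊆ R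

theorem Compat.iUnion₂ {K : SimplicialComplex ℝ V} {ι : Type*} {S : Set ι} {R : ι → Set V}
    (h : ∀ i ∈ S, K.Compat (R i)) : K.Compat (⋃ i ∈ S, R i) := by
  intro x s hx hs
  obtain ⟨i, hi, hxi⟩ := mem_iUnion₂.1 hx
  exact (h i hi x s hxi hs).trans (subset_biUnion_of_mem (u := R) hi)

/-- A form of the maximum principle: `x` has positive weight at each vertex of its carrier, so a
nonpositive affine function which is not negative at `x` vanishes at all these vertices. -/
theorem IsCarrier.eq_zero {K : SimplicialComplex ℝ V} {x : V} {s : Finset V}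
    (hs : K.IsCarrier x s) {h : V →ᵃ[ℝ] ℝ}
    (hneg : ∀ v ∈ convexHull ℝ (s : Set V), h v ≤ 0) (hx : 0 ≤ h x) :
    ∀ v ∈ convexHull ℝ (s : Set V), h v = 0 := by
  classical
  obtain ⟨w, hw⟩ := exists_isBary hs.2.1
  have hs' : ∀ v ∈ s, h v ≤ 0 := fun v hv => hneg v (subset_convexHull ℝ _ hv)
  have h0 : ∑ v ∈ s, w v * h v = 0 := by
    refine le_antisymm (Finset.sum_nonpos fun v hv => ?_) ?_
    · exact mul_nonpos_of_nonneg_of_nonpos (hw.nonneg v) (hs' v hv)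
    · have := hw.map_affine h
      simp only [smul_eq_mul] at this
      rwa [← this]
  rw [Finset.sum_eq_zero_iff_of_nonpos
    (fun v hv => mul_nonpos_of_nonneg_of_nonpos (hw.nonneg v) (hs' v hv))] at h0
  have hb : IsBary (s.filter (fun v => h v = 0)) w x :=
    hw.restrict (Finset.filter_subset _ _) fun v hv hv' => by
      rcases mul_eq_zero.1 (h0 v hv) with h1 | h1
      · exact h1
      · exact absurd (Finset.mem_filter.2 ⟨hv, h1⟩) hv'
  have hne : (s.filter (fun v => h v = 0)).Nonempty := by
    rw [← Finset.coe_nonempty, ← convexHull_nonempty_iff (𝕜 := ℝ)]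
    exact ⟨x, hb.mem⟩
  have hsub := hs.2.2 _ (K.down_closed hs.1 (Finset.filter_subset _ _) hne) hb.mem
  intro v hv
  refine le_antisymm (hneg v hv) (affine_nonneg_on_convexHull (fun u hu => ?_) v hv)
  exact (Finset.mem_filter.1 (hsub hu)).2.ge

theorem compat_of_signConst {K : SimplicialComplex ℝ V} {H : Set (V →ᵃ[ℝ] ℝ)} {R : Set V}
    (hR : ∀ x, x ∈ R ↔ ∀ h ∈ H, 0 ≤ h x) (hK : ∀ h ∈ H, K.SignConst h) : K.Compat R := by
  intro x s hx hs v hv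
  refine (hR v).2 fun h hh => ?_
  rcases hK h hh s hs.1 with h1 | h1
  · exact h1 v hv
  · exact (hs.eq_zero h1 ((hR x).1 hx h hh) v hv).ge

theorem exists_isCarrier_of_mem_faces (K : SimplicialComplex ℝ V) {s : Finset V}
    (hs : s ∈ K.faces) : ∃ x, K.IsCarrier x s := by
  classical
  have hpos : (0 : ℝ) < s.card := Nat.cast_pos.2 (Finset.card_pos.2 (K.nonempty_of_mem_faces hs))
  have hw : IsBary s (fun v => if v ∈ s then (s.card : ℝ)⁻¹ else 0)
      (∑ v ∈ s, (if v ∈ s then (s.card : ℝ)⁻¹ else 0) • v) := by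
    refine ⟨fun v => by split_ifs <;> positivity, fun v hv => by simp [hv], ?_, rfl⟩
    rw [Finset.sum_congr rfl (fun v hv => if_pos hv : ∀ v ∈ s, _ = (s.card : ℝ)⁻¹)]
    simp [hpos.ne']
  refine ⟨_, hs, hw.mem, fun t ht hxt v hv => ?_⟩
  obtain ⟨w', hw'⟩ := exists_isBary hxt
  have := congrFun (K.isBary_unique hs ht hw hw') v
  by_contra hvt
  rw [hw'.supp v hvt] at this
  simp only [hv, if_true] at this
  exact (inv_pos.2 hpos).ne' this

/-- The complex of all faces of one simplex. -/
def ofSimplex (s : Finset V) (hs : AffineIndependent ℝ ((↑) : s → V)) : SimplicialComplex ℝ V :=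
  ofUnique {t | t ⊆ s ∧ t.Nonempty} (fun _ h => h.2)
    (fun _ h _ hu hne => ⟨hu.trans h.1, hne⟩)
    (fun _ ht _ hu _ _ _ hw hw' => hs.isBary_unique (hw.mono ht.1) (hw'.mono hu.1))

theorem ofSimplex_finite (s : Finset V) (hs : AffineIndependent ℝ ((↑) : s → V)) :
    (ofSimplex s hs).faces.Finite :=
  (Finset.finite_toSet s.powerset).subset fun _ ht => Finset.mem_coe.2 (Finset.mem_powerset.2 ht.1)

theorem subset_space_ofSimplex (s : Finset V) (hs : AffineIndependent ℝ ((↑) : s → V)) :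
    convexHull ℝ (s : Set V) ⊆ (ofSimplex s hs).space := fun _ hx =>
  mem_space_iff.2 ⟨s, ⟨Subset.rfl, Finset.coe_nonempty.1 (convexHull_nonempty_iff.1 ⟨_, hx⟩)⟩, hx⟩

end Geometry.SimplicialComplex

theorem Finset.isCompact_convexHull {E : Type*} [NormedAddCommGroup E] [NormedSpace ℝ E]
    (s : Finset E) : IsCompact (convexHull ℝ (s : Set E)) :=
  s.finite_toSet.isCompact_convexHull (𝕜 := ℝ)

/-! ### Fine triangulations compatible with given polytopes. -/

section Triangulate

open Geometry Geometry.SimplicialComplex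

variable {E : Type*} [NormedAddCommGroup E] [NormedSpace ℝ E] [FiniteDimensional ℝ E]

theorem exists_small_simplex (x : E) {U : Set E} (hU : U ∈ 𝓝 x) :
    ∃ s : Finset E, AffineIndependent ℝ ((↑) : s → E) ∧ convexHull ℝ (s : Set E) ∈ 𝓝 x ∧
      convexHull ℝ (s : Set E) ⊆ U := by
  classical
  obtain ⟨b, hb, hbU⟩ := exists_mem_interior_convexHull_affineBasis hU
  have hr : (range b).Finite := finite_range _
  refine ⟨hr.toFinset, ?_, ?_, ?_⟩
  · have h1 := b.ind.range
    have h2 : ∀ p : E, p ∈ hr.toFinset ↔ p ∈ range b := fun p => hr.mem_toFinset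
    exact h1.comp_embedding (Equiv.subtypeEquivRight h2).toEmbedding
  · rw [hr.coe_toFinset]; exact mem_interior_iff_mem_nhds.1 hb
  · rwa [hr.coe_toFinset]

theorem exists_big_simplex {B : Set E} (hB : Bornology.IsBounded B) :
    ∃ s : Finset E, AffineIndependent ℝ ((↑) : s → E) ∧ B ⊆ convexHull ℝ (s : Set E) := by
  classical
  obtain ⟨s, hs, hs0, -⟩ := exists_small_simplex (0 : E) Filter.univ_mem
  obtain ⟨r, hr, hrs⟩ := Metric.mem_nhds_iff.1 hs0
  obtain ⟨R, hR, hBR⟩ := hB.subset_ball_lt 0 0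
  have hc : (0 : ℝ) < R / r := div_pos hR hr
  let g : E →ₗ[ℝ] E := (R / r) • LinearMap.id
  have hg : Function.Injective g := fun x y h => smul_right_injective E hc.ne' h
  refine ⟨s.image g, ?_, fun x hx => ?_⟩
  · have h1 := (hs.map' g.toAffineMap hg).range
    have h2 : ∀ p : E, p ∈ s.image g ↔ p ∈ range (g.toAffineMap ∘ ((↑) : s → E)) := fun p => by
      simp
    exact h1.comp_embedding (Equiv.subtypeEquivRight h2).toEmbedding
  · rw [Finset.coe_image, ← LinearMap.image_convexHull]
    refine ⟨(R / r)⁻¹ • x, hrs ?_, ?_⟩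
    · have := mem_ball_zero_iff.1 (hBR hx)
      rw [mem_ball_zero_iff, norm_smul, norm_inv, Real.norm_of_nonneg hc.le, inv_div]
      calc r / R * ‖x‖ < r / R * R := by gcongr
        _ = r := by field_simp
    · change (R / r) • ((R / r)⁻¹ • x) = x
      rw [smul_smul, mul_inv_cancel₀ hc.ne', one_smul]

/-- A finite, arbitrarily fine simplicial complex compatible with given polytopes. -/
theorem exists_triangulation (S : Set (Finset E)) (hS : S.Finite) {η : ℝ} (hη : 0 < η) :
    ∃ L : SimplicialComplex ℝ E, L.faces.Finite ∧
      (∀ s ∈ S, convexHull ℝ (s : Set E) ⊆ L.space ∧ L.Compat (convexHull ℝ (s : Set E))) ∧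
      ∀ s ∈ L.faces, ∀ x ∈ convexHull ℝ (s : Set E), ∀ y ∈ convexHull ℝ (s : Set E),
        dist x y < η := by
  classical
  have hb : Bornology.IsBounded (⋃ s ∈ S, convexHull ℝ (s : Set E)) :=
    (Bornology.isBounded_biUnion hS).2 fun s _ => s.isCompact_convexHull.isBounded
  obtain ⟨Δ, hΔ, hsub⟩ := exists_big_simplex hb
  choose σ hσ1 hσ2 hσ3 using fun x : E =>
    exists_small_simplex x (Metric.ball_mem_nhds x (half_pos hη))
  obtain ⟨T, -, hT⟩ := (Δ.isCompact_convexHull).elim_nhds_subcover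
    (fun x => convexHull ℝ (σ x : Set E)) (fun x _ => hσ2 x)
  -- Two kinds of simplices are respected: those which make up the given polytopes by Carathéodory's
  -- theorem, and small ones covering `Δ`, which bound the mesh.
  set 𝓡 : Set (Finset E) := {r | (∃ s ∈ S, r ⊆ s) ∧ AffineIndependent ℝ ((↑) : r → E)} ∪
    σ '' (T : Set E) with h𝓡
  have h𝓡fin : 𝓡.Finite := by
    refine Set.Finite.union ?_ (T.finite_toSet.image _)
    refine (hS.biUnion (t := fun s => (s.powerset : Set (Finset E)))
      fun s _ => Finset.finite_toSet _).subset ?_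
    rintro r ⟨⟨s, hs, hrs⟩, -⟩
    exact mem_biUnion hs (Finset.mem_coe.2 (Finset.mem_powerset.2 hrs))
  have hind : ∀ r ∈ 𝓡, AffineIndependent ℝ ((↑) : r → E) := by
    rintro r (h | ⟨x, -, rfl⟩)
    · exact h.2
    · exact hσ1 x
  choose! H hHfin hH using fun r hr => (hind r hr).exists_halfspaces
  obtain ⟨L, hL1, hL2, hL3⟩ := exists_subdivision_signConst (ofSimplex Δ hΔ)
    (ofSimplex_finite Δ hΔ) (⋃ r ∈ 𝓡, H r) (h𝓡fin.biUnion hHfin)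
  have hcomp : ∀ r ∈ 𝓡, L.Compat (convexHull ℝ (r : Set E)) := fun r hr =>
    compat_of_signConst (hH r hr) fun h hh => hL3 h (mem_biUnion hr hh)
  have hspace : convexHull ℝ (Δ : Set E) ⊆ L.space := by
    rw [hL2.1]; exact subset_space_ofSimplex Δ hΔ
  refine ⟨L, hL1, fun s hs => ⟨?_, ?_⟩, fun s hs x hx y hy => ?_⟩
  · exact (subset_biUnion_of_mem (u := fun s : Finset E => convexHull ℝ (s : Set E)) hs).trans
      (hsub.trans hspace)
  · have hcar : convexHull ℝ (s : Set E) = ⋃ r ∈ {r : Finset E | r ⊆ s ∧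
        AffineIndependent ℝ ((↑) : r → E)}, convexHull ℝ (r : Set E) := by
      rw [convexHull_eq_union]
      ext x
      simp only [mem_iUnion, mem_ofPred_eq, Finset.coe_subset, exists_prop, and_assoc]
    rw [hcar]
    exact Compat.iUnion₂ fun r hr => hcomp r (Or.inl ⟨⟨s, hs, hr.1⟩, hr.2⟩)
  -- A relative interior point of the face lies in one of the small simplices, and compatibility
  -- puts the whole face there.
  · obtain ⟨z, hz⟩ := L.exists_isCarrier_of_mem_faces hs
    have hzΔ : z ∈ convexHull ℝ (Δ : Set E) := by
      obtain ⟨t, ht, hst⟩ := hL2.2 s hs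
      exact convexHull_mono (Finset.coe_subset.2 ht.1) (hst hz.2.1)
    obtain ⟨p, hp, hzp⟩ := mem_iUnion₂.1 (hT hzΔ)
    have h1 := (hcomp _ (Or.inr ⟨p, hp, rfl⟩) z s hzp hz).trans (hσ3 p)
    calc dist x y ≤ dist x p + dist y p := dist_triangle_right _ _ _
      _ < η / 2 + η / 2 := add_lt_add (h1 hx) (h1 hy)
      _ = η := add_halves η

end Triangulate

/-! ### Polyhedral sets and calculus of PL maps. -/

section ConvexAffine

variable {V W W' : Type*} [AddCommGroup V] [Module ℝ V] [AddCommGroup W] [Module ℝ W]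
  [AddCommGroup W'] [Module ℝ W']

/-- `F` preserves convex combinations of points of `C`. -/
def ConvexAffineOn (F : V → W) (C : Set V) : Prop :=
  ∀ x ∈ C, ∀ y ∈ C, ∀ a b : ℝ, 0 ≤ a → 0 ≤ b → a + b = 1 →
    F (a • x + b • y) = a • F x + b • F y

theorem ConvexAffineOn.mono {F : V → W} {C D : Set V} (h : ConvexAffineOn F D) (hCD : C ⊆ D) :
    ConvexAffineOn F C := fun x hx y hy => h x (hCD hx) y (hCD hy)

theorem ConvexAffineOn.congr {F G : V → W} {C : Set V} (h : ConvexAffineOn F C)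
    (hC : Convex ℝ C) (hFG : EqOn G F C) : ConvexAffineOn G C := by
  intro x hx y hy a b ha hb hab
  rw [hFG (hC hx hy ha hb hab), hFG hx, hFG hy, h x hx y hy a b ha hb hab]

theorem AffineMap.convexAffineOn (φ : V →ᵃ[ℝ] W) (C : Set V) : ConvexAffineOn φ C := by
  intro x _ y _ a b _ _ hab
  exact Convex.combo_affine_apply hab

theorem ConvexAffineOn.prodMk {F : V → W} {G : V → W'} {C : Set V} (hF : ConvexAffineOn F C)
    (hG : ConvexAffineOn G C) : ConvexAffineOn (fun x => (F x, G x)) C := by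
  intro x hx y hy a b ha hb hab
  simp only [hF x hx y hy a b ha hb hab, hG x hx y hy a b ha hb hab, Prod.smul_mk, Prod.mk_add_mk]

theorem ConvexAffineOn.linear_comp {F : V → W} {C : Set V} (hF : ConvexAffineOn F C)
    (L : W →ₗ[ℝ] W') : ConvexAffineOn (fun x => L (F x)) C := by
  intro x hx y hy a b ha hb hab
  simp only [hF x hx y hy a b ha hb hab, map_add, map_smul]

theorem ConvexAffineOn.comp_linear {F : W → W'} {C : Set V} (L : V →ₗ[ℝ] W)
    (hF : ConvexAffineOn F (L '' C)) : ConvexAffineOn (fun x => F (L x)) C := by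
  intro x hx y hy a b ha hb hab
  simp only [map_add, map_smul]
  exact hF _ (mem_image_of_mem _ hx) _ (mem_image_of_mem _ hy) a b ha hb hab

theorem ConvexAffineOn.eqOn_affine {F : V → W} {s : Finset V}
    (hF : ConvexAffineOn F (convexHull ℝ (s : Set V))) (φ : V →ᵃ[ℝ] W)
    (h : ∀ v ∈ s, F v = φ v) : EqOn F φ (convexHull ℝ (s : Set V)) := by
  have hconv : Convex ℝ {x ∈ convexHull ℝ (s : Set V) | F x = φ x} := by
    intro x hx y hy a b ha hb hab
    refine ⟨convex_convexHull ℝ _ hx.1 hy.1 ha hb hab, ?_⟩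
    rw [hF x hx.1 y hy.1 a b ha hb hab, hx.2, hy.2, Convex.combo_affine_apply hab]
  exact fun x hx => (convexHull_min (t := {x ∈ convexHull ℝ (s : Set V) | F x = φ x})
    (fun v hv => ⟨subset_convexHull ℝ _ hv, h v hv⟩) hconv hx).2

/-- A finite union of polytopes. -/
def IsPolyhedral (X : Set V) : Prop :=
  ∃ S : Set (Finset V), S.Finite ∧ X = ⋃ s ∈ S, convexHull ℝ (s : Set V)

/-- `X` is a finite union of polytopes on each of which `F` preserves convex combinations. -/
def HasPLCover (F : V → W) (X : Set V) : Prop :=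
  ∃ S : Set (Finset V), S.Finite ∧ X = (⋃ s ∈ S, convexHull ℝ (s : Set V)) ∧
    ∀ s ∈ S, ConvexAffineOn F (convexHull ℝ (s : Set V))

theorem HasPLCover.isPolyhedral {F : V → W} {X : Set V} (h : HasPLCover F X) :
    IsPolyhedral X := by
  obtain ⟨S, h1, h2, -⟩ := h
  exact ⟨S, h1, h2⟩

theorem IsPLOn.hasPLCover {F : V → W} {X : Set V} (h : IsPLOn F X) : HasPLCover F X := by
  obtain ⟨K, hK, hKX, hF⟩ := h
  refine ⟨K.faces, hK, hKX.symm, fun s hs => ?_⟩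
  obtain ⟨φ, hφ⟩ := hF s hs
  exact (φ.convexAffineOn _).congr (convex_convexHull ℝ _) hφ

theorem IsPolyhedral.convexHull (s : Finset V) : IsPolyhedral (convexHull ℝ (s : Set V)) :=
  ⟨{s}, finite_singleton _, by simp⟩

theorem IsPolyhedral.biUnion {ι : Type*} {I : Set ι} (hI : I.Finite) {X : ι → Set V}
    (h : ∀ i ∈ I, IsPolyhedral (X i)) : IsPolyhedral (⋃ i ∈ I, X i) := by
  choose! S hS hX using h
  refine ⟨⋃ i ∈ I, S i, hI.biUnion hS, ?_⟩
  simp only [biUnion_iUnion]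
  exact iUnion₂_congr hX

theorem HasPLCover.biUnion {ι : Type*} {I : Set ι} (hI : I.Finite) {X : ι → Set V} {F : V → W}
    (h : ∀ i ∈ I, HasPLCover F (X i)) : HasPLCover F (⋃ i ∈ I, X i) := by
  choose! S hS hX hF using h
  refine ⟨⋃ i ∈ I, S i, hI.biUnion hS, ?_, ?_⟩
  · simp only [biUnion_iUnion]
    exact iUnion₂_congr hX
  · intro s hs
    obtain ⟨i, hi, his⟩ := mem_iUnion₂.1 hs
    exact hF i hi s his

theorem HasPLCover.union {X Y : Set V} {F : V → W} (hX : HasPLCover F X) (hY : HasPLCover F Y) :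
    HasPLCover F (X ∪ Y) := by
  obtain ⟨S, h1, h2, h3⟩ := hX
  obtain ⟨T, h4, h5, h6⟩ := hY
  exact ⟨S ∪ T, h1.union h4, by rw [biUnion_union, h2, h5], fun s hs => hs.elim (h3 s) (h6 s)⟩

theorem HasPLCover.congr {X : Set V} {F G : V → W} (hF : HasPLCover F X) (h : EqOn G F X) :
    HasPLCover G X := by
  obtain ⟨S, h1, h2, h3⟩ := hF
  refine ⟨S, h1, h2, fun s hs => (h3 s hs).congr (convex_convexHull ℝ _) (h.mono ?_)⟩
  rw [h2]
  exact subset_biUnion_of_mem (u := fun s : Finset V => _root_.convexHull ℝ (s : Set V)) hs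

theorem HasPLCover.linear_comp {X : Set V} {F : V → W} (hF : HasPLCover F X) (L : W →ₗ[ℝ] W') :
    HasPLCover (fun x => L (F x)) X := by
  obtain ⟨S, h1, h2, h3⟩ := hF
  exact ⟨S, h1, h2, fun s hs => (h3 s hs).linear_comp L⟩

theorem IsPolyhedral.hasPLCover_affine {X : Set V} (hX : IsPolyhedral X) (φ : V →ᵃ[ℝ] W) :
    HasPLCover φ X := by
  obtain ⟨S, h1, h2⟩ := hX
  exact ⟨S, h1, h2, fun s _ => φ.convexAffineOn _⟩

theorem HasPLCover.comp_fst_prod {X : Set V} {Y : Set W'} {F : V → W} (hF : HasPLCover F X)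
    (hY : IsPolyhedral Y) : HasPLCover (fun p : V × W' => F p.1) (X ×ˢ Y) := by
  obtain ⟨S, h1, h2, h3⟩ := hF
  obtain ⟨T, h4, h5⟩ := hY
  refine ⟨(fun p : Finset V × Finset W' => p.1 ×ˢ p.2) '' (S ×ˢ T), (h1.prod h4).image _, ?_, ?_⟩
  · rw [biUnion_image]
    simp only [Finset.coe_product, convexHull_prod]
    rw [h2, h5]
    ext ⟨x, y⟩
    simp only [mem_prod, mem_iUnion, exists_prop, Prod.exists]
    tauto
  · rintro _ ⟨⟨s, t⟩, ⟨hs, -⟩, rfl⟩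
    refine ConvexAffineOn.comp_linear (LinearMap.fst ℝ V W') ((h3 s hs).mono ?_)
    rintro _ ⟨⟨x, y⟩, hxy, rfl⟩
    rw [Finset.coe_product, convexHull_prod] at hxy
    exact hxy.1

theorem IsPolyhedral.prod {X : Set V} {Y : Set W} (hX : IsPolyhedral X) (hY : IsPolyhedral Y) :
    IsPolyhedral (X ×ˢ Y) :=
  ((hX.hasPLCover_affine (AffineMap.const ℝ V (0 : ℝ))).comp_fst_prod hY).isPolyhedral

end ConvexAffine

section PLCalculus

open Geometry Geometry.SimplicialComplex

variable {V : Type*} [NormedAddCommGroup V] [NormedSpace ℝ V] [FiniteDimensional ℝ V]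
  {W W' : Type*} [AddCommGroup W] [Module ℝ W] [AddCommGroup W'] [Module ℝ W']

/-- In a triangulation compatible with all the polytopes, keep the faces contained in one polytope
from each family; the carrier of any common point is such a face. -/
theorem exists_common_refinement {S T : Set (Finset V)} (hS : S.Finite) (hT : T.Finite) :
    ∃ K : SimplicialComplex ℝ V, K.faces.Finite ∧
      K.space = (⋃ s ∈ S, convexHull ℝ (s : Set V)) ∩ (⋃ s ∈ T, convexHull ℝ (s : Set V)) ∧
      ∀ r ∈ K.faces, (∃ s ∈ S, convexHull ℝ (r : Set V) ⊆ convexHull ℝ (s : Set V)) ∧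
        ∃ s ∈ T, convexHull ℝ (r : Set V) ⊆ convexHull ℝ (s : Set V) := by
  obtain ⟨L, hL, hLR, -⟩ := exists_triangulation (S ∪ T) (hS.union hT) one_pos
  set F : Set (Finset V) := {r | r ∈ L.faces ∧
    (∃ s ∈ S, convexHull ℝ (r : Set V) ⊆ convexHull ℝ (s : Set V)) ∧
        ∃ s ∈ T, convexHull ℝ (r : Set V) ⊆ convexHull ℝ (s : Set V)} with hF
  let K : SimplicialComplex ℝ V :=
    { faces := F
      indep := fun hs => L.indep hs.1
      isRelLowerSet_faces := by
        rintro r ⟨hr, ⟨s, hs, hrs⟩, ⟨t, ht, hrt⟩⟩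
        refine ⟨L.nonempty_of_mem_faces hr, fun r' hr' hne => ?_⟩
        have hsub := convexHull_mono (𝕜 := ℝ) (Finset.coe_subset.2 hr')
        exact ⟨L.down_closed hr hr' hne, ⟨s, hs, hsub.trans hrs⟩, ⟨t, ht, hsub.trans hrt⟩⟩
      inter_subset_convexHull := fun hs ht => L.inter_subset_convexHull hs.1 ht.1 }
  refine ⟨K, hL.subset fun r hr => hr.1, Subset.antisymm ?_ ?_, fun r hr => hr.2⟩
  · intro x hx
    obtain ⟨r, hr, hxr⟩ := mem_space_iff.1 hx
    obtain ⟨-, ⟨s, hs, hrs⟩, ⟨t, ht, hrt⟩⟩ := hr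
    exact ⟨mem_biUnion hs (hrs hxr), mem_biUnion ht (hrt hxr)⟩
  · rintro x ⟨hxS, hxT⟩
    obtain ⟨s, hs, hxs⟩ := mem_iUnion₂.1 hxS
    obtain ⟨t, ht, hxt⟩ := mem_iUnion₂.1 hxT
    obtain ⟨r₀, hr₀, hxr₀⟩ := mem_space_iff.1 ((hLR s (Or.inl hs)).1 hxs)
    obtain ⟨r, hr⟩ := L.exists_isCarrier hr₀ hxr₀
    exact mem_space_iff.2 ⟨r, ⟨hr.1, ⟨s, hs, (hLR s (Or.inl hs)).2 x r hxs hr⟩,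
      ⟨t, ht, (hLR t (Or.inr ht)).2 x r hxt hr⟩⟩, hr.2.1⟩

/-- With `IsPLOn.hasPLCover`, this allows PL maps to be built on overlapping polytopes, without
exhibiting triangulations. -/
theorem HasPLCover.isPLOn {F : V → W} {X : Set V} (h : HasPLCover F X) : IsPLOn F X := by
  obtain ⟨S, hS, rfl, hF⟩ := h
  obtain ⟨K, hK, hKS, hK'⟩ := exists_common_refinement hS hS
  refine ⟨K, hK, by rw [hKS, inter_self], fun r hr => ?_⟩
  obtain ⟨⟨s, hs, hrs⟩, -⟩ := hK' r hr
  obtain ⟨φ, hφ⟩ := (K.indep hr).exists_affineMap F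
  exact ⟨φ, ((hF s hs).mono hrs).eqOn_affine φ fun v hv => (hφ v hv).symm⟩

theorem HasPLCover.inter {F : V → W} {X Y : Set V} (h : HasPLCover F X) (hY : IsPolyhedral Y) :
    HasPLCover F (X ∩ Y) := by
  obtain ⟨S, hS, rfl, hF⟩ := h
  obtain ⟨T, hT, rfl⟩ := hY
  obtain ⟨K, hK, hKS, hK'⟩ := exists_common_refinement hS hT
  refine ⟨K.faces, hK, hKS.symm, fun r hr => ?_⟩
  obtain ⟨⟨s, hs, hrs⟩, -⟩ := hK' r hr
  exact (hF s hs).mono hrs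

theorem HasPLCover.mono {F : V → W} {X Y : Set V} (h : HasPLCover F X) (hY : IsPolyhedral Y)
    (hYX : Y ⊆ X) : HasPLCover F Y := by
  have := h.inter hY
  rwa [inter_eq_right.2 hYX] at this

theorem HasPLCover.prodMk {F : V → W} {G : V → W'} {X : Set V} (hF : HasPLCover F X)
    (hG : HasPLCover G X) : HasPLCover (fun x => (F x, G x)) X := by
  obtain ⟨S, hS, hXS, hF⟩ := hF
  obtain ⟨T, hT, hXT, hG⟩ := hG
  obtain ⟨K, hK, hKS, hK'⟩ := exists_common_refinement hS hT
  refine ⟨K.faces, hK, ?_, fun r hr => ?_⟩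
  · rw [← hXS, ← hXT, inter_self] at hKS; exact hKS.symm
  · obtain ⟨⟨s, hs, hrs⟩, ⟨t, ht, hrt⟩⟩ := hK' r hr
    exact ((hF s hs).mono hrs).prodMk ((hG t ht).mono hrt)

theorem IsPolyhedral.isCompact {X : Set V} (hX : IsPolyhedral X) : IsCompact X := by
  obtain ⟨S, hS, rfl⟩ := hX
  exact hS.isCompact_biUnion fun s _ => s.isCompact_convexHull

theorem HasPLCover.continuousOn {E : Type*} [NormedAddCommGroup E] [NormedSpace ℝ E]
    {F : V → E} {X : Set V} (h : HasPLCover F X) : ContinuousOn F X := by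
  obtain ⟨K, hK, rfl, hF⟩ := h.isPLOn
  have := hK.to_subtype
  rw [SimplicialComplex.space, biUnion_eq_iUnion]
  refine (locallyFinite_of_finite _).continuousOn_iUnion
    (fun s => (s.1.isCompact_convexHull).isClosed) fun s => ?_
  obtain ⟨φ, hφ⟩ := hF s.1 s.2
  exact φ.continuous_of_finiteDimensional.continuousOn.congr hφ

/-- The images of the simplices are polytopes covering the image, and the inverse preserves convex
combinations on each of them. -/
theorem HasPLCover.isPLEmbeddingOn {E : Type*} [NormedAddCommGroup E] [NormedSpace ℝ E]
    [FiniteDimensional ℝ E] {F : V → E} {X : Set V} (h : HasPLCover F X) (hinj : InjOn F X) :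
    IsPLEmbeddingOn F X := by
  classical
  rcases isEmpty_or_nonempty V with hV | hV
  · exact (hV.false 0).elim
  refine ⟨h.isPLOn, Function.invFunOn F X, ?_, hinj.leftInvOn_invFunOn⟩
  obtain ⟨K, hK, rfl, hF⟩ := h.isPLOn
  choose! φ hφ using hF
  have himg : ∀ s ∈ K.faces, F '' convexHull ℝ (s : Set V) =
      convexHull ℝ ((s.image (φ s) : Finset E) : Set E) := by
    intro s hs
    rw [(hφ s hs).image_eq, AffineMap.image_convexHull, Finset.coe_image]
  refine HasPLCover.isPLOn ⟨(fun s => s.image (φ s)) '' K.faces, hK.image _, ?_, ?_⟩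
  · rw [biUnion_image, SimplicialComplex.space, image_iUnion₂]
    exact iUnion₂_congr himg
  · rintro _ ⟨s, hs, rfl⟩
    simp only
    rw [← himg s hs]
    rintro _ ⟨x, hx, rfl⟩ _ ⟨y, hy, rfl⟩ a b ha hb hab
    have hsub : ∀ z ∈ convexHull ℝ (s : Set V), z ∈ K.space := fun z hz =>
      mem_space_iff.2 ⟨s, hs, hz⟩
    have hz := convex_convexHull ℝ (s : Set V) hx hy ha hb hab
    have h1 : a • F x + b • F y = F (a • x + b • y) := by
      rw [hφ s hs hz, hφ s hs hx, hφ s hs hy, Convex.combo_affine_apply hab]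
    have hl := hinj.leftInvOn_invFunOn
    rw [h1, hl (hsub _ hz), hl (hsub _ hx), hl (hsub _ hy)]

theorem isPolyhedral_plBall (n : ℕ) : IsPolyhedral (plBall n) := by
  classical
  refine ⟨{Fintype.piFinset fun _ => {-1, 1}}, finite_singleton _, ?_⟩
  have h1 : convexHull ℝ ({-1, 1} : Set ℝ) = Icc (-1) 1 := by
    rw [convexHull_pair, segment_eq_Icc (by norm_num)]
  rw [biUnion_singleton, Fintype.coe_piFinset, convexHull_pi]
  ext x
  simp only [Finset.coe_insert, Finset.coe_singleton, h1, plBall, mem_closedBall_zero_iff,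
    pi_norm_le_iff_of_nonneg zero_le_one, Real.norm_eq_abs, abs_le, mem_univ_pi, mem_Icc]

end PLCalculus

/-! ### Conical extension over cones attached along their bases. -/

section Cone

variable {V W E A : Type*} [NormedAddCommGroup V] [NormedSpace ℝ V]
  [NormedAddCommGroup W] [NormedSpace ℝ W] [NormedAddCommGroup E] [NormedSpace ℝ E]
  [NormedAddCommGroup A] [NormedSpace ℝ A]

/-- `g` separates the points of each fibre of `f` in `N`. -/
def FibInj (f : V → W) (N : Set V) (g : V → E) : Prop :=
  ∀ x ∈ N, ∀ y ∈ N, f x = f y → g x = g y → x = y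

/-- `N` is obtained from `N₁` by attaching cones `D v` with apexes `v ∈ F`, all lying over one
point; `s` is the cone parameter, vanishing at the apexes and equal to `1` on `N₁`. -/
structure IsCone (f : V → W) (N N₁ F : Set V) (D : V → Set V) (s : V → ℝ) : Prop where
  finite : F.Finite
  cover : N = N₁ ∪ ⋃ v ∈ F, D v
  polyhedral : IsPolyhedral N₁
  nonneg : ∀ x ∈ N, 0 ≤ s x
  le_one : ∀ x ∈ N, s x ≤ 1
  mem_iff : ∀ x ∈ N, x ∈ N₁ ↔ s x = 1
  continuousOn : ContinuousOn s N
  apex_mem : ∀ v ∈ F, v ∈ D v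
  apex_zero : ∀ v ∈ F, s v = 0
  zero : ∀ v ∈ F, ∀ x ∈ D v, s x = 0 → x = v
  sep : ∀ v ∈ F, ∀ v' ∈ F, ∀ x, x ∈ D v → x ∈ D v' → s x < 1 → v = v'
  fib : ∀ x ∈ N, ∀ x' ∈ N, f x = f x' → s x = s x'
  ray : ∀ v ∈ F, ∀ x ∈ D v, ∀ m, 0 < m → s x ≤ m → m ≤ 1 →
    v + m⁻¹ • (x - v) ∈ D v ∧ s (v + m⁻¹ • (x - v)) = s x / m ∧
      f (v + m⁻¹ • (x - v)) = f v + m⁻¹ • (f x - f v)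
  poly : ∀ v ∈ F, ∃ B : Set (Finset V), B.Finite ∧
    D v = (⋃ β ∈ B, convexHull ℝ (insert v (β : Set V))) ∧
    ∀ β ∈ B, convexHull ℝ (β : Set V) ⊆ N₁ ∧
      ConvexAffineOn s (convexHull ℝ (insert v (β : Set V)))

/-- The prescribed regions `R x` for the values at `x` are compatible with the cones `D v`. -/
structure IsConeRegion (e : V → E) (N F : Set V) (D : V → Set V) (s : V → ℝ)
    (R : V → Set E) : Prop where
  ray : ∀ v ∈ F, ∀ x ∈ D v, ∀ m, 0 < m → s x ≤ m → m ≤ 1 → ∀ z ∈ R (v + m⁻¹ • (x - v)),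
    (1 - m) • e v + m • z ∈ R x
  apex : ∀ v ∈ F, e v ∈ R v
  ball : ∃ δ > 0, ∀ x ∈ N, Metric.ball (e x) δ ⊆ R x
  sep : ∃ ρ, (∀ v ∈ F, ∀ x ∈ D v, R x ⊆ Metric.ball (e v) ρ) ∧
    ∀ v ∈ F, ∀ v' ∈ F, v ≠ v' → 2 * ρ ≤ dist (e v) (e v')

/-- The extension over the cones, from the apexes `(c x, 0)`. -/
noncomputable def coneExt (e : V → E) (s : V → ℝ) (c : V → V) (H : V → A → E) (x : V) (b : A) : E :=
  (1 - max (s x) ‖b‖) • e (c x) +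
    max (s x) ‖b‖ • H (c x + (max (s x) ‖b‖)⁻¹ • (x - c x)) ((max (s x) ‖b‖)⁻¹ • b)

variable {f : V → W} {N N₁ F : Set V} {D : V → Set V} {s : V → ℝ} {e : V → E} {R : V → Set E}

theorem IsCone.subset_left (hC : IsCone f N N₁ F D s) : N₁ ⊆ N := by
  rw [hC.cover]; exact subset_union_left

theorem IsCone.subset_right (hC : IsCone f N N₁ F D s) {v : V} (hv : v ∈ F) : D v ⊆ N := by
  rw [hC.cover]; exact (subset_biUnion_of_mem (u := D) hv).trans subset_union_right

theorem IsCone.exists_apex (hC : IsCone f N N₁ F D s) {x : V} (hx : x ∈ N) (hs : s x < 1) :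
    ∃ v ∈ F, x ∈ D v := by
  have h1 : x ∉ N₁ := fun h => hs.ne ((hC.mem_iff x hx).1 h)
  have h2 := hx
  rw [hC.cover] at h2
  simpa using h2.resolve_left h1

theorem IsCone.exists_apexMap (hC : IsCone f N N₁ F D s) :
    ∃ c : V → V, ∀ v ∈ F, ∀ x ∈ D v, s x < 1 → c x = v := by
  classical
  refine ⟨fun x => if h : ∃ v ∈ F, x ∈ D v then h.choose else x, fun v hv x hx hs => ?_⟩
  have h : ∃ v ∈ F, x ∈ D v := ⟨v, hv, hx⟩
  simp only [dif_pos h]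
  exact hC.sep _ h.choose_spec.1 v hv x h.choose_spec.2 hx hs

theorem coneExt_eq_of_max_eq_one {c : V → V} {H : V → A → E} {x : V} {b : A}
    (hm : max (s x) ‖b‖ = 1) : coneExt e s c H x b = H x b := by
  simp [coneExt, hm]

theorem IsCone.max_eq_one (hC : IsCone f N N₁ F D s) {x : V} {b : A} (hx : x ∈ N) (hb : ‖b‖ ≤ 1)
    (h : s x = 1 ∨ ‖b‖ = 1) : max (s x) ‖b‖ = 1 := by
  rcases h with h | h
  · rw [h, max_eq_left hb]
  · rw [h, max_eq_right (hC.le_one x hx)]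

/-- Cones may overlap where `s x = 1`, so that `c x` need not be `v` there; but then the scale is
`1` and the apex drops out. -/
theorem IsCone.coneExt_eq (hC : IsCone f N N₁ F D s) {c : V → V}
    (hc : ∀ v ∈ F, ∀ x ∈ D v, s x < 1 → c x = v) {H : V → A → E} {v x : V} {b : A} (hv : v ∈ F)
    (hx : x ∈ D v) (hb : ‖b‖ ≤ 1) : coneExt e s c H x b = (1 - max (s x) ‖b‖) • e v +
      max (s x) ‖b‖ • H (v + (max (s x) ‖b‖)⁻¹ • (x - v)) ((max (s x) ‖b‖)⁻¹ • b) := by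
  have hxN := hC.subset_right hv hx
  rcases (hC.le_one x hxN).lt_or_eq with h | h
  · rw [coneExt, hc v hv x hx h]
  · have hm := hC.max_eq_one hxN hb (Or.inl h)
    rw [coneExt_eq_of_max_eq_one hm, hm]
    simp

/-- The points at which the map being extended over the cones is already defined. -/
def coneDom (N : Set V) (s : V → ℝ) (A : Type*) [NormedAddCommGroup A] : Set (V × A) :=
  {p | p.1 ∈ N ∧ ‖p.2‖ ≤ 1 ∧ (s p.1 = 1 ∨ ‖p.2‖ = 1)}

/-- Dividing by the maximum brings either the cone parameter or the norm to `1`: the ray from `(v,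
0)` leaves the cone where the map is already defined. -/
theorem IsCone.ray_mem_coneDom (hC : IsCone f N N₁ F D s) {v x : V} {b : A} (hv : v ∈ F)
    (hx : x ∈ D v) (hb : ‖b‖ ≤ 1) (hm : 0 < max (s x) ‖b‖) :
    (v + (max (s x) ‖b‖)⁻¹ • (x - v), (max (s x) ‖b‖)⁻¹ • b) ∈ coneDom N s A := by
  have hm1 : max (s x) ‖b‖ ≤ 1 := max_le (hC.le_one x (hC.subset_right hv hx)) hb
  obtain ⟨h1, h2, -⟩ := hC.ray v hv x hx _ hm (le_max_left _ _) hm1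
  have hn : ‖(max (s x) ‖b‖)⁻¹ • b‖ = ‖b‖ / max (s x) ‖b‖ := by
    rw [norm_smul, norm_inv, Real.norm_of_nonneg hm.le, div_eq_inv_mul]
  refine ⟨hC.subset_right hv h1, ?_, ?_⟩
  · simp only [hn]
    exact (div_le_one hm).2 (le_max_right _ _)
  · simp only [hn, h2]
    rcases max_choice (s x) ‖b‖ with h | h
    · left
      rw [h] at hm ⊢
      exact div_self hm.ne'
    · right
      rw [h] at hm ⊢
      exact div_self hm.ne'

theorem IsCone.coneExt_mem (hC : IsCone f N N₁ F D s) (hR : IsConeRegion e N F D s R) {c : V → V}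
    (hc : ∀ v ∈ F, ∀ x ∈ D v, s x < 1 → c x = v) {H : V → A → E}
    (hH : ∀ p ∈ coneDom N s A, H p.1 p.2 ∈ R p.1) {x : V} {b : A} (hx : x ∈ N) (hb : ‖b‖ ≤ 1) :
    coneExt e s c H x b ∈ R x := by
  rcases (hC.le_one x hx).lt_or_eq with h | h
  · obtain ⟨v, hv, hxv⟩ := hC.exists_apex hx h
    rw [hC.coneExt_eq hc hv hxv hb]
    -- Scale `0` occurs only at `(v, 0)`; the convention `0⁻¹ = 0` is harmless because the term
    -- involving it is multiplied by `0`.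
    rcases ((hC.nonneg x hx).trans (le_max_left _ ‖b‖)).eq_or_lt with h0 | h0
    · have hs0 : s x = 0 := le_antisymm (h0 ▸ le_max_left _ _) (hC.nonneg x hx)
      obtain rfl := hC.zero v hv x hxv hs0
      rw [← h0]
      simpa using hR.apex _ hv
    · exact hR.ray v hv x hxv _ h0 (le_max_left _ _) (max_le (hC.le_one x hx) hb) _
        (hH _ (hC.ray_mem_coneDom hv hxv hb h0))
  · rw [coneExt_eq_of_max_eq_one (hC.max_eq_one hx hb (Or.inl h))]
    exact hH (x, b) ⟨hx, hb, Or.inl h⟩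

/-- Points of a common fibre have the same cone parameter, hence the same scale. In one cone their
rays end at points of a common fibre, separated by `H`; in different cones their values lie in
disjoint balls. -/
theorem IsCone.coneExt_fibInj (hC : IsCone f N N₁ F D s) (hR : IsConeRegion e N F D s R)
    {c : V → V} (hc : ∀ v ∈ F, ∀ x ∈ D v, s x < 1 → c x = v) {H : V → A → E}
    (hH : ∀ p ∈ coneDom N s A, H p.1 p.2 ∈ R p.1)
    (hinj : ∀ b, FibInj f {x | (x, b) ∈ coneDom N s A} (fun x => H x b)) {b : A} (hb : ‖b‖ ≤ 1) :
    FibInj f N (fun x => coneExt e s c H x b) := by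
  intro x hx x' hx' hf heq
  have hs := hC.fib x hx x' hx' hf
  rcases (hC.le_one x hx).lt_or_eq with h | h
  · obtain ⟨v, hv, hxv⟩ := hC.exists_apex hx h
    obtain ⟨v', hv', hxv'⟩ := hC.exists_apex hx' (hs ▸ h)
    by_cases hvv : v = v'
    · subst hvv
      simp only [hC.coneExt_eq hc hv hxv hb, hC.coneExt_eq hc hv hxv' hb, ← hs] at heq
      rcases ((hC.nonneg x hx).trans (le_max_left _ ‖b‖)).eq_or_lt with h0 | h0
      · have hs0 : s x = 0 := le_antisymm (h0 ▸ le_max_left _ _) (hC.nonneg x hx)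
        rw [hC.zero v hv x hxv hs0, hC.zero v hv x' hxv' (hs ▸ hs0)]
      · have h1 := hC.ray_mem_coneDom hv hxv hb h0
        have h2 := hC.ray_mem_coneDom hv hxv' hb (hs ▸ h0)
        rw [← hs] at h2
        have hm1 : max (s x) ‖b‖ ≤ 1 := max_le (hC.le_one x hx) hb
        have h3 := (hC.ray v hv x hxv _ h0 (le_max_left _ _) hm1).2.2
        have h4 := (hC.ray v hv x' hxv' _ h0 (hs ▸ le_max_left _ _) hm1).2.2
        have h5 := hinj _ _ h1 _ h2 (by rw [h3, h4, hf])
          (smul_right_injective E h0.ne' (add_left_cancel heq))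
        have h6 := smul_right_injective V (inv_pos.2 h0).ne' (add_left_cancel h5)
        exact sub_left_injective h6
    · obtain ⟨ρ, hρ1, hρ2⟩ := hR.sep
      have h1 := hρ1 v hv x hxv (hC.coneExt_mem hR hc hH hx hb)
      have h2 := hρ1 v' hv' x' hxv' (hC.coneExt_mem hR hc hH hx' hb)
      simp only at heq
      rw [heq] at h1
      have h3 := hρ2 v hv v' hv' hvv
      have h4 := dist_triangle_left (e v) (e v') (coneExt e s c H x' b)
      rw [Metric.mem_ball] at h1 h2
      linarith
  · have h' : s x' = 1 := hs ▸ h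
    simp only [coneExt_eq_of_max_eq_one (hC.max_eq_one hx hb (Or.inl h)),
      coneExt_eq_of_max_eq_one (hC.max_eq_one hx' hb (Or.inl h'))] at heq
    exact hinj b x ⟨hx, hb, Or.inl h⟩ x' ⟨hx', hb, Or.inl h'⟩ hf heq

end Cone

/-! ### Contraction properties and the topological cone step. -/

section ConeSteps

universe u

variable {V W E : Type*} [NormedAddCommGroup V] [NormedSpace ℝ V]
  [NormedAddCommGroup W] [NormedSpace ℝ W] [NormedAddCommGroup E] [NormedSpace ℝ E]

/-- Continuous families of maps close to `e` and separating points in the fibres of `f` contract,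
through such maps with values in the regions `R`. -/
def ContractsTop (f : V → W) (e : V → E) (N : Set V) (R : V → Set E) : Prop :=
  ∃ δ > 0, ∀ (Z : Type u) [TopologicalSpace Z] (G : Z → V → E),
    ContinuousOn (fun p : Z × V => G p.1 p.2) (univ ×ˢ N) → (∀ z, FibInj f N (G z)) →
    (∀ z, ∀ x ∈ N, dist (G z x) (e x) < δ) →
    ∃ H : Z → V → ℝ → E,
      ContinuousOn (fun p : Z × V × ℝ => H p.1 p.2.1 p.2.2)
        (univ ×ˢ (N ×ˢ Metric.closedBall 0 1)) ∧
      (∀ z, ∀ b, ‖b‖ ≤ 1 → FibInj f N (fun x => H z x b)) ∧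
      (∀ z, ∀ x ∈ N, ∀ b, ‖b‖ ≤ 1 → H z x b ∈ R x) ∧
      (∀ z, ∀ x ∈ N, ∀ b, ‖b‖ = 1 → H z x b = G z x) ∧
      ∀ z z', ∀ x ∈ N, H z x 0 = H z' x 0

/-- PL families over spheres of maps close to `e` and separating points in the fibres of `f` extend
to PL families over balls of such maps with values in the regions `R`. -/
def ContractsPL (f : V → W) (e : V → E) (N : Set V) (R : V → Set E) : Prop :=
  ∃ δ > 0, ∀ (n : ℕ) (G : V × (Fin n → ℝ) → E), HasPLCover G (N ×ˢ plSphere n) →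
    (∀ b ∈ plSphere n, FibInj f N (fun x => G (x, b))) →
    (∀ b ∈ plSphere n, ∀ x ∈ N, dist (G (x, b)) (e x) < δ) →
    ∃ H : V × (Fin n → ℝ) → E, HasPLCover H (N ×ˢ plBall n) ∧
      (∀ b ∈ plBall n, FibInj f N (fun x => H (x, b))) ∧
      (∀ b ∈ plBall n, ∀ x ∈ N, H (x, b) ∈ R x) ∧ EqOn H G (N ×ˢ plSphere n)

variable {f : V → W} {N N₁ F : Set V} {D : V → Set V} {s : V → ℝ} {e : V → E} {R : V → Set E}

theorem ContractsTop.mono {R' : V → Set E} (h : ContractsTop.{u} f e N R)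
    (hR : ∀ x ∈ N, R x ⊆ R' x) : ContractsTop.{u} f e N R' := by
  obtain ⟨δ, hδ, h⟩ := h
  refine ⟨δ, hδ, fun Z _ G h1 h2 h3 => ?_⟩
  obtain ⟨H, h4, h5, h6, h7⟩ := h Z G h1 h2 h3
  exact ⟨H, h4, h5, fun z x hx b hb => hR x hx (h6 z x hx b hb), h7⟩

theorem ContractsPL.mono {R' : V → Set E} (h : ContractsPL f e N R)
    (hR : ∀ x ∈ N, R x ⊆ R' x) : ContractsPL f e N R' := by
  obtain ⟨δ, hδ, h⟩ := h
  refine ⟨δ, hδ, fun n G h1 h2 h3 => ?_⟩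
  obtain ⟨H, h4, h5, h6, h7⟩ := h n G h1 h2 h3
  exact ⟨H, h4, h5, fun b hb x hx => hR x hx (h6 b hb x hx), h7⟩

theorem contractsTop_empty : ContractsTop.{u} f e ∅ R :=
  ⟨1, one_pos, fun Z _ G _ _ _ => ⟨fun z x _ => G z x, by simp, by simp [FibInj], by simp, by simp,
    by simp⟩⟩

theorem contractsPL_empty : ContractsPL f e ∅ R :=
  ⟨1, one_pos, fun n G _ _ _ => ⟨G, ⟨∅, finite_empty, by simp, by simp⟩, by simp [FibInj],
    by simp, by simp⟩⟩

theorem IsCone.isClosed_apex (hC : IsCone f N N₁ F D s) {v : V} (hv : v ∈ F) : IsClosed (D v) := by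
  classical
  obtain ⟨B, hB, hD, -⟩ := hC.poly v hv
  rw [hD]
  refine hB.isClosed_biUnion fun β _ => ?_
  rw [← Finset.coe_insert]
  exact (Finset.isCompact_convexHull _).isClosed

/-- The contraction over `N₁` and the given family at `‖b‖ = 1` are the data for `coneExt`. The
bound `δ₀` places the given values in the regions. -/
theorem ContractsTop.cone [FiniteDimensional ℝ V] (hC : IsCone f N N₁ F D s)
    (hR : IsConeRegion e N F D s R)
    (h : ContractsTop.{u} f e N₁ R) : ContractsTop.{u} f e N R := by
  classical
  obtain ⟨δ₁, hδ₁, h⟩ := h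
  obtain ⟨δ₀, hδ₀, hball⟩ := hR.ball
  obtain ⟨c, hc⟩ := hC.exists_apexMap
  have hN₁c : IsClosed N₁ := hC.polyhedral.isCompact.isClosed
  have hNc : IsClosed N := by
    rw [hC.cover]
    exact hN₁c.union (hC.finite.isClosed_biUnion fun v hv => hC.isClosed_apex hv)
  refine ⟨min δ₁ δ₀, lt_min hδ₁ hδ₀, fun Z _ G hG1 hG2 hG3 => ?_⟩
  obtain ⟨H₁, h1, h2, h3, h4, h5⟩ := h Z G (hG1.mono (prod_mono_right hC.subset_left))
    (fun z x hx y hy => hG2 z x (hC.subset_left hx) y (hC.subset_left hy))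
    (fun z x hx => (hG3 z x (hC.subset_left hx)).trans_le (min_le_left _ _))
  let H : Z → V → ℝ → E := fun z y b => if y ∈ N₁ then H₁ z y b else G z y
  have hHN₁ : ∀ z, ∀ y ∈ N₁, ∀ b, H z y b = H₁ z y b := fun z y hy b => by simp [H, hy]
  have hHG : ∀ z, ∀ y ∈ N, ∀ b, ‖b‖ = 1 → H z y b = G z y := fun z y hy b hb => by
    by_cases hy1 : y ∈ N₁
    · rw [hHN₁ z y hy1, h4 z y hy1 b hb]
    · simp [H, hy1]
  have hHR : ∀ z, ∀ p ∈ coneDom N s ℝ, H z p.1 p.2 ∈ R p.1 := by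
    rintro z ⟨y, b⟩ ⟨hy, hb, hs | hb1⟩
    · have hy1 := (hC.mem_iff y hy).2 hs
      simp only [hHN₁ z y hy1]
      exact h3 z y hy1 b hb
    · simp only at hb1 hy
      simp only [hHG z y hy b hb1]
      exact hball y hy ((hG3 z y hy).trans_le (min_le_right _ _))
  have hHinj : ∀ z b, FibInj f {x | (x, b) ∈ coneDom N s ℝ} (fun x => H z x b) := by
    rintro z b x ⟨hx, hb, hxs⟩ y ⟨hy, -, hys⟩ hf heq
    simp only at hx hb hxs hy hys heq
    by_cases hb1 : ‖b‖ = 1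
    · rw [hHG z x hx b hb1, hHG z y hy b hb1] at heq
      exact hG2 z x hx y hy hf heq
    · have hx1 := (hC.mem_iff x hx).2 (hxs.resolve_right hb1)
      have hy1 := (hC.mem_iff y hy).2 (hys.resolve_right hb1)
      rw [hHN₁ z x hx1, hHN₁ z y hy1] at heq
      exact h2 z b hb x hx1 y hy1 hf heq
  have hHcont : ContinuousOn (fun p : Z × V × ℝ => H p.1 p.2.1 p.2.2)
      (univ ×ˢ coneDom N s ℝ) := by
    have hsplit : (univ : Set Z) ×ˢ coneDom N s ℝ =
        univ ×ˢ (N₁ ×ˢ Metric.closedBall 0 1) ∪ univ ×ˢ (N ×ˢ Metric.sphere 0 1) := by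
      ext ⟨z, x, b⟩
      simp only [coneDom, mem_prod, mem_univ, true_and, mem_ofPred_eq, mem_union,
        mem_closedBall_zero_iff, mem_sphere_zero_iff_norm]
      constructor
      · rintro ⟨hx, hb, hs | hb1⟩
        · exact Or.inl ⟨(hC.mem_iff x hx).2 hs, hb⟩
        · exact Or.inr ⟨hx, hb1⟩
      · rintro (⟨hx, hb⟩ | ⟨hx, hb⟩)
        · exact ⟨hC.subset_left hx, hb, Or.inl ((hC.mem_iff x (hC.subset_left hx)).1 hx)⟩
        · exact ⟨hx, hb.le, Or.inr hb⟩
    rw [hsplit]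
    refine ContinuousOn.union_of_isClosed ?_ ?_
      (isClosed_univ.prod (hN₁c.prod Metric.isClosed_closedBall))
      (isClosed_univ.prod (hNc.prod Metric.isClosed_sphere))
    · refine h1.congr ?_
      rintro ⟨z, x, b⟩ ⟨-, hx, -⟩
      exact hHN₁ z x hx b
    · have h6 : ContinuousOn (fun p : Z × V × ℝ => G p.1 p.2.1)
          (univ ×ˢ (N ×ˢ Metric.sphere 0 1)) :=
        hG1.comp (f := fun p : Z × V × ℝ => (p.1, p.2.1)) (by fun_prop)
          (fun p hp => ⟨mem_univ _, hp.2.1⟩)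
      refine h6.congr ?_
      rintro ⟨z, x, b⟩ ⟨-, hx, hb⟩
      exact hHG z x hx b (mem_sphere_zero_iff_norm.1 hb)
  refine ⟨fun z => coneExt e s c (H z), ?_, ?_, ?_, ?_, ?_⟩
  · have hsplit : (univ : Set Z) ×ˢ (N ×ˢ Metric.closedBall (0 : ℝ) 1) =
        univ ×ˢ (N₁ ×ˢ Metric.closedBall 0 1) ∪
          ⋃ v ∈ F, univ ×ˢ (D v ×ˢ Metric.closedBall 0 1) := by
      ext ⟨z, x, b⟩
      rw [hC.cover]
      simp only [mem_prod, mem_univ, true_and, mem_union, mem_iUnion, exists_prop]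
      constructor
      · rintro ⟨hx | ⟨v, hv, hx⟩, hb⟩
        · exact Or.inl ⟨hx, hb⟩
        · exact Or.inr ⟨v, hv, hx, hb⟩
      · rintro (⟨hx, hb⟩ | ⟨v, hv, hx, hb⟩)
        · exact ⟨Or.inl hx, hb⟩
        · exact ⟨Or.inr ⟨v, hv, hx⟩, hb⟩
    rw [hsplit]
    refine ContinuousOn.union_of_isClosed ?_ ?_
      (isClosed_univ.prod (hN₁c.prod Metric.isClosed_closedBall))
      (hC.finite.isClosed_biUnion fun v hv =>
        isClosed_univ.prod ((hC.isClosed_apex hv).prod Metric.isClosed_closedBall))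
    · refine h1.congr ?_
      rintro ⟨z, x, b⟩ ⟨-, hx, hb⟩
      have hxN := hC.subset_left hx
      simp only
      rw [coneExt_eq_of_max_eq_one (hC.max_eq_one hxN (mem_closedBall_zero_iff.1 hb)
        (Or.inl ((hC.mem_iff x hxN).1 hx))), hHN₁ z x hx b]
    · have := hC.finite.to_subtype
      rw [biUnion_eq_iUnion]
      refine (locallyFinite_of_finite _).continuousOn_iUnion (fun v =>
        isClosed_univ.prod ((hC.isClosed_apex v.2).prod Metric.isClosed_closedBall)) ?_
      rintro ⟨v, hv⟩
      set T : Set (Z × V × ℝ) := univ ×ˢ (D v ×ˢ Metric.closedBall (0 : ℝ) 1) with hT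
      let m : Z × V × ℝ → ℝ := fun p => max (s p.2.1) ‖p.2.2‖
      have hm : ContinuousOn m T := by
        have h6 : ContinuousOn (fun p : Z × V × ℝ => s p.2.1) T :=
          hC.continuousOn.comp (f := fun p : Z × V × ℝ => p.2.1) (by fun_prop)
            fun p hp => hC.subset_right hv hp.2.1
        exact continuous_max.comp_continuousOn (h6.prodMk (by fun_prop))
      have hform : EqOn (fun p : Z × V × ℝ => coneExt e s c (H p.1) p.2.1 p.2.2)
          (fun p => (1 - m p) • e v + m p • H p.1 (v + (m p)⁻¹ • (p.2.1 - v))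
            ((m p)⁻¹ • p.2.2)) T := by
        rintro ⟨z, x, b⟩ ⟨-, hx, hb⟩
        exact hC.coneExt_eq hc hv hx (mem_closedBall_zero_iff.1 hb)
      refine ContinuousOn.congr ?_ hform
      have hm0 : ∀ p ∈ T, 0 ≤ m p := fun p hp =>
        (hC.nonneg _ (hC.subset_right hv hp.2.1)).trans (le_max_left _ _)
      have hdom : ∀ p ∈ T, 0 < m p →
          (v + (m p)⁻¹ • (p.2.1 - v), (m p)⁻¹ • p.2.2) ∈ coneDom N s ℝ := fun p hp h0 =>
        hC.ray_mem_coneDom hv hp.2.1 (mem_closedBall_zero_iff.1 hp.2.2) h0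
      intro p hp
      rcases (hm0 p hp).eq_or_lt with h0 | h0
      -- At the apex the scale `m` vanishes. Nothing is known about convergence of the rays, but the
      -- values of `H` stay within `ρ` of `e v`, so the extension is within `m * ρ` of it.
      · obtain ⟨ρ, hρ, -⟩ := hR.sep
        have hbound : ∀ q ∈ T, ‖((1 - m q) • e v + m q • H q.1 (v + (m q)⁻¹ • (q.2.1 - v))
            ((m q)⁻¹ • q.2.2)) - e v‖ ≤ m q * ρ := by
          intro q hq
          rcases (hm0 q hq).eq_or_lt with h6 | h6
          · rw [← h6]; simp
          · have h7 := hHR q.1 _ (hdom q hq h6)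
            have h8 := hρ v hv _ (hC.ray v hv q.2.1 hq.2.1 _ h6 (le_max_left _ _)
              (max_le (hC.le_one _ (hC.subset_right hv hq.2.1))
                (mem_closedBall_zero_iff.1 hq.2.2))).1 h7
            rw [mem_ball_iff_norm] at h8
            have h9 : ∀ a : E, ((1 - m q) • e v + m q • a) - e v = m q • (a - e v) := fun a => by
              module
            rw [h9, norm_smul, Real.norm_of_nonneg h6.le]
            exact mul_le_mul_of_nonneg_left h8.le h6.le
        have hval : (1 - m p) • e v + m p • H p.1 (v + (m p)⁻¹ • (p.2.1 - v))
            ((m p)⁻¹ • p.2.2) = e v := by rw [← h0]; simp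
        rw [ContinuousWithinAt, hval, tendsto_iff_norm_sub_tendsto_zero]
        have hlim : Filter.Tendsto (fun q => m q * ρ) (𝓝[T] p) (𝓝 0) := by
          have h6 : Filter.Tendsto (fun q => m q * ρ) (𝓝[T] p) (𝓝 (m p * ρ)) :=
            (hm p hp).mul_const ρ
          rwa [← h0, zero_mul] at h6
        exact squeeze_zero' (Filter.Eventually.of_forall fun q => norm_nonneg _)
          (Filter.eventually_of_mem self_mem_nhdsWithin hbound) hlim
      · have hset : {q | 0 < m q} ∈ 𝓝[T] p := (hm p hp) (Ioi_mem_nhds h0)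
        have hinv : ContinuousOn (fun q => (m q)⁻¹) (T ∩ {q | 0 < m q}) :=
          (hm.mono inter_subset_left).inv₀ fun q hq => (ne_of_gt hq.2)
        have hΦ : ContinuousOn (fun q : Z × V × ℝ =>
            (q.1, v + (m q)⁻¹ • (q.2.1 - v), (m q)⁻¹ • q.2.2)) (T ∩ {q | 0 < m q}) := by
          refine ContinuousOn.prodMk (by fun_prop) (ContinuousOn.prodMk ?_ ?_)
          · exact continuousOn_const.add (hinv.smul (by fun_prop))
          · exact hinv.smul (by fun_prop)
        have hcomp := hHcont.comp hΦ fun q hq => ⟨mem_univ _, hdom q hq.1 hq.2⟩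
        have hm' := hm.mono (inter_subset_left (t := {q | 0 < m q}))
        have key : ContinuousOn (fun q => (1 - m q) • e v + m q • H q.1
            (v + (m q)⁻¹ • (q.2.1 - v)) ((m q)⁻¹ • q.2.2)) (T ∩ {q | 0 < m q}) :=
          ((continuousOn_const.sub hm').smul continuousOn_const).add (hm'.smul hcomp)
        have h10 := key p ⟨hp, h0⟩
        rwa [continuousWithinAt_inter' hset] at h10
  · intro z b hb
    exact hC.coneExt_fibInj hR hc (hHR z) (hHinj z) hb
  · intro z x hx b hb
    exact hC.coneExt_mem hR hc (hHR z) hx hb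
  · intro z x hx b hb
    change coneExt e s c (H z) x b = G z x
    rw [coneExt_eq_of_max_eq_one (hC.max_eq_one hx hb.le (Or.inr hb)), hHG z x hx b hb]
  · intro z z' x hx
    change coneExt e s c (H z) x 0 = coneExt e s c (H z') x 0
    -- Rays inside the slice `b = 0` stay in it, so they can end only on `N₁`, where the map at `0`
    -- is already independent of `z`.
    rcases (hC.le_one x hx).lt_or_eq with hs | hs
    · obtain ⟨v, hv, hxv⟩ := hC.exists_apex hx hs
      have hb : ‖(0 : ℝ)‖ ≤ 1 := by simp
      rw [hC.coneExt_eq hc hv hxv hb, hC.coneExt_eq hc hv hxv hb]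
      rcases ((hC.nonneg x hx).trans (le_max_left _ ‖(0 : ℝ)‖)).eq_or_lt with h0 | h0
      · rw [← h0]; simp
      · have h6 := hC.ray_mem_coneDom hv hxv hb h0
        have h7 : v + (max (s x) ‖(0 : ℝ)‖)⁻¹ • (x - v) ∈ N₁ := by
          refine (hC.mem_iff _ h6.1).2 (h6.2.2.resolve_right ?_)
          simp
        rw [hHN₁ z _ h7, hHN₁ z' _ h7, smul_zero, h5 z z' _ h7]
    · have hx1 := (hC.mem_iff x hx).2 hs
      have hm := hC.max_eq_one hx (b := (0 : ℝ)) (by simp) (Or.inl hs)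
      rw [coneExt_eq_of_max_eq_one hm, coneExt_eq_of_max_eq_one hm, hHN₁ z x hx1, hHN₁ z' x hx1,
        h5 z z' x hx1]

end ConeSteps

/-! ### Cones of piecewise linear maps and the PL cone step. -/

section

variable {V W : Type*} [AddCommGroup V] [Module ℝ V] [AddCommGroup W] [Module ℝ W]

theorem mem_convexHull_insert_iff {p : V} {Q : Set V} {x : V} :
    x ∈ convexHull ℝ (insert p Q) ↔ x = p ∨
      ∃ q ∈ convexHull ℝ Q, ∃ m : ℝ, 0 ≤ m ∧ m ≤ 1 ∧ x = (1 - m) • p + m • q := by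
  rcases Q.eq_empty_or_nonempty with rfl | hQ
  · simp
  · rw [convexHull_insert hQ, convexJoin_singleton_left, mem_iUnion₂]
    constructor
    · rintro ⟨q, hq, a, b, ha, hb, hab, rfl⟩
      exact Or.inr ⟨q, hq, b, hb, by linarith, by rw [← hab]; congr 2; ring⟩
    · rintro (rfl | ⟨q, hq, m, h0, h1, rfl⟩)
      · obtain ⟨q, hq⟩ := hQ
        exact ⟨q, subset_convexHull ℝ _ hq, left_mem_segment ℝ _ _⟩
      · exact ⟨q, hq, 1 - m, m, by linarith, h0, by ring, rfl⟩

/-- A map which is conical on the join of a point with a polytope preserves convex combinations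
there if it does so on the polytope. -/
theorem ConvexAffineOn.cone {F : V → W} {p : V} {Q : Set V}
    (hQ : ConvexAffineOn F (convexHull ℝ Q))
    (hcone : ∀ q ∈ convexHull ℝ Q, ∀ m : ℝ, 0 ≤ m → m ≤ 1 →
      F ((1 - m) • p + m • q) = (1 - m) • F p + m • F q) :
    ConvexAffineOn F (convexHull ℝ (insert p Q)) := by
  rcases Q.eq_empty_or_nonempty with rfl | ⟨q₀, hq₀⟩
  · intro x hx y hy a b ha hb hab
    simp only [insert_empty_eq, convexHull_singleton, mem_singleton_iff] at hx hy
    rw [hx, hy, ← add_smul, ← add_smul, hab, one_smul, one_smul]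
  have hrep : ∀ x ∈ convexHull ℝ (insert p Q), ∃ q ∈ convexHull ℝ Q, ∃ m : ℝ, 0 ≤ m ∧ m ≤ 1 ∧
      x = (1 - m) • p + m • q := by
    intro x hx
    rcases mem_convexHull_insert_iff.1 hx with rfl | h
    · exact ⟨q₀, subset_convexHull ℝ _ hq₀, 0, le_rfl, zero_le_one, by simp⟩
    · exact h
  intro x hx y hy a b ha hb hab
  obtain ⟨q, hq, m, hm0, hm1, rfl⟩ := hrep x hx
  obtain ⟨q', hq', m', hm0', hm1', rfl⟩ := hrep y hy
  rw [hcone q hq m hm0 hm1, hcone q' hq' m' hm0' hm1']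
  have hb' : b = 1 - a := by linarith
  have h1 := mul_nonneg ha hm0
  have h2 := mul_nonneg hb hm0'
  rcases (add_nonneg h1 h2).eq_or_lt with h0 | h0
  · have h3 : a * m = 0 := by linarith
    have h4 : b * m' = 0 := by linarith
    have h5 : ∀ (X : Type _) [AddCommGroup X] [Module ℝ X] (P A B : X),
        a • ((1 - m) • P + m • A) + b • ((1 - m') • P + m' • B) = P := by
      intro X _ _ P A B
      have e1 : a • ((1 - m) • P + m • A) + b • ((1 - m') • P + m' • B) =
        (a + b - a * m - b * m') • P + (a * m) • A + (b * m') • B := by module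
      rw [e1, h3, h4, hab]; simp
    have h6 : ∀ (P A B : W),
        a • ((1 - m) • P + m • A) + b • ((1 - m') • P + m' • B) = P := by
      intro P A B
      have e1 : a • ((1 - m) • P + m • A) + b • ((1 - m') • P + m' • B) =
        (a + b - a * m - b * m') • P + (a * m) • A + (b * m') • B := by module
      rw [e1, h3, h4, hab]; simp
    rw [h5 V, h6]
  -- The combination is at proportion `M` from the apex, towards the base point with weights `a * m
  -- / M` and `b * m' / M`.
  · set M := a * m + b * m' with hM
    have hM1 : M ≤ 1 := by nlinarith
    have ha' : 0 ≤ a * m / M := div_nonneg h1 h0.le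
    have hb'' : 0 ≤ b * m' / M := div_nonneg h2 h0.le
    have hab' : a * m / M + b * m' / M = 1 := by rw [← add_div, div_self h0.ne']
    have e1 : a • ((1 - m) • p + m • q) + b • ((1 - m') • p + m' • q') =
        (1 - M) • p + M • ((a * m / M) • q + (b * m' / M) • q') := by
      rw [smul_add M, smul_smul, smul_smul, mul_div_cancel₀ _ h0.ne', mul_div_cancel₀ _ h0.ne', hM,
        hb']
      module
    rw [e1, hcone _ (convex_convexHull ℝ _ hq hq' ha' hb'' hab') M h0.le hM1,
      hQ q hq q' hq' _ _ ha' hb'' hab', smul_add M, smul_smul, smul_smul,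
      mul_div_cancel₀ _ h0.ne', mul_div_cancel₀ _ h0.ne', hM, hb']
    module

end

section ConePL

variable {V W E : Type*} [NormedAddCommGroup V] [NormedSpace ℝ V] [FiniteDimensional ℝ V]
  [NormedAddCommGroup W] [NormedSpace ℝ W] [NormedAddCommGroup E] [NormedSpace ℝ E]
  {f : V → W} {N N₁ F : Set V} {D : V → Set V} {s : V → ℝ} {e : V → E} {R : V → Set E}

/-- The product of a cone over `β` with the ball is itself a cone from `(v, 0)` on the polyhedron
formed by the base times the ball and the cone times the sphere. Cut the latter into cells on which
`H` preserves convex combinations; on the cone over each cell, `ConvexAffineOn.cone` applies. -/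
theorem IsCone.hasPLCover_coneExt (hC : IsCone f N N₁ F D s) {n : ℕ} {c : V → V}
    (hc : ∀ v ∈ F, ∀ x ∈ D v, s x < 1 → c x = v) {H : V → (Fin n → ℝ) → E}
    (h₁ : HasPLCover (fun p : V × (Fin n → ℝ) => H p.1 p.2) (N₁ ×ˢ plBall n))
    (h₂ : HasPLCover (fun p : V × (Fin n → ℝ) => H p.1 p.2) (N ×ˢ plSphere n)) :
    HasPLCover (fun p : V × (Fin n → ℝ) => coneExt e s c H p.1 p.2) (N ×ˢ plBall n) := by
  classical
  have hsplit : N ×ˢ plBall n = N₁ ×ˢ plBall n ∪ ⋃ v ∈ F, D v ×ˢ plBall n := by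
    ext ⟨x, b⟩
    rw [hC.cover]
    simp only [mem_prod, mem_union, mem_iUnion, exists_prop]
    constructor
    · rintro ⟨hx | ⟨v, hv, hx⟩, hb⟩
      · exact Or.inl ⟨hx, hb⟩
      · exact Or.inr ⟨v, hv, hx, hb⟩
    · rintro (⟨hx, hb⟩ | ⟨v, hv, hx, hb⟩)
      · exact ⟨Or.inl hx, hb⟩
      · exact ⟨Or.inr ⟨v, hv, hx⟩, hb⟩
  rw [hsplit]
  refine HasPLCover.union (h₁.congr ?_) (HasPLCover.biUnion hC.finite fun v hv => ?_)
  · rintro ⟨x, b⟩ ⟨hx, hb⟩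
    have hxN := hC.subset_left hx
    exact coneExt_eq_of_max_eq_one (hC.max_eq_one hxN (mem_closedBall_zero_iff.1 hb)
        (Or.inl ((hC.mem_iff x hxN).1 hx)))
  obtain ⟨B, hB, hD, hBs⟩ := hC.poly v hv
  have hsplit' : D v ×ˢ plBall n =
      ⋃ β ∈ B, convexHull ℝ (insert v (β : Set V)) ×ˢ plBall n := by
    rw [hD]
    ext ⟨x, b⟩
    simp only [mem_prod, mem_iUnion, exists_prop]
    constructor
    · rintro ⟨⟨β, hβ, hx⟩, hb⟩
      exact ⟨β, hβ, hx, hb⟩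
    · rintro ⟨β, hβ, hx, hb⟩
      exact ⟨⟨β, hβ, hx⟩, hb⟩
  rw [hsplit']
  refine HasPLCover.biUnion hB fun β hβ => ?_
  obtain ⟨hβN, hsβ⟩ := hBs β hβ
  have hcD : convexHull ℝ (insert v (β : Set V)) ⊆ D v := by
    rw [hD]
    exact subset_biUnion_of_mem (u := fun β : Finset V => convexHull ℝ (insert v (β : Set V))) hβ
  have hvc : v ∈ convexHull ℝ (insert v (β : Set V)) := subset_convexHull ℝ _ (mem_insert _ _)
  have hβc : convexHull ℝ (β : Set V) ⊆ convexHull ℝ (insert v (β : Set V)) :=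
    convexHull_mono (subset_insert _ _)
  have hcN := hcD.trans (hC.subset_right hv)
  have hpoly : IsPolyhedral (convexHull ℝ (insert v (β : Set V))) := by
    rw [← Finset.coe_insert]; exact IsPolyhedral.convexHull _
  have hq₁ := h₁.mono ((IsPolyhedral.convexHull β).prod (isPolyhedral_plBall n))
    (prod_mono_left hβN)
  have hsub₂ : (N ×ˢ plSphere n) ∩ (convexHull ℝ (insert v (β : Set V)) ×ˢ plBall n) =
      convexHull ℝ (insert v (β : Set V)) ×ˢ plSphere n := by
    ext ⟨x, b⟩
    simp only [mem_inter_iff, mem_prod]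
    exact ⟨fun h => ⟨h.2.1, h.1.2⟩, fun h => ⟨⟨hcN h.1, h.2⟩, h.1,
      Metric.sphere_subset_closedBall h.2⟩⟩
  have hq₂ := h₂.inter (hpoly.prod (isPolyhedral_plBall n))
  rw [hsub₂] at hq₂
  obtain ⟨Q, hQ, hQU, hQF⟩ := hq₁.union hq₂
  set p₀ : V × (Fin n → ℝ) := (v, 0) with hp₀
  have hs0 := hC.apex_zero v hv
  have hsm : ∀ q ∈ convexHull ℝ (insert v (β : Set V)), ∀ m : ℝ, 0 ≤ m → m ≤ 1 →
      (1 - m) • v + m • q ∈ convexHull ℝ (insert v (β : Set V)) ∧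
        s ((1 - m) • v + m • q) = m * s q := by
    intro q hq m h0 h1
    refine ⟨convex_convexHull ℝ _ hvc hq (by linarith) h0 (by ring), ?_⟩
    rw [hsβ v hvc q hq _ _ (by linarith) h0 (by ring), hs0]; simp
  have hdom : ∀ q ∈ (⋃ r ∈ Q, convexHull ℝ (r : Set (V × (Fin n → ℝ)))),
      q.1 ∈ convexHull ℝ (insert v (β : Set V)) ∧ ‖q.2‖ ≤ 1 ∧ (s q.1 = 1 ∨ ‖q.2‖ = 1) := by
    rw [← hQU]
    rintro ⟨y, b⟩ (⟨hy, hb⟩ | ⟨hy, hb⟩)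
    · exact ⟨hβc hy, mem_closedBall_zero_iff.1 hb,
        Or.inl ((hC.mem_iff y (hcN (hβc hy))).1 (hβN hy))⟩
    · have := mem_sphere_zero_iff_norm.1 hb
      exact ⟨hy, this.le, Or.inr this⟩
  have hform : ∀ q ∈ (⋃ r ∈ Q, convexHull ℝ (r : Set (V × (Fin n → ℝ)))), ∀ m : ℝ, 0 ≤ m → m ≤ 1 →
      coneExt e s c H ((1 - m) • p₀ + m • q).1 ((1 - m) • p₀ + m • q).2 =
        (1 - m) • e v + m • H q.1 q.2 := by
    rintro ⟨y, b⟩ hq m hm0 hm1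
    obtain ⟨hy, hb, hyb⟩ := hdom _ hq
    simp only at hy hb hyb
    obtain ⟨hx, hsx⟩ := hsm y hy m hm0 hm1
    have hmax := hC.max_eq_one (hcN hy) hb hyb
    have e1 : ((1 - m) • p₀ + m • (y, b)).1 = (1 - m) • v + m • y := rfl
    have e2 : ((1 - m) • p₀ + m • (y, b)).2 = m • b := by simp [hp₀]
    have hnb : ‖m • b‖ = m * ‖b‖ := by rw [norm_smul, Real.norm_of_nonneg hm0]
    have hmm : max (s ((1 - m) • v + m • y)) ‖m • b‖ = m := by
      rw [hsx, hnb, ← mul_max_of_nonneg _ _ hm0, hmax, mul_one]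
    rw [e1, e2, hC.coneExt_eq hc hv (hcD hx) (by rw [hnb]; exact mul_le_one₀ hm1 (norm_nonneg _) hb),
      hmm]
    rcases hm0.eq_or_lt with h0 | h0
    · rw [← h0]; simp
    · have e3 : v + m⁻¹ • ((1 - m) • v + m • y - v) = y := by
        have : (1 - m) • v + m • y - v = m • (y - v) := by module
        rw [this, smul_smul, inv_mul_cancel₀ h0.ne', one_smul, add_sub_cancel]
      rw [e3, smul_smul, inv_mul_cancel₀ h0.ne', one_smul]
  have hp₀val : coneExt e s c H p₀.1 p₀.2 = e v := by
    rw [hC.coneExt_eq hc hv (hC.apex_mem v hv) (by simp [hp₀])]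
    simp [hp₀, hs0]
  refine ⟨insert {p₀} ((fun r => insert p₀ r) '' Q), (hQ.image _).insert _, ?_, ?_⟩
  · rw [biUnion_insert, biUnion_image]
    simp only [Finset.coe_singleton, convexHull_singleton, Finset.coe_insert]
    apply Subset.antisymm
    · rintro ⟨x, b⟩ ⟨hx, hb⟩
      have hb1 : ‖b‖ ≤ 1 := mem_closedBall_zero_iff.1 hb
      -- `μ` is the cone parameter of `x`, and `y` is the image of `x` under dilation by `m⁻¹` about
      -- `v`; it reaches the base when `m = μ`.
      obtain ⟨μ, hμ0, hμ1, hμx, hray⟩ : ∃ μ : ℝ, 0 ≤ μ ∧ μ ≤ 1 ∧ s x = μ ∧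
          ∀ m, 0 < m → μ ≤ m → m ≤ 1 → ∃ y ∈ convexHull ℝ (insert v (β : Set V)),
            x = (1 - m) • v + m • y ∧ (μ = m → y ∈ convexHull ℝ (β : Set V)) := by
        rcases mem_convexHull_insert_iff.1 hx with rfl | ⟨q, hq, μ, hμ0, hμ1, rfl⟩
        · exact ⟨0, le_rfl, zero_le_one, hs0, fun m hm _ _ => ⟨x, hvc, by module,
            fun h => absurd h hm.ne⟩⟩
        · have hsq : s q = 1 := (hC.mem_iff q (hcN (hβc hq))).1 (hβN hq)
          refine ⟨μ, hμ0, hμ1, by rw [(hsm q (hβc hq) μ hμ0 hμ1).2, hsq, mul_one],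
            fun m hm hμm hm1 => ⟨(1 - μ / m) • v + (μ / m) • q, ?_, ?_, ?_⟩⟩
          · exact (hsm q (hβc hq) (μ / m) (div_nonneg hμ0 hm.le) ((div_le_one hm).2 hμm)).1
          · rw [smul_add, smul_smul, smul_smul, mul_sub, mul_div_cancel₀ _ hm.ne']
            module
          · rintro rfl
            rw [div_self hm.ne']
            simpa using hq
      have hm0 : 0 ≤ max μ ‖b‖ := hμ0.trans (le_max_left _ _)
      rcases hm0.eq_or_lt with h0 | h0
      · left
        have hb0 : b = 0 := norm_le_zero_iff.1 (h0 ▸ le_max_right _ _)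
        have hμ0' : μ = 0 := le_antisymm (h0 ▸ le_max_left _ _) hμ0
        rw [hC.zero v hv x (hcD hx) (hμx.trans hμ0'), hb0]
        rfl
      · right
        obtain ⟨y, hy, hxy, hyβ⟩ := hray _ h0 (le_max_left _ _) (max_le hμ1 hb1)
        have hmem : (y, (max μ ‖b‖)⁻¹ • b) ∈ ⋃ r ∈ Q, convexHull ℝ (r : Set (V × (Fin n → ℝ))) := by
          rw [← hQU]
          have hn : ‖(max μ ‖b‖)⁻¹ • b‖ = ‖b‖ / max μ ‖b‖ := by
            rw [norm_smul, norm_inv, Real.norm_of_nonneg hm0, div_eq_inv_mul]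
          rcases max_choice μ ‖b‖ with h | h
          · left
            refine ⟨hyβ h.symm, mem_closedBall_zero_iff.2 ?_⟩
            rw [hn]; exact (div_le_one h0).2 (le_max_right _ _)
          · right
            refine ⟨hy, mem_sphere_zero_iff_norm.2 ?_⟩
            rw [hn, h]; rw [h] at h0; exact div_self h0.ne'
        obtain ⟨r, hr, hyr⟩ := mem_iUnion₂.1 hmem
        refine mem_biUnion hr (mem_convexHull_insert_iff.2 (Or.inr ⟨_, hyr, max μ ‖b‖, hm0,
          max_le hμ1 hb1, ?_⟩))
        ext1
        · exact hxy
        · simp [hp₀, smul_smul, mul_inv_cancel₀ h0.ne']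
    · rintro q (hq | hq)
      · rw [mem_singleton_iff.1 hq]
        exact ⟨hvc, by simp [hp₀, plBall]⟩
      · obtain ⟨r, hr, hqr⟩ := mem_iUnion₂.1 hq
        rcases mem_convexHull_insert_iff.1 hqr with rfl | ⟨q', hq', m, hm0, hm1, rfl⟩
        · exact ⟨hvc, by simp [hp₀, plBall]⟩
        · obtain ⟨h1, h2, -⟩ := hdom q' (mem_biUnion hr hq')
          refine ⟨(hsm _ h1 m hm0 hm1).1, mem_closedBall_zero_iff.2 ?_⟩
          have e2 : ((1 - m) • p₀ + m • q').2 = m • q'.2 := by simp [hp₀]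
          rw [e2, norm_smul, Real.norm_of_nonneg hm0]
          exact mul_le_one₀ hm1 (norm_nonneg _) h2
  · rintro r (rfl | ⟨r, hr, rfl⟩)
    · intro x hx y hy a b ha hb hab
      simp only [Finset.coe_singleton, convexHull_singleton, mem_singleton_iff] at hx hy
      rw [hx, hy, ← add_smul, ← add_smul, hab, one_smul, one_smul]
    · simp only [Finset.coe_insert]
      have hrU : ∀ q ∈ convexHull ℝ (r : Set (V × (Fin n → ℝ))),
          q ∈ ⋃ r ∈ Q, convexHull ℝ (r : Set (V × (Fin n → ℝ))) := fun q hq => mem_biUnion hr hq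
      have hHq : ∀ q ∈ convexHull ℝ (r : Set (V × (Fin n → ℝ))),
          coneExt e s c H q.1 q.2 = H q.1 q.2 := by
        intro q hq
        obtain ⟨h1, h2, h3⟩ := hdom q (hrU q hq)
        exact coneExt_eq_of_max_eq_one (hC.max_eq_one (hcN h1) h2 h3)
      refine ConvexAffineOn.cone ((hQF r hr).congr (convex_convexHull ℝ _) hHq) ?_
      intro q hq m hm0 hm1
      simp only [hp₀val]
      rw [hHq q hq]
      exact hform q (hrU q hq) m hm0 hm1

theorem ContractsPL.cone (hC : IsCone f N N₁ F D s) (hR : IsConeRegion e N F D s R)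
    (h : ContractsPL f e N₁ R) : ContractsPL f e N R := by
  classical
  obtain ⟨δ₁, hδ₁, h⟩ := h
  obtain ⟨δ₀, hδ₀, hball⟩ := hR.ball
  obtain ⟨c, hc⟩ := hC.exists_apexMap
  refine ⟨min δ₁ δ₀, lt_min hδ₁ hδ₀, fun n G hG1 hG2 hG3 => ?_⟩
  have hN₁S : (N ×ˢ plSphere n) ∩ (N₁ ×ˢ plBall n) = N₁ ×ˢ plSphere n := by
    ext ⟨x, b⟩
    simp only [mem_inter_iff, mem_prod]
    exact ⟨fun h => ⟨h.2.1, h.1.2⟩, fun h => ⟨⟨hC.subset_left h.1, h.2⟩, h.1,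
      Metric.sphere_subset_closedBall h.2⟩⟩
  have hG1' := hG1.inter (hC.polyhedral.prod (isPolyhedral_plBall n))
  rw [hN₁S] at hG1'
  obtain ⟨H₁, h1, h2, h3, h4⟩ := h n G hG1'
    (fun b hb x hx y hy => hG2 b hb x (hC.subset_left hx) y (hC.subset_left hy))
    (fun b hb x hx => (hG3 b hb x (hC.subset_left hx)).trans_le (min_le_left _ _))
  let H : V → (Fin n → ℝ) → E := fun y b => if y ∈ N₁ then H₁ (y, b) else G (y, b)
  have hS : ∀ b : Fin n → ℝ, ‖b‖ = 1 → b ∈ plSphere n := fun b hb => mem_sphere_zero_iff_norm.2 hb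
  have hBall : ∀ b : Fin n → ℝ, ‖b‖ ≤ 1 → b ∈ plBall n := fun b hb => mem_closedBall_zero_iff.2 hb
  have hHN₁ : ∀ y ∈ N₁, ∀ b, H y b = H₁ (y, b) := fun y hy b => by simp [H, hy]
  have hHG : ∀ y b, ‖b‖ = 1 → H y b = G (y, b) := fun y b hb => by
    by_cases hy1 : y ∈ N₁
    · rw [hHN₁ y hy1, h4 ⟨hy1, hS b hb⟩]
    · simp [H, hy1]
  have hHR : ∀ p ∈ coneDom N s (Fin n → ℝ), H p.1 p.2 ∈ R p.1 := by
    rintro ⟨y, b⟩ ⟨hy, hb, hs | hb1⟩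
    · have hy1 := (hC.mem_iff y hy).2 hs
      simp only [hHN₁ y hy1]
      exact h3 b (hBall b hb) y hy1
    · simp only at hb1 hy
      simp only [hHG y b hb1]
      exact hball y hy ((hG3 b (hS b hb1) y hy).trans_le (min_le_right _ _))
  have hHinj : ∀ b, FibInj f {x | (x, b) ∈ coneDom N s (Fin n → ℝ)} (fun x => H x b) := by
    rintro b x ⟨hx, hb, hxs⟩ y ⟨hy, -, hys⟩ hf heq
    simp only at hx hb hxs hy hys heq
    by_cases hb1 : ‖b‖ = 1
    · rw [hHG x b hb1, hHG y b hb1] at heq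
      exact hG2 b (hS b hb1) x hx y hy hf heq
    · have hx1 := (hC.mem_iff x hx).2 (hxs.resolve_right hb1)
      have hy1 := (hC.mem_iff y hy).2 (hys.resolve_right hb1)
      rw [hHN₁ x hx1, hHN₁ y hy1] at heq
      exact h2 b (hBall b hb) x hx1 y hy1 hf heq
  refine ⟨fun p => coneExt e s c H p.1 p.2, hC.hasPLCover_coneExt hc (h1.congr ?_) (hG1.congr ?_),
    ?_, ?_, ?_⟩
  · rintro ⟨x, b⟩ ⟨hx, -⟩
    exact hHN₁ x hx b
  · rintro ⟨x, b⟩ ⟨-, hb⟩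
    exact hHG x b (mem_sphere_zero_iff_norm.1 hb)
  · intro b hb
    exact hC.coneExt_fibInj hR hc hHR hHinj (mem_closedBall_zero_iff.1 hb)
  · intro b hb x hx
    exact hC.coneExt_mem hR hc hHR hx (mem_closedBall_zero_iff.1 hb)
  · rintro ⟨x, b⟩ ⟨hx, hb⟩
    have hb1 := mem_sphere_zero_iff_norm.1 hb
    change coneExt e s c H x b = _
    rw [coneExt_eq_of_max_eq_one (hC.max_eq_one hx hb1.le (Or.inr hb1)), hHG x b hb1]

end ConePL

/-! ### Barycentric coordinates and subcomplexes of the target. -/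

namespace Geometry.SimplicialComplex

variable {W : Type*} [AddCommGroup W] [Module ℝ W]

open Classical in
/-- The barycentric coordinate of a point of a simplicial complex at `w`. -/
noncomputable def coord (L : SimplicialComplex ℝ W) (w y : W) : ℝ :=
  if h : ∃ ω : W → ℝ, ∃ τ ∈ L.faces, IsBary τ ω y then h.choose w else 0

theorem coord_eq (L : SimplicialComplex ℝ W) {τ : Finset W} (hτ : τ ∈ L.faces) {ω : W → ℝ} {y : W}
    (h : IsBary τ ω y) (w : W) : L.coord w y = ω w := by
  have hex : ∃ ω : W → ℝ, ∃ τ ∈ L.faces, IsBary τ ω y := ⟨ω, τ, hτ, h⟩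
  rw [coord, dif_pos hex]
  obtain ⟨τ', hτ', h'⟩ := hex.choose_spec
  rw [L.isBary_unique hτ' hτ h' h]

theorem coord_nonneg (L : SimplicialComplex ℝ W) {τ : Finset W} (hτ : τ ∈ L.faces) {y : W}
    (h : y ∈ convexHull ℝ (τ : Set W)) (w : W) : 0 ≤ L.coord w y := by
  obtain ⟨ω, hω⟩ := exists_isBary h
  rw [L.coord_eq hτ hω]; exact hω.nonneg w

theorem coord_le_one (L : SimplicialComplex ℝ W) {τ : Finset W} (hτ : τ ∈ L.faces) {y : W}
    (h : y ∈ convexHull ℝ (τ : Set W)) (w : W) : L.coord w y ≤ 1 := by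
  obtain ⟨ω, hω⟩ := exists_isBary h
  rw [L.coord_eq hτ hω]
  by_cases hw : w ∈ τ
  · rw [← hω.sum]; exact Finset.single_le_sum (fun v _ => hω.nonneg v) hw
  · rw [hω.supp w hw]; exact zero_le_one

theorem coord_eq_zero (L : SimplicialComplex ℝ W) {τ : Finset W} (hτ : τ ∈ L.faces) {y w : W}
    (h : y ∈ convexHull ℝ (τ : Set W)) (hw : w ∉ τ) : L.coord w y = 0 := by
  obtain ⟨ω, hω⟩ := exists_isBary h
  rw [L.coord_eq hτ hω, hω.supp w hw]

theorem eq_of_coord_eq_one (L : SimplicialComplex ℝ W) {τ : Finset W} (hτ : τ ∈ L.faces) {y w : W}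
    (h : y ∈ convexHull ℝ (τ : Set W)) (h1 : L.coord w y = 1) : y = w := by
  classical
  obtain ⟨ω, hω⟩ := exists_isBary h
  rw [L.coord_eq hτ hω] at h1
  have hw : w ∈ τ := by
    by_contra hw
    rw [hω.supp w hw] at h1
    exact zero_ne_one h1
  have h2 : ∑ v ∈ τ.erase w, ω v = 0 := by
    have := Finset.add_sum_erase τ ω hw
    rw [hω.sum, h1] at this
    linarith
  rw [Finset.sum_eq_zero_iff_of_nonneg fun v _ => hω.nonneg v] at h2
  have h3 : IsBary {w} ω y := hω.restrict (Finset.singleton_subset_iff.2 hw) fun v hv hvw =>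
    h2 v (Finset.mem_erase.2 ⟨fun h => hvw (Finset.mem_singleton.2 h), hv⟩)
  have := h3.eq
  rw [Finset.sum_singleton, h1, one_smul] at this
  exact this.symm

theorem coord_self (L : SimplicialComplex ℝ W) {w : W} (hw : {w} ∈ L.faces) :
    L.coord w w = 1 := by
  classical
  have : IsBary {w} (fun v => if v = w then 1 else 0) w :=
    ⟨fun v => by split_ifs <;> norm_num, fun v hv => by
      rw [if_neg fun h => hv (Finset.mem_singleton.2 h)], by simp, by simp⟩
  rw [L.coord_eq hw this, if_pos rfl]

theorem convexAffineOn_coord (L : SimplicialComplex ℝ W) {τ : Finset W} (hτ : τ ∈ L.faces) (w : W) :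
    ConvexAffineOn (L.coord w) (convexHull ℝ (τ : Set W)) := by
  intro x hx y hy a b ha hb hab
  obtain ⟨ω, hω⟩ := exists_isBary hx
  obtain ⟨ω', hω'⟩ := exists_isBary hy
  have h : IsBary τ (fun v => a * ω v + b * ω' v) (a • x + b • y) := by
    refine ⟨fun v => add_nonneg (mul_nonneg ha (hω.nonneg v)) (mul_nonneg hb (hω'.nonneg v)),
      fun v hv => by rw [hω.supp v hv, hω'.supp v hv]; simp, ?_, ?_⟩
    · rw [Finset.sum_add_distrib, ← Finset.mul_sum, ← Finset.mul_sum, hω.sum, hω'.sum]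
      simpa using hab
    · simp only [add_smul, mul_smul, Finset.sum_add_distrib, ← Finset.smul_sum, hω.eq, hω'.eq]
  rw [L.coord_eq hτ h, L.coord_eq hτ hω, L.coord_eq hτ hω']
  rfl

/-- The part of a simplex seen from a vertex `w` under a dilation centred at `w`. -/
theorem dilate_mem (L : SimplicialComplex ℝ W) {τ : Finset W} (hτ : τ ∈ L.faces) {w y : W}
    (hw : w ∈ τ) (hy : y ∈ convexHull ℝ (τ : Set W)) {m : ℝ} (hm : 0 < m)
    (hym : 1 - L.coord w y ≤ m) :
    w + m⁻¹ • (y - w) ∈ convexHull ℝ (τ : Set W) ∧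
      1 - L.coord w (w + m⁻¹ • (y - w)) = (1 - L.coord w y) / m := by
  classical
  obtain ⟨ω, hω⟩ := exists_isBary hy
  rw [L.coord_eq hτ hω] at hym ⊢
  -- The dilation scales all weights by `m⁻¹` and restores their sum at `w`; `hym` is exactly
  -- nonnegativity of the weight at `w`.
  have h : IsBary τ (fun v => m⁻¹ * ω v + if v = w then 1 - m⁻¹ else 0)
      (w + m⁻¹ • (y - w)) := by
    refine ⟨fun v => ?_, fun v hv => ?_, ?_, ?_⟩
    · by_cases hvw : v = w
      · subst hvw
        rw [if_pos rfl]
        have h1 : m⁻¹ * (1 - ω v) ≤ 1 := by rwa [inv_mul_le_iff₀ hm, mul_one]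
        linarith
      · rw [if_neg hvw, add_zero]
        exact mul_nonneg (inv_nonneg.2 hm.le) (hω.nonneg v)
    · rw [hω.supp v hv, if_neg (show ¬ v = w from fun h => hv (h ▸ hw))]; simp
    · rw [Finset.sum_add_distrib, ← Finset.mul_sum, hω.sum, Finset.sum_ite_eq' τ w, if_pos hw]
      ring
    · simp only [add_smul, mul_smul, Finset.sum_add_distrib, ← Finset.smul_sum, hω.eq, ite_smul,
        zero_smul, Finset.sum_ite_eq' τ w, if_pos hw]
      module
  refine ⟨h.mem, ?_⟩
  rw [L.coord_eq hτ h, if_pos rfl]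
  field_simp
  ring

/-- The union of the simplices in a family. -/
def spaceOf (T : Set (Finset W)) : Set W := ⋃ τ ∈ T, convexHull ℝ (τ : Set W)

theorem mem_spaceOf {T : Set (Finset W)} {y : W} :
    y ∈ spaceOf T ↔ ∃ τ ∈ T, y ∈ convexHull ℝ (τ : Set W) := by
  simp [spaceOf]

/-- A subcomplex, as a family of faces closed under passing to nonempty subsets. -/
structure IsSub (L : SimplicialComplex ℝ W) (T : Set (Finset W)) : Prop where
  subset : T ⊆ L.faces
  down : ∀ τ ∈ T, ∀ σ ⊆ τ, σ.Nonempty → σ ∈ T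

theorem IsSub.exists_carrier {L : SimplicialComplex ℝ W} {T : Set (Finset W)} (hT : L.IsSub T)
    {y : W} (hy : y ∈ spaceOf T) : ∃ τ ∈ T, L.IsCarrier y τ := by
  obtain ⟨τ, hτ, hyτ⟩ := mem_spaceOf.1 hy
  obtain ⟨σ, hσ⟩ := L.exists_isCarrier (hT.subset hτ) hyτ
  exact ⟨σ, hT.down τ hτ σ (hσ.2.2 τ (hT.subset hτ) hyτ) (L.nonempty_of_mem_faces hσ.1), hσ⟩

theorem IsSub.remove {L : SimplicialComplex ℝ W} {T : Set (Finset W)} (hT : L.IsSub T)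
    (A : Set W) : L.IsSub {τ ∈ T | ∀ w ∈ A, w ∉ τ} :=
  ⟨fun _ h => hT.subset h.1, fun τ hτ σ hσ hne => ⟨hT.down τ hτ.1 σ hσ hne,
    fun w hw hwσ => hτ.2 w hw (hσ hwσ)⟩⟩

theorem IsSub.mem_remove_iff {L : SimplicialComplex ℝ W} {T : Set (Finset W)} (hT : L.IsSub T)
    {w y : W} (hy : y ∈ spaceOf T) :
    y ∈ spaceOf {τ ∈ T | w ∉ τ} ↔ L.coord w y = 0 := by
  classical
  constructor
  · intro h
    obtain ⟨τ, hτ, hyτ⟩ := mem_spaceOf.1 h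
    exact L.coord_eq_zero (hT.subset hτ.1) hyτ hτ.2
  · intro h
    obtain ⟨τ, hτ, hyτ⟩ := mem_spaceOf.1 hy
    obtain ⟨ω, hω⟩ := exists_isBary hyτ
    rw [L.coord_eq (hT.subset hτ) hω] at h
    have h1 : IsBary (τ.erase w) ω y := hω.restrict (Finset.erase_subset _ _) fun v hv hv' => by
      by_cases hvw : v = w
      · rw [hvw, h]
      · exact absurd (Finset.mem_erase.2 ⟨hvw, hv⟩) hv'
    refine mem_spaceOf.2 ⟨τ.erase w, ⟨hT.down τ hτ _ (Finset.erase_subset _ _) ?_,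
      Finset.notMem_erase _ _⟩, h1.mem⟩
    exact Finset.coe_nonempty.1 (convexHull_nonempty_iff.1 ⟨y, h1.mem⟩)

end Geometry.SimplicialComplex

/-! ### The cone structure of `f` over the star of a vertex. -/

section Preimage

variable {V W : Type*} [AddCommGroup V] [Module ℝ V] [AddCommGroup W] [Module ℝ W]

theorem ConvexAffineOn.preimage_convexHull [DecidableEq V] {f : V → W} {C : Set V}
    (hC : Convex ℝ C)
    (hf : ConvexAffineOn f C) (hinj : InjOn f C) {T : Finset W} {g : W → V}
    (hg : ∀ u ∈ T, g u ∈ C ∧ f (g u) = u) :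
    C ∩ f ⁻¹' convexHull ℝ (T : Set W) = convexHull ℝ ((T.image g : Finset V) : Set V) := by
  have hsub : convexHull ℝ ((T.image g : Finset V) : Set V) ⊆ C := by
    refine convexHull_min ?_ hC
    rintro _ hv
    obtain ⟨u, hu, rfl⟩ := Finset.mem_image.1 (Finset.mem_coe.1 hv)
    exact (hg u hu).1
  apply Subset.antisymm
  · rintro x ⟨hx, hfx⟩
    have hconv : Convex ℝ (f '' convexHull ℝ ((T.image g : Finset V) : Set V)) := by
      rintro _ ⟨y, hy, rfl⟩ _ ⟨z, hz, rfl⟩ a b ha hb hab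
      exact ⟨a • y + b • z, convex_convexHull ℝ _ hy hz ha hb hab,
        hf y (hsub hy) z (hsub hz) a b ha hb hab⟩
    obtain ⟨z, hz, hzx⟩ := convexHull_min (t := f '' convexHull ℝ ((T.image g : Finset V) : Set V))
      (fun u hu => ⟨g u, subset_convexHull ℝ _ (Finset.mem_coe.2 (Finset.mem_image_of_mem g hu)),
        (hg u hu).2⟩) hconv hfx
    exact hinj (hsub hz) hx hzx ▸ hz
  · refine convexHull_min (t := C ∩ f ⁻¹' convexHull ℝ (T : Set W)) ?_ ?_
    · rintro _ hv
      obtain ⟨u, hu, rfl⟩ := Finset.mem_image.1 (Finset.mem_coe.1 hv)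
      refine ⟨(hg u hu).1, ?_⟩
      rw [mem_preimage, (hg u hu).2]
      exact subset_convexHull ℝ _ hu
    · intro y hy z hz a b ha hb hab
      refine ⟨hC hy.1 hz.1 ha hb hab, ?_⟩
      rw [mem_preimage, hf y hy.1 z hz.1 a b ha hb hab]
      exact convex_convexHull ℝ _ hy.2 hz.2 ha hb hab

end Preimage

open Geometry Geometry.SimplicialComplex

/-- A triangulation `K` on whose simplices `f` is affine and injective, and a simplicial complex
`L` compatible with the images of the simplices of `K` and of their intersections. -/
structure IsSheeted {V W : Type*} [AddCommGroup V] [Module ℝ V] [AddCommGroup W] [Module ℝ W]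
    (f : V → W) (K : SimplicialComplex ℝ V) (L : SimplicialComplex ℝ W) : Prop where
  finite : K.faces.Finite
  finite' : L.faces.Finite
  affine : ∀ s ∈ K.faces, ConvexAffineOn f (convexHull ℝ (s : Set V))
  inj : ∀ s ∈ K.faces, InjOn f (convexHull ℝ (s : Set V))
  compat : ∀ s ∈ K.faces, ∀ t ∈ K.faces,
    L.Compat (f '' (convexHull ℝ (s : Set V) ∩ convexHull ℝ (t : Set V)))

namespace IsSheeted

section

variable {V W : Type*} [AddCommGroup V] [Module ℝ V] [AddCommGroup W] [Module ℝ W]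
  {f : V → W} {K : SimplicialComplex ℝ V} {L : SimplicialComplex ℝ W}

theorem subset_image (h : IsSheeted f K L) {s : Finset V} (hs : s ∈ K.faces) {x : V}
    (hx : x ∈ convexHull ℝ (s : Set V)) {τ : Finset W} (hτ : L.IsCarrier (f x) τ) :
    convexHull ℝ (τ : Set W) ⊆ f '' convexHull ℝ (s : Set V) := by
  have := h.compat s hs s hs (f x) τ ⟨x, ⟨hx, hx⟩, rfl⟩ hτ
  rwa [inter_self] at this

/-- The cone over the apex `v` lying over the vertex `w`. -/
def cone (f : V → W) (K : SimplicialComplex ℝ V) (T : Set (Finset W)) (w : W) (v : V) : Set V :=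
  {x | ∃ s ∈ K.faces, v ∈ convexHull ℝ (s : Set V) ∧ x ∈ convexHull ℝ (s : Set V) ∧
    ∃ τ ∈ T, w ∈ τ ∧ convexHull ℝ (τ : Set W) ⊆ f '' convexHull ℝ (s : Set V) ∧
      f x ∈ convexHull ℝ (τ : Set W)}

/-- By compatibility, whenever `x` lies in a simplex `s`, the carrier `τ` of `f x` lies in the image
of `s`. The preimage is thus a union of cells `s ∩ f⁻¹(τ)`, each the hull of the preimages in `s` of
the vertices of `τ`. -/
theorem isPolyhedral_preimage (h : IsSheeted f K L) {T : Set (Finset W)} (hT : L.IsSub T) :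
    IsPolyhedral (K.space ∩ f ⁻¹' spaceOf T) := by
  classical
  have heq : K.space ∩ f ⁻¹' spaceOf T = ⋃ s ∈ K.faces,
      ⋃ τ ∈ {τ ∈ T | convexHull ℝ (τ : Set W) ⊆ f '' convexHull ℝ (s : Set V)},
        convexHull ℝ (s : Set V) ∩ f ⁻¹' convexHull ℝ (τ : Set W) := by
    ext x
    simp only [mem_iUnion, exists_prop]
    constructor
    · rintro ⟨hx, hfx⟩
      obtain ⟨s, hs, hxs⟩ := mem_space_iff.1 hx
      obtain ⟨τ, hτ, hc⟩ := hT.exists_carrier hfx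
      exact ⟨s, hs, τ, ⟨hτ, h.subset_image hs hxs hc⟩, hxs, hc.2.1⟩
    · rintro ⟨s, hs, τ, hτ, hxs, hxτ⟩
      exact ⟨mem_space_iff.2 ⟨s, hs, hxs⟩, mem_spaceOf.2 ⟨τ, hτ.1, hxτ⟩⟩
  rw [heq]
  refine IsPolyhedral.biUnion h.finite fun s hs => IsPolyhedral.biUnion
    (h.finite'.subset fun τ hτ => hT.subset hτ.1) fun τ hτ => ?_
  have hex : ∀ u ∈ τ, ∃ x ∈ convexHull ℝ (s : Set V), f x = u := fun u hu =>
    hτ.2 (subset_convexHull ℝ (τ : Set W) (Finset.mem_coe.2 hu))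
  choose! g hg hgf using hex
  rw [(h.affine s hs).preimage_convexHull (convex_convexHull ℝ _) (h.inj s hs)
    (fun u hu => ⟨hg u hu, hgf u hu⟩)]
  exact IsPolyhedral.convexHull _

/-- The dilated point of `τ` has a preimage in `s`, and injectivity of the affine map `f` on `s`
identifies it with the dilation of `x` about `v`. -/
theorem ray (h : IsSheeted f K L) {s : Finset V} (hs : s ∈ K.faces) {τ : Finset W}
    (hτ : τ ∈ L.faces) {v x : V} {w : W} (hw : w ∈ τ)
    (hsub : convexHull ℝ (τ : Set W) ⊆ f '' convexHull ℝ (s : Set V))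
    (hv : v ∈ convexHull ℝ (s : Set V)) (hvw : f v = w) (hx : x ∈ convexHull ℝ (s : Set V))
    (hfx : f x ∈ convexHull ℝ (τ : Set W)) {m : ℝ} (hm : 0 < m) (hm1 : m ≤ 1)
    (hxm : 1 - L.coord w (f x) ≤ m) :
    v + m⁻¹ • (x - v) ∈ convexHull ℝ (s : Set V) ∧
      f (v + m⁻¹ • (x - v)) ∈ convexHull ℝ (τ : Set W) ∧
      f (v + m⁻¹ • (x - v)) = w + m⁻¹ • (f x - w) ∧
      1 - L.coord w (f (v + m⁻¹ • (x - v))) = (1 - L.coord w (f x)) / m := by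
  obtain ⟨h1, h2⟩ := L.dilate_mem hτ hw hfx hm hxm
  obtain ⟨z, hz, hfz⟩ := hsub h1
  have h3 : (1 - m) • v + m • z = x := by
    refine h.inj s hs (convex_convexHull ℝ _ hv hz (by linarith) hm.le (by ring)) hx ?_
    rw [h.affine s hs v hv z hz _ _ (by linarith) hm.le (by ring), hfz, hvw, smul_add, smul_smul,
      mul_inv_cancel₀ hm.ne']
    module
  have h4 : v + m⁻¹ • (x - v) = z := by
    have : x - v = m • (z - v) := by rw [← h3]; module
    rw [this, smul_smul, inv_mul_cancel₀ hm.ne', one_smul, add_sub_cancel]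
  rw [h4, hfz]
  exact ⟨hz, h1, rfl, h2⟩

/-- This is where compatibility with intersections enters. If `x` lies in `s` and `t`, the carrier
of `f x` lies in the image of `s ∩ t`; so its vertex `w` has a preimage in `s ∩ t`, which is `v` by
injectivity on `s`. -/
theorem apex_mem (h : IsSheeted f K L) {T : Set (Finset W)} (hT : L.IsSub T)
    {v x : V} {w : W} (hvw : f v = w) (hx : x ∈ cone f K T w v) (hs : 1 - L.coord w (f x) < 1)
    {t : Finset V} (ht : t ∈ K.faces) (hxt : x ∈ convexHull ℝ (t : Set V)) :
    v ∈ convexHull ℝ (t : Set V) ∧ ∃ τ ∈ T, L.IsCarrier (f x) τ ∧ w ∈ τ ∧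
      convexHull ℝ (τ : Set W) ⊆ f '' convexHull ℝ (t : Set V) := by
  obtain ⟨s, hsK, hvs, hxs, τ, hτ, hwτ, hsub, hfx⟩ := hx
  obtain ⟨σ, hσ, hc⟩ := hT.exists_carrier (mem_spaceOf.2 ⟨τ, hτ, hfx⟩)
  have hwσ : w ∈ σ := by
    by_contra hw
    rw [L.coord_eq_zero hc.1 hc.2.1 hw] at hs
    linarith
  obtain ⟨u, ⟨hus, hut⟩, huw⟩ := h.compat s hsK t ht (f x) σ ⟨x, ⟨hxs, hxt⟩, rfl⟩ hc
    (subset_convexHull ℝ _ hwσ)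
  obtain rfl := h.inj s hsK hus hvs (huw.trans hvw.symm)
  exact ⟨hut, σ, hσ, hc, hwσ, h.subset_image ht hxt hc⟩

end

section

variable {V W : Type*} [NormedAddCommGroup V] [NormedSpace ℝ V] [FiniteDimensional ℝ V]
  [NormedAddCommGroup W] [NormedSpace ℝ W] [FiniteDimensional ℝ W]
  {f : V → W} {K : SimplicialComplex ℝ V} {L : SimplicialComplex ℝ W}

theorem continuousOn (h : IsSheeted f K L) : ContinuousOn f K.space :=
  HasPLCover.continuousOn ⟨K.faces, h.finite, rfl, h.affine⟩

/-- The cone parameter is one minus the barycentric coordinate at `w` of the image point: it is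
constant on fibres, vanishes just over `w`, and equals `1` just outside the open star. Cones are
disjoint over the open star because any simplex through a point there contains its apex
(`apex_mem`). -/
theorem isCone (h : IsSheeted f K L) {T : Set (Finset W)} (hT : L.IsSub T) (w : W) :
    IsCone f (K.space ∩ f ⁻¹' spaceOf T) (K.space ∩ f ⁻¹' spaceOf {τ ∈ T | w ∉ τ})
      {v ∈ K.space | f v = w ∧ {w} ∈ T} (cone f K T w) (fun x => 1 - L.coord w (f x)) := by
  classical
  have hT₁ : L.IsSub {τ ∈ T | w ∉ τ} := by
    have := hT.remove {w}
    simpa using this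
  have hcone : ∀ v, cone f K T w v ⊆ K.space ∩ f ⁻¹' spaceOf T := by
    rintro v x ⟨s, hs, -, hxs, τ, hτ, -, -, hfx⟩
    exact ⟨mem_space_iff.2 ⟨s, hs, hxs⟩, mem_spaceOf.2 ⟨τ, hτ, hfx⟩⟩
  have hmem : ∀ x ∈ K.space ∩ f ⁻¹' spaceOf T, ∃ τ ∈ L.faces, f x ∈ convexHull ℝ (τ : Set W) := by
    rintro x ⟨-, hx⟩
    obtain ⟨τ, hτ, hx⟩ := mem_spaceOf.1 hx
    exact ⟨τ, hT.subset hτ, hx⟩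
  refine
  { finite := ?_
    cover := ?_
    polyhedral := h.isPolyhedral_preimage hT₁
    nonneg := ?_
    le_one := ?_
    mem_iff := ?_
    continuousOn := ?_
    apex_mem := ?_
    apex_zero := ?_
    zero := ?_
    sep := ?_
    fib := fun x _ x' _ hf => by simp only [hf]
    ray := ?_
    poly := ?_ }
  · refine (h.finite.biUnion (t := fun s => {v ∈ convexHull ℝ (s : Set V) | f v = w})
      fun s hs => Set.Subsingleton.finite ?_).subset ?_
    · rintro x ⟨hx, hfx⟩ y ⟨hy, hfy⟩
      exact h.inj s hs hx hy (hfx.trans hfy.symm)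
    · rintro v ⟨hv, hvw, -⟩
      obtain ⟨s, hs, hvs⟩ := mem_space_iff.1 hv
      exact mem_biUnion hs ⟨hvs, hvw⟩
  · apply Subset.antisymm
    · rintro x ⟨hx, hfx⟩
      obtain ⟨s, hs, hxs⟩ := mem_space_iff.1 hx
      obtain ⟨τ, hτ, hc⟩ := hT.exists_carrier hfx
      by_cases hw : w ∈ τ
      · have hsub := h.subset_image hs hxs hc
        obtain ⟨v, hvs, hvw⟩ := hsub (subset_convexHull ℝ _ hw)
        refine Or.inr (mem_biUnion (x := v) ⟨mem_space_iff.2 ⟨s, hs, hvs⟩, hvw, ?_⟩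
          ⟨s, hs, hvs, hxs, τ, hτ, hw, hsub, hc.2.1⟩)
        exact hT.down τ hτ _ (Finset.singleton_subset_iff.2 hw) (Finset.singleton_nonempty _)
      · exact Or.inl ⟨hx, mem_spaceOf.2 ⟨τ, ⟨hτ, hw⟩, hc.2.1⟩⟩
    · refine union_subset ?_ (iUnion₂_subset fun v _ => hcone v)
      rintro x ⟨hx, hfx⟩
      obtain ⟨τ, hτ, hfx⟩ := mem_spaceOf.1 hfx
      exact ⟨hx, mem_spaceOf.2 ⟨τ, hτ.1, hfx⟩⟩
  · intro x hx
    obtain ⟨τ, hτ, hfx⟩ := hmem x hx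
    have := L.coord_le_one hτ hfx w
    simpa using this
  · intro x hx
    obtain ⟨τ, hτ, hfx⟩ := hmem x hx
    have := L.coord_nonneg hτ hfx w
    simpa using this
  · rintro x ⟨hx, hfx⟩
    simp only [mem_inter_iff, hx, true_and, mem_preimage, hT.mem_remove_iff hfx, sub_eq_self]
  · have h1 : ContinuousOn (L.coord w) L.space :=
      HasPLCover.continuousOn ⟨L.faces, h.finite', rfl, fun τ hτ => L.convexAffineOn_coord hτ w⟩
    refine continuousOn_const.sub (h1.comp (h.continuousOn.mono inter_subset_left) fun x hx => ?_)
    obtain ⟨τ, hτ, hfx⟩ := hmem x hx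
    exact mem_space_iff.2 ⟨τ, hτ, hfx⟩
  · rintro v ⟨hv, hvw, hwT⟩
    obtain ⟨s, hs, hvs⟩ := mem_space_iff.1 hv
    refine ⟨s, hs, hvs, hvs, {w}, hwT, Finset.mem_singleton_self w, ?_, ?_⟩
    · simpa using ⟨v, hvs, hvw⟩
    · simpa using hvw
  · rintro v ⟨hv, hvw, hwT⟩
    simp only [hvw, L.coord_self (hT.subset hwT), sub_self]
  · rintro v ⟨hv, hvw, hwT⟩ x ⟨s, hs, hvs, hxs, τ, hτ, hwτ, hsub, hfx⟩ h0
    have h1 := L.eq_of_coord_eq_one (hT.subset hτ) hfx (sub_eq_zero.1 h0).symm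
    exact h.inj s hs hxs hvs (h1.trans hvw.symm)
  · rintro v ⟨hv, hvw, hwT⟩ v' ⟨hv', hvw', -⟩ x hx hx' hlt
    have hx'' := hx'
    obtain ⟨s, hs, hvs, hxs, -⟩ := hx''
    exact h.inj s hs (h.apex_mem hT hvw hx hlt hs hxs).1 hvs (hvw.trans hvw'.symm)
  · rintro v ⟨hv, hvw, hwT⟩ x ⟨s, hs, hvs, hxs, τ, hτ, hwτ, hsub, hfx⟩ m hm hsm hm1
    obtain ⟨h1, h2, h3, h4⟩ := h.ray hs (hT.subset hτ) hwτ hsub hvs hvw hxs hfx hm hm1 hsm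
    exact ⟨⟨s, hs, hvs, h1, τ, hτ, hwτ, hsub, h2⟩, h4, by rw [hvw, h3]⟩
  · rintro v ⟨hv, hvw, hwT⟩
    set I : Set (Finset V × Finset W) := {p | p.1 ∈ K.faces ∧ v ∈ convexHull ℝ (p.1 : Set V) ∧
      p.2 ∈ T ∧ w ∈ p.2 ∧ convexHull ℝ (p.2 : Set W) ⊆ f '' convexHull ℝ (p.1 : Set V)} with hI
    have hIfin : I.Finite := (h.finite.prod h.finite').subset fun p hp =>
      ⟨hp.1, hT.subset hp.2.2.1⟩
    have hg : ∀ p : Finset V × Finset W, ∃ g : W → V, p ∈ I → ∀ u ∈ p.2,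
        g u ∈ convexHull ℝ (p.1 : Set V) ∧ f (g u) = u := by
      intro p
      by_cases hp : p ∈ I
      · have hex : ∀ u ∈ p.2, ∃ x ∈ convexHull ℝ (p.1 : Set V), f x = u := fun u hu =>
          hp.2.2.2.2 (subset_convexHull ℝ (p.2 : Set W) (Finset.mem_coe.2 hu))
        choose! g hg hgf using hex
        exact ⟨g, fun _ u hu => ⟨hg u hu, hgf u hu⟩⟩
      · exact ⟨fun _ => 0, fun h => absurd h hp⟩
    choose g hg using hg
    have hpre : ∀ p ∈ I, ∀ σ ⊆ p.2,
        convexHull ℝ (p.1 : Set V) ∩ f ⁻¹' convexHull ℝ (σ : Set W) =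
          convexHull ℝ ((σ.image (g p) : Finset V) : Set V) := fun p hp σ hσ =>
      (h.affine p.1 hp.1).preimage_convexHull (convex_convexHull ℝ _) (h.inj p.1 hp.1)
        (fun u hu => hg p hp u (hσ hu))
    have hgw : ∀ p ∈ I, g p w = v := fun p hp =>
      h.inj p.1 hp.1 (hg p hp w hp.2.2.2.1).1 hp.2.1 ((hg p hp w hp.2.2.2.1).2.trans hvw.symm)
    have hins : ∀ p ∈ I, (p.2.image (g p) : Finset V) = insert v ((p.2.erase w).image (g p)) := by
      intro p hp
      conv_lhs => rw [← Finset.insert_erase hp.2.2.2.1, Finset.image_insert, hgw p hp]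
    have hins' : ∀ p ∈ I, convexHull ℝ (insert v (((p.2.erase w).image (g p) : Finset V) : Set V)) =
        convexHull ℝ (p.1 : Set V) ∩ f ⁻¹' convexHull ℝ (p.2 : Set W) := fun p hp => by
      rw [hpre p hp p.2 Subset.rfl, hins p hp, Finset.coe_insert]
    refine ⟨(fun p => (p.2.erase w).image (g p)) '' I, hIfin.image _, ?_, ?_⟩
    · rw [biUnion_image]
      apply Subset.antisymm
      · rintro x ⟨s, hs, hvs, hxs, τ, hτ, hwτ, hsub, hfx⟩
        have hp : (s, τ) ∈ I := ⟨hs, hvs, hτ, hwτ, hsub⟩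
        refine mem_biUnion hp ?_
        rw [hins' _ hp]
        exact ⟨hxs, hfx⟩
      · refine iUnion₂_subset fun p hp x hx => ?_
        rw [hins' _ hp] at hx
        obtain ⟨hs, hvs, hτ, hwτ, hsub⟩ := hp
        exact ⟨p.1, hs, hvs, hx.1, p.2, hτ, hwτ, hsub, hx.2⟩
    · rintro _ ⟨p, hp, rfl⟩
      refine ⟨?_, ?_⟩
      · rw [← hpre p hp _ (Finset.erase_subset _ _)]
        rintro x ⟨hx, hfx⟩
        refine ⟨mem_space_iff.2 ⟨p.1, hp.1, hx⟩, mem_spaceOf.2 ⟨p.2.erase w, ⟨?_,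
          Finset.notMem_erase _ _⟩, hfx⟩⟩
        exact hT.down p.2 hp.2.2.1 _ (Finset.erase_subset _ _)
          (Finset.coe_nonempty.1 (convexHull_nonempty_iff.1 ⟨_, hfx⟩))
      · rw [hins' p hp]
        rintro x ⟨hx, hfx⟩ y ⟨hy, hfy⟩ a b ha hb hab
        simp only [h.affine p.1 hp.1 x hx y hy a b ha hb hab,
          L.convexAffineOn_coord (hT.subset hp.2.2.1) w _ hfx _ hfy a b ha hb hab, smul_eq_mul]
        linear_combination (-1 : ℝ) * hab

variable {E : Type*} [NormedAddCommGroup E] [NormedSpace ℝ E] {e : V → E}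

/-- The values admissible at `x`: those `ρ`-close to the hulls of the `e`-images of all the cells
containing `x`. -/
def region (f : V → W) (K : SimplicialComplex ℝ V) (L : SimplicialComplex ℝ W) (e : V → E) (ρ : ℝ)
    (x : V) : Set E :=
  {z | ∀ s ∈ K.faces, ∀ τ ∈ L.faces, x ∈ convexHull ℝ (s : Set V) →
    f x ∈ convexHull ℝ (τ : Set W) → z ∈ Metric.thickening ρ (convexHull ℝ
      (e '' (convexHull ℝ (s : Set V) ∩ f ⁻¹' convexHull ℝ (τ : Set W))))}

theorem ball_subset_region (e : V → E) (ρ : ℝ) (x : V) :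
    Metric.ball (e x) ρ ⊆ region f K L e ρ x := by
  intro z hz s _ τ _ hxs hxτ
  exact Metric.mem_thickening_iff.2 ⟨e x, subset_convexHull ℝ _ ⟨x, ⟨hxs, hxτ⟩, rfl⟩, hz⟩

theorem region_subset_ball {r ρ : ℝ}
    (hosc : ∀ s ∈ K.faces, ∀ τ ∈ L.faces,
      ∀ x ∈ convexHull ℝ (s : Set V) ∩ f ⁻¹' convexHull ℝ (τ : Set W),
      ∀ y ∈ convexHull ℝ (s : Set V) ∩ f ⁻¹' convexHull ℝ (τ : Set W), dist (e x) (e y) < r)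
    {s : Finset V} (hs : s ∈ K.faces) {τ : Finset W} (hτ : τ ∈ L.faces) {x y : V}
    (hx : x ∈ convexHull ℝ (s : Set V) ∩ f ⁻¹' convexHull ℝ (τ : Set W))
    (hy : y ∈ convexHull ℝ (s : Set V) ∩ f ⁻¹' convexHull ℝ (τ : Set W)) :
    region f K L e ρ x ⊆ Metric.ball (e y) (r + ρ) := by
  intro z hz
  obtain ⟨a, ha, hza⟩ := Metric.mem_thickening_iff.1 (hz s hs τ hτ hx.1 hx.2)
  have h1 : a ∈ Metric.ball (e y) r := by
    refine convexHull_min ?_ (convex_ball _ _) ha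
    rintro _ ⟨x', hx', rfl⟩
    exact hosc s hs τ hτ x' hx' y hy
  rw [Metric.mem_ball] at h1 ⊢
  linarith [dist_triangle z a (e y)]

/-- Every cell containing a point of the cone over the open star of `w` also contains the apex and
the dilated point. The set this cell imposes is convex, so it is preserved by coning from `e v`. -/
theorem isConeRegion (h : IsSheeted f K L) {T : Set (Finset W)} (hT : L.IsSub T) (w : W) {r ρ : ℝ}
    (hρ : 0 < ρ)
    (hosc : ∀ s ∈ K.faces, ∀ τ ∈ L.faces,
      ∀ x ∈ convexHull ℝ (s : Set V) ∩ f ⁻¹' convexHull ℝ (τ : Set W),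
      ∀ y ∈ convexHull ℝ (s : Set V) ∩ f ⁻¹' convexHull ℝ (τ : Set W), dist (e x) (e y) < r)
    (hgap : {w} ∈ T → ∀ v ∈ K.space, ∀ v' ∈ K.space, f v = w → f v' = w → v ≠ v' →
      2 * (r + ρ) ≤ dist (e v) (e v')) :
    IsConeRegion e (K.space ∩ f ⁻¹' spaceOf T) {v ∈ K.space | f v = w ∧ {w} ∈ T}
      (cone f K T w) (fun x => 1 - L.coord w (f x)) (region f K L e ρ) where
  ray := by
    rintro v ⟨hv, hvw, hwT⟩ x hx m hm hsm hm1 z hz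
    -- For `m = 1` the dilation is the identity; for `m < 1` the cone parameter is below `1`, as
    -- `apex_mem` requires.
    rcases hm1.eq_or_lt with rfl | hm1'
    · simpa using hz
    intro s hs τ hτ hxs hxτ
    obtain ⟨hvs, σ, hσ, hc, hwσ, hsub⟩ := h.apex_mem hT hvw hx (hsm.trans_lt hm1') hs hxs
    obtain ⟨h1, h2, -, -⟩ := h.ray hs (hT.subset hσ) hwσ hsub hvs hvw hxs hc.2.1 hm hm1 hsm
    have hστ := hc.2.2 τ hτ hxτ
    have h3 := hz s hs τ hτ h1 (convexHull_mono (Finset.coe_subset.2 hστ) h2)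
    have h4 : e v ∈ Metric.thickening ρ (convexHull ℝ
      (e '' (convexHull ℝ (s : Set V) ∩ f ⁻¹' convexHull ℝ (τ : Set W)))) := by
      refine Metric.self_subset_thickening hρ _ (subset_convexHull ℝ _ ⟨v, ⟨hvs, ?_⟩, rfl⟩)
      rw [mem_preimage, hvw]
      exact subset_convexHull ℝ _ (hστ hwσ)
    exact (convex_convexHull ℝ _).thickening ρ h4 h3 (by linarith) hm.le (by ring)
  apex v _ := ball_subset_region e ρ v (Metric.mem_ball_self hρ)
  ball := ⟨ρ, hρ, fun x _ => ball_subset_region e ρ x⟩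
  sep := by
    refine ⟨r + ρ, ?_, ?_⟩
    · rintro v ⟨hv, hvw, hwT⟩ x ⟨s, hs, hvs, hxs, τ, hτ, hwτ, hsub, hfx⟩
      refine region_subset_ball hosc hs (hT.subset hτ) ⟨hxs, hfx⟩ ⟨hvs, ?_⟩
      rw [mem_preimage, hvw]
      exact subset_convexHull ℝ _ hwτ
    · rintro v ⟨hv, hvw, hwT⟩ v' ⟨hv', hvw', -⟩ hne
      exact hgap hwT v hv v' hv' hvw hvw' hne

end

end IsSheeted

/-! ### Uniform positive bounds from finiteness and compactness. -/

section Bounds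

theorem exists_pos_forall_of_finite {ι : Type*} {I : Set ι} (hI : I.Finite) {P : ι → ℝ → Prop}
    (hanti : ∀ i a b, a ≤ b → P i b → P i a) (h : ∀ i ∈ I, ∃ γ > 0, P i γ) :
    ∃ γ > 0, ∀ i ∈ I, P i γ := by
  induction I, hI using Set.Finite.induction_on with
  | empty => exact ⟨1, one_pos, by simp⟩
  | insert _ _ ih =>
    obtain ⟨γ, hγ, h1⟩ := ih fun i hi => h i (mem_insert_of_mem _ hi)
    obtain ⟨γ', hγ', h2⟩ := h _ (mem_insert _ _)
    refine ⟨min γ γ', lt_min hγ hγ', ?_⟩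
    rintro i (rfl | hi)
    · exact hanti _ _ _ (min_le_right _ _) h2
    · exact hanti _ _ _ (min_le_left _ _) (h1 i hi)

theorem IsCompact.exists_pos_le {X : Type*} [TopologicalSpace X] {T : Set X} (hT : IsCompact T)
    {h : X → ℝ} (hc : ContinuousOn h T) (hpos : ∀ x ∈ T, 0 < h x) :
    ∃ γ > 0, ∀ x ∈ T, γ ≤ h x := by
  rcases T.eq_empty_or_nonempty with rfl | hne
  · exact ⟨1, one_pos, by simp⟩
  · obtain ⟨x, hx, hmin⟩ := hT.exists_isMinOn hne hc
    exact ⟨h x, hpos x hx, hmin⟩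

theorem ContinuousOn.dist_fst_snd {X Y : Type*} [TopologicalSpace X] [PseudoMetricSpace Y]
    {g : X → Y} {N s t : Set X} (hg : ContinuousOn g N) (hs : s ⊆ N) (ht : t ⊆ N) :
    ContinuousOn (fun p : X × X => dist (g p.1) (g p.2)) (s ×ˢ t) :=
  continuous_dist.comp_continuousOn
    ((hg.comp continuous_fst.continuousOn fun _ hp => hs hp.1).prodMk
      (hg.comp continuous_snd.continuousOn fun _ hp => ht hp.2))

end Bounds

/-! ### Induction over the skeleta of the target. -/

section Strata

open Geometry Geometry.SimplicialComplex

universe u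

variable {V W E : Type*} [NormedAddCommGroup V] [NormedSpace ℝ V] [FiniteDimensional ℝ V]
  [NormedAddCommGroup W] [NormedSpace ℝ W] [FiniteDimensional ℝ W]
  [NormedAddCommGroup E] [NormedSpace ℝ E]
  {f : V → W} {K : SimplicialComplex ℝ V} {L L₀ : SimplicialComplex ℝ W} {e : V → E}

/-- Both the topological and the PL contraction property. -/
def Contracts (f : V → W) (e : V → E) (N : Set V) (R : V → Set E) : Prop :=
  ContractsTop.{u} f e N R ∧ ContractsPL f e N R

/-- The `i`-skeleton, indexed by the number of vertices. -/
def Geometry.SimplicialComplex.skel (L : SimplicialComplex ℝ W) (i : ℕ) : Set W :=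
  spaceOf {τ ∈ L.faces | τ.card ≤ i}

theorem IsSheeted.contracts_of_remove (h : IsSheeted f K L) {r ρ : ℝ} (hρ : 0 < ρ)
    (hosc : ∀ s ∈ K.faces, ∀ τ ∈ L.faces,
      ∀ x ∈ convexHull ℝ (s : Set V) ∩ f ⁻¹' convexHull ℝ (τ : Set W),
      ∀ y ∈ convexHull ℝ (s : Set V) ∩ f ⁻¹' convexHull ℝ (τ : Set W), dist (e x) (e y) < r)
    {T : Set (Finset W)} (hT : L.IsSub T) {A : Set W} (hA : A.Finite)
    (hgap : ∀ w ∈ A, {w} ∈ T → ∀ v ∈ K.space, ∀ v' ∈ K.space, f v = w → f v' = w → v ≠ v' →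
      2 * (r + ρ) ≤ dist (e v) (e v'))
    (hc : Contracts.{u} f e (K.space ∩ f ⁻¹' spaceOf {τ ∈ T | ∀ w ∈ A, w ∉ τ})
      (region f K L e ρ)) :
    Contracts.{u} f e (K.space ∩ f ⁻¹' spaceOf T) (region f K L e ρ) := by
  induction A, hA using Set.Finite.induction_on with
  | empty => simpa using hc
  | insert _ _ ih =>
    rename_i w A _ _
    refine ih (fun w' hw' => hgap w' (mem_insert_of_mem _ hw')) ?_
    have hT' := hT.remove A
    have hC := h.isCone hT' w
    have hR := h.isConeRegion (e := e) hT' w hρ hosc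
      fun hw => hgap w (mem_insert _ _) hw.1
    have heq : {τ ∈ {τ ∈ T | ∀ w ∈ A, w ∉ τ} | w ∉ τ} =
        {τ ∈ T | ∀ w' ∈ insert w A, w' ∉ τ} := by
      ext τ
      simp only [mem_ofPred_eq, mem_insert_iff, forall_eq_or_imp]
      tauto
    rw [heq] at hC
    exact ⟨hc.1.cone hC hR, hc.2.cone hC hR⟩

/-- For each triple of simplices `s`, `t` upstairs and `τ` downstairs there are two cases: either
the sheets `s` and `t` coincide over all of `τ`, or they are disjoint over `Y ∩ τ` and compactness
yields a bound. -/
theorem exists_gap (h : IsSheeted f K L₀) (he : ContinuousOn e K.space)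
    (hinj : FibInj f K.space e) {Y : Set W} (hY : IsClosed Y) {i : ℕ}
    (hYi : Disjoint Y (L₀.skel i)) :
    ∃ γ > 0, ∀ v ∈ K.space, ∀ v' ∈ K.space, f v = f v' → f v ∈ Y → f v ∈ L₀.skel (i + 1) →
      v ≠ v' → γ ≤ dist (e v) (e v') := by
  have key := exists_pos_forall_of_finite
    (I := K.faces ×ˢ K.faces ×ˢ {τ ∈ L₀.faces | τ.card ≤ i + 1})
    (P := fun p γ => ∀ v ∈ convexHull ℝ (p.1 : Set V), ∀ v' ∈ convexHull ℝ (p.2.1 : Set V),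
      f v = f v' → f v ∈ Y → f v ∈ convexHull ℝ (p.2.2 : Set W) → v ≠ v' →
        γ ≤ dist (e v) (e v'))
    (h.finite.prod (h.finite.prod (h.finite'.subset fun τ hτ => hτ.1)))
    (fun p a b hab H v hv v' hv' h1 h2 h3 h4 => hab.trans (H v hv v' hv' h1 h2 h3 h4)) ?_
  · obtain ⟨γ, hγ, H⟩ := key
    refine ⟨γ, hγ, fun v hv v' hv' h1 h2 h3 h4 => ?_⟩
    obtain ⟨s, hs, hvs⟩ := mem_space_iff.1 hv
    obtain ⟨t, ht, hvt⟩ := mem_space_iff.1 hv'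
    obtain ⟨τ, hτ, hfτ⟩ := mem_spaceOf.1 h3
    exact H (s, t, τ) ⟨hs, ht, hτ⟩ v hvs v' hvt h1 h2 hfτ h4
  rintro ⟨s, t, τ⟩ ⟨hs, ht, hτ, hcard⟩
  simp only at hs ht hτ hcard ⊢
  have hsK := convexHull_subset_space hs
  have htK := convexHull_subset_space ht
  by_cases hcase : ∃ x ∈ convexHull ℝ (s : Set V) ∩ convexHull ℝ (t : Set V),
      f x ∈ Y ∩ convexHull ℝ (τ : Set W)
  · obtain ⟨x, hx, hxY, hxτ⟩ := hcase
    obtain ⟨σ, hσ⟩ := L₀.exists_isCarrier hτ hxτ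
    have hστ := hσ.2.2 τ hτ hxτ
    have hσi : ¬ σ.card ≤ i := fun hi =>
      hYi.notMem_of_mem_left hxY (mem_spaceOf.2 ⟨σ, ⟨hσ.1, hi⟩, hσ.2.1⟩)
    -- The carrier of a point of `Y` has more than `i` vertices, and `τ` has at most `i + 1`; so one
    -- common point over the interior of `τ` puts all of `τ` in the image of `s ∩ t`.
    obtain rfl : σ = τ := Finset.eq_of_subset_of_card_le hστ (by omega)
    have hsub := h.compat s hs t ht (f x) σ ⟨x, hx, rfl⟩ hσ
    refine ⟨1, one_pos, fun v hv v' hv' h1 _ h3 h4 => absurd ?_ h4⟩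
    obtain ⟨u, ⟨hus, hut⟩, hu⟩ := hsub h3
    rw [← h.inj s hs hus hv hu, ← h.inj t ht hut hv' (hu.trans h1)]
  -- `D` is a compact set of pairs in common fibres, and it misses the diagonal, so `e` separates
  -- each pair.
  · set D : Set (V × V) := (convexHull ℝ (s : Set V) ×ˢ convexHull ℝ (t : Set V)) ∩
      (fun p : V × V => (f p.1 - f p.2, f p.1)) ⁻¹' ({0} ×ˢ (Y ∩ convexHull ℝ (τ : Set W))) with hD
    have hst : IsCompact (convexHull ℝ (s : Set V) ×ˢ convexHull ℝ (t : Set V)) :=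
      s.isCompact_convexHull.prod t.isCompact_convexHull
    have hf1 : ContinuousOn (fun p : V × V => f p.1)
        (convexHull ℝ (s : Set V) ×ˢ convexHull ℝ (t : Set V)) :=
      h.continuousOn.comp (f := Prod.fst) (by fun_prop) fun p hp => hsK hp.1
    have hf2 : ContinuousOn (fun p : V × V => f p.2)
        (convexHull ℝ (s : Set V) ×ˢ convexHull ℝ (t : Set V)) :=
      h.continuousOn.comp (f := Prod.snd) (by fun_prop) fun p hp => htK hp.2
    have hDc : IsCompact D := by
      refine hst.of_isClosed_subset (ContinuousOn.preimage_isClosed_of_isClosed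
        ((hf1.sub hf2).prodMk hf1) hst.isClosed ?_) inter_subset_left
      exact isClosed_singleton.prod (hY.inter τ.isCompact_convexHull.isClosed)
    have hdist := (he.dist_fst_snd hsK htK).mono (inter_subset_left : D ⊆ _)
    obtain ⟨γ, hγ, H⟩ := hDc.exists_pos_le hdist (by
      rintro ⟨v, v'⟩ ⟨⟨hv, hv'⟩, h1, h2⟩
      simp only at hv hv' h2
      have h3 : f v = f v' := sub_eq_zero.1 h1
      refine dist_pos.2 fun heq => hcase ⟨v, ⟨hv, ?_⟩, h2⟩
      rw [hinj v (hsK hv) v' (htK hv') h3 heq]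
      exact hv')
    exact ⟨γ, hγ, fun v hv v' hv' h1 h2 h3 _ => H (v, v') ⟨⟨hv, hv'⟩, sub_eq_zero.2 h1, h2, h3⟩⟩

/-- On a compact simplex the injective map `f` has a uniformly continuous inverse; hence a fine mesh
downstairs controls the oscillation of `e` on the cells upstairs. -/
theorem exists_osc (h : IsSheeted f K L₀) (he : ContinuousOn e K.space) {r : ℝ} (hr : 0 < r) :
    ∃ η > 0, ∀ s ∈ K.faces, ∀ x ∈ convexHull ℝ (s : Set V), ∀ y ∈ convexHull ℝ (s : Set V),
      dist (f x) (f y) < η → dist (e x) (e y) < r := by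
  refine exists_pos_forall_of_finite (P := fun s η => ∀ x ∈ convexHull ℝ (s : Set V),
    ∀ y ∈ convexHull ℝ (s : Set V), dist (f x) (f y) < η → dist (e x) (e y) < r) h.finite
    (fun s a b hab H x hx y hy h1 => H x hx y hy (h1.trans_le hab)) fun s hs => ?_
  have hsK := convexHull_subset_space hs
  have hss : IsCompact (convexHull ℝ (s : Set V) ×ˢ convexHull ℝ (s : Set V)) :=
    s.isCompact_convexHull.prod s.isCompact_convexHull
  have hde := he.dist_fst_snd hsK hsK
  set D : Set (V × V) := (convexHull ℝ (s : Set V) ×ˢ convexHull ℝ (s : Set V)) ∩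
    (fun p : V × V => dist (e p.1) (e p.2)) ⁻¹' Ici r with hD
  have hDc : IsCompact D := hss.of_isClosed_subset
    (hde.preimage_isClosed_of_isClosed hss.isClosed isClosed_Ici) inter_subset_left
  obtain ⟨η, hη, H⟩ := hDc.exists_pos_le ((h.continuousOn.dist_fst_snd hsK hsK).mono
    inter_subset_left) (by
    rintro ⟨x, y⟩ ⟨⟨hx, hy⟩, hxy⟩
    refine dist_pos.2 fun heq => ?_
    have hxy' : x = y := h.inj s hs hx hy heq
    subst hxy'
    have h0 : r ≤ dist (e x) (e x) := hxy
    rw [dist_self] at h0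
    linarith)
  refine ⟨η, hη, fun x hx y hy hlt => ?_⟩
  by_contra hge
  exact absurd (H (x, y) ⟨⟨hx, hy⟩, not_lt.1 hge⟩) (not_le.2 hlt)

/-- The carrier of a point of `X` lies in `X`, so its vertices are among those removed. -/
theorem spaceOf_disjoint_skel {L : SimplicialComplex ℝ W} {T : Set (Finset W)} (hT : L.IsSub T)
    {X : Set W} (hX : L.Compat X) (A : Set W) (hA : ∀ τ ∈ T, ∀ w ∈ τ, w ∈ X → w ∈ A) :
    Disjoint (spaceOf {τ ∈ T | ∀ w ∈ A, w ∉ τ}) X := by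
  rw [Set.disjoint_left]
  intro y hy hyX
  obtain ⟨σ, hσ, hc⟩ := (hT.remove A).exists_carrier hy
  obtain ⟨u, hu⟩ := L.nonempty_of_mem_faces hc.1
  exact hσ.2 u (hA σ hσ.1 u hu (hX y σ hyX hc (subset_convexHull ℝ _ hu))) hu

theorem ConvexAffineOn.image_convexHull {V W : Type*} [AddCommGroup V] [Module ℝ V]
    [AddCommGroup W] [Module ℝ W] [DecidableEq W] {f : V → W} {r : Finset V}
    (hf : ConvexAffineOn f (convexHull ℝ (r : Set V))) :
    f '' convexHull ℝ (r : Set V) = convexHull ℝ ((r.image f : Finset W) : Set W) := by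
  rw [Finset.coe_image]
  apply Subset.antisymm
  · have hconv : Convex ℝ
        {x ∈ convexHull ℝ (r : Set V) | f x ∈ convexHull ℝ (f '' (r : Set V))} := by
      intro x hx y hy a b ha hb hab
      refine ⟨convex_convexHull ℝ _ hx.1 hy.1 ha hb hab, ?_⟩
      rw [hf x hx.1 y hy.1 a b ha hb hab]
      exact convex_convexHull ℝ _ hx.2 hy.2 ha hb hab
    rintro _ ⟨x, hx, rfl⟩
    exact (convexHull_min (t := {x ∈ convexHull ℝ (r : Set V) |
      f x ∈ convexHull ℝ (f '' (r : Set V))}) (fun v hv => ⟨subset_convexHull ℝ _ hv,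
        subset_convexHull ℝ _ (mem_image_of_mem f hv)⟩) hconv hx).2
  · refine convexHull_min (image_mono (subset_convexHull ℝ _)) ?_
    rintro _ ⟨y, hy, rfl⟩ _ ⟨z, hz, rfl⟩ a b ha hb hab
    exact ⟨a • y + b • z, convex_convexHull ℝ _ hy hz ha hb hab, hf y hy z hz a b ha hb hab⟩

/-- Two simplices of `K` meet in a common face or not at all, so the sets to be respected are
polytopes and `exists_triangulation` applies. -/
theorem exists_isSheeted (hK : K.faces.Finite)
    (haff : ∀ s ∈ K.faces, ConvexAffineOn f (convexHull ℝ (s : Set V)))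
    (hinj : ∀ s ∈ K.faces, InjOn f (convexHull ℝ (s : Set V)))
    {S : Set (Finset W)} (hS : S.Finite) {η : ℝ} (hη : 0 < η) :
    ∃ L : SimplicialComplex ℝ W, IsSheeted f K L ∧ K.space ⊆ f ⁻¹' L.space ∧
      (∀ s ∈ S, convexHull ℝ (s : Set W) ⊆ L.space ∧ L.Compat (convexHull ℝ (s : Set W))) ∧
      ∀ s ∈ L.faces, ∀ x ∈ convexHull ℝ (s : Set W), ∀ y ∈ convexHull ℝ (s : Set W),
        dist x y < η := by
  classical
  have himg : ∀ s ∈ K.faces, ∀ t ∈ K.faces,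
      f '' (convexHull ℝ (s : Set V) ∩ convexHull ℝ (t : Set V)) =
        convexHull ℝ (((s ∩ t).image f : Finset W) : Set W) := by
    intro s hs t ht
    rw [K.convexHull_inter_convexHull hs ht, ← Finset.coe_inter]
    exact ((haff s hs).mono (convexHull_mono
      (Finset.coe_subset.2 Finset.inter_subset_left))).image_convexHull
  obtain ⟨L, hL, hLS, hmesh⟩ := exists_triangulation
    (S ∪ (fun p : Finset V × Finset V => (p.1 ∩ p.2).image f) '' (K.faces ×ˢ K.faces))
    (hS.union ((hK.prod hK).image _)) hη
  refine ⟨L, ⟨hK, hL, haff, hinj, fun s hs t ht => ?_⟩, fun x hx => ?_,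
    fun s hs => hLS s (Or.inl hs), hmesh⟩
  · rw [himg s hs t ht]
    exact (hLS _ (Or.inr ⟨(s, t), ⟨hs, ht⟩, rfl⟩)).2
  · obtain ⟨s, hs, hxs⟩ := mem_space_iff.1 hx
    refine (hLS _ (Or.inr ⟨(s, s), ⟨hs, hs⟩, rfl⟩)).1 ?_
    simp only
    rw [← himg s hs s hs]
    exact ⟨x, ⟨hxs, hxs⟩, rfl⟩

theorem isPolyhedral_spaceOf {T : Set (Finset W)} (hT : T.Finite) : IsPolyhedral (spaceOf T) :=
  ⟨T, hT, rfl⟩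

/-- The induction is on `j`, a bound for the number of skeleta still to be cleared. When none is
left, `Y` is empty. The quantifier over `ε` stands inside because each step uses the previous one
with a smaller radius. -/
theorem contracts_of_disjoint_skel (h : IsSheeted f K L₀) (he : ContinuousOn e K.space)
    (hinj : FibInj f K.space e) {d : ℕ} (hd : ∀ τ ∈ L₀.faces, τ.card ≤ d) (j : ℕ) :
    ∀ i, d ≤ i + j → ∀ Y, IsPolyhedral Y → Y ⊆ L₀.space → Disjoint Y (L₀.skel i) → ∀ ε > 0,
      Contracts.{u} f e (K.space ∩ f ⁻¹' Y) (fun x => Metric.ball (e x) ε) := by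
  induction j with
  | zero =>
    intro i hi Y _ hYL hYi ε _
    have hempty : Y = ∅ := by
      refine eq_empty_of_forall_notMem fun y hy => ?_
      obtain ⟨τ, hτ, hyτ⟩ := mem_space_iff.1 (hYL hy)
      exact hYi.notMem_of_mem_left hy (mem_spaceOf.2 ⟨τ, ⟨hτ, (hd τ hτ).trans hi⟩, hyτ⟩)
    rw [hempty, preimage_empty, inter_empty]
    exact ⟨contractsTop_empty, contractsPL_empty⟩
  | succ j ih =>
    intro i hi Y hY hYL hYi ε hε
    obtain ⟨γ, hγ, hgap⟩ := exists_gap h he hinj hY.isCompact.isClosed hYi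
    -- Oscillation `r` on cells plus thickening `r` puts each region in a ball of radius `r + r`:
    -- such balls about distinct apexes must be disjoint, and a region must lie in the `ε`-ball.
    obtain ⟨r, hr, hrγ, hrε⟩ : ∃ r > 0, 2 * (r + r) ≤ γ ∧ r + r ≤ ε :=
      ⟨min (γ / 4) (ε / 2), lt_min (by linarith) (by linarith),
        by linarith [min_le_left (γ / 4) (ε / 2)], by linarith [min_le_right (γ / 4) (ε / 2)]⟩
    obtain ⟨η, hη, hosc⟩ := exists_osc h he hr
    obtain ⟨S, hS, rfl⟩ := hY
    obtain ⟨L, hL, hKL, hLS, hmesh⟩ := exists_isSheeted h.finite h.affine h.inj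
      (hS.union h.finite') hη
    have hYc : L.Compat (⋃ s ∈ S, convexHull ℝ (s : Set W)) :=
      Compat.iUnion₂ fun s hs => (hLS s (Or.inl hs)).2
    have hXc : L.Compat (L₀.skel (i + 1)) :=
      Compat.iUnion₂ fun τ hτ => (hLS τ (Or.inr hτ.1)).2
    set Y : Set W := ⋃ s ∈ S, convexHull ℝ (s : Set W) with hYdef
    set T : Set (Finset W) := {τ ∈ L.faces | convexHull ℝ (τ : Set W) ⊆ Y} with hTdef
    have hT : L.IsSub T := ⟨fun τ hτ => hτ.1, fun τ hτ σ hσ hne =>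
      ⟨L.down_closed hτ.1 hσ hne, (convexHull_mono (Finset.coe_subset.2 hσ)).trans hτ.2⟩⟩
    have hTY : spaceOf T = Y := by
      apply Subset.antisymm
      · exact iUnion₂_subset fun τ hτ => hτ.2
      · intro y hy
        obtain ⟨s, hs, hys⟩ := mem_iUnion₂.1 hy
        obtain ⟨τ₀, hτ₀, hyτ₀⟩ := mem_space_iff.1 ((hLS s (Or.inl hs)).1 hys)
        obtain ⟨τ, hτ⟩ := L.exists_isCarrier hτ₀ hyτ₀
        exact mem_spaceOf.2 ⟨τ, ⟨hτ.1, hYc y τ hy hτ⟩, hτ.2.1⟩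
    set A : Set W := {w | {w} ∈ L.faces ∧ w ∈ L₀.skel (i + 1)} with hAdef
    have hA : A.Finite := by
      refine (hL.finite'.biUnion (t := fun τ => (τ : Set W)) fun τ _ => τ.finite_toSet).subset ?_
      intro w hw
      exact mem_biUnion hw.1 (Finset.mem_coe.2 (Finset.mem_singleton_self w))
    have hosc' : ∀ s ∈ K.faces, ∀ τ ∈ L.faces,
        ∀ x ∈ convexHull ℝ (s : Set V) ∩ f ⁻¹' convexHull ℝ (τ : Set W),
        ∀ y ∈ convexHull ℝ (s : Set V) ∩ f ⁻¹' convexHull ℝ (τ : Set W),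
          dist (e x) (e y) < r := fun s hs τ hτ x hx y hy =>
      hosc s hs x hx.1 y hy.1 (hmesh τ hτ _ hx.2 _ hy.2)
    have hdisj : Disjoint (spaceOf {τ ∈ T | ∀ w ∈ A, w ∉ τ}) (L₀.skel (i + 1)) :=
      spaceOf_disjoint_skel hT hXc A fun τ hτ w hw hwX =>
        ⟨L.down_closed hτ.1 (Finset.singleton_subset_iff.2 hw) (Finset.singleton_nonempty w), hwX⟩
    have hsub : spaceOf {τ ∈ T | ∀ w ∈ A, w ∉ τ} ⊆ L₀.space := by
      refine Subset.trans ?_ hYL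
      rw [← hTY]
      exact biUnion_mono (fun τ hτ => hτ.1) fun _ _ => Subset.rfl
    have hc := ih (i + 1) (by omega) _ (isPolyhedral_spaceOf
      (hL.finite'.subset fun τ hτ => hτ.1.1)) hsub hdisj r hr
    have hc' : Contracts.{u} f e (K.space ∩ f ⁻¹' spaceOf {τ ∈ T | ∀ w ∈ A, w ∉ τ})
        (IsSheeted.region f K L e r) :=
      ⟨hc.1.mono fun x _ => IsSheeted.ball_subset_region e r x,
        hc.2.mono fun x _ => IsSheeted.ball_subset_region e r x⟩
    have hfin := hL.contracts_of_remove hr hosc' hT hA (fun w hw hwT v hv v' hv' h1 h2 hne => by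
      refine hrγ.trans (hgap v hv v' hv' (h1.trans h2.symm) ?_ ?_ hne)
      · rw [h1]
        exact hwT.2 (by simp)
      · rw [h1]; exact hw.2) hc'
    rw [hTY] at hfin
    have hRb : ∀ x ∈ K.space ∩ f ⁻¹' Y, IsSheeted.region f K L e r x ⊆ Metric.ball (e x) ε := by
      rintro x ⟨hx, hxY⟩
      obtain ⟨s, hs, hxs⟩ := mem_space_iff.1 hx
      obtain ⟨τ, hτ, hxτ⟩ := mem_space_iff.1 (hKL hx)
      exact (IsSheeted.region_subset_ball hosc' hs hτ ⟨hxs, hxτ⟩ ⟨hxs, hxτ⟩).trans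
        (Metric.ball_subset_ball hrε)
    exact ⟨hfin.1.mono hRb, hfin.2.mono hRb⟩

/-- The contraction property near every continuous map separating the points of the fibres. -/
theorem contracts (hK : K.faces.Finite)
    (haff : ∀ s ∈ K.faces, ConvexAffineOn f (convexHull ℝ (s : Set V)))
    (hfinj : ∀ s ∈ K.faces, InjOn f (convexHull ℝ (s : Set V)))
    (he : ContinuousOn e K.space) (hinj : FibInj f K.space e) {ε : ℝ} (hε : 0 < ε) :
    Contracts.{u} f e K.space (fun x => Metric.ball (e x) ε) := by
  obtain ⟨L₀, hL₀, hKL, -⟩ := exists_isSheeted hK haff hfinj (finite_empty (α := Finset W)) one_pos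
  obtain ⟨d, hd⟩ := (hL₀.finite'.image Finset.card).bddAbove
  have h := contracts_of_disjoint_skel.{u} hL₀ he hinj
    (fun τ hτ => hd (mem_image_of_mem _ hτ)) d 0 (by omega) L₀.space ⟨_, hL₀.finite', rfl⟩
    Subset.rfl ?_ ε hε
  · rwa [inter_eq_left.2 hKL] at h
  · rw [Set.disjoint_right]
    intro y hy
    obtain ⟨τ, ⟨hτ, hτ0⟩, -⟩ := mem_spaceOf.1 hy
    exact absurd (Finset.card_pos.2 (L₀.nonempty_of_mem_faces hτ)) (by omega)

end Strata

/-- Two points with the same image would span a segment inside a fibre. -/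
theorem IsNondegenerate.injOn {V W : Type*} [AddCommGroup V] [Module ℝ V] [AddCommGroup W]
    [Module ℝ W] {f : V → W} {N : Set V} {M : Set W} (h : IsNondegenerate f N M)
    (hfM : MapsTo f N M) {C : Set V} (hCN : C ⊆ N) (hC : Convex ℝ C) (hf : ConvexAffineOn f C) :
    InjOn f C := by
  classical
  intro x hx y hy hxy
  by_contra hne
  have hdim := h (f x) (hfM (hCN hx))
  have hle : (((({x, y} : Finset V).card - 1 : ℕ) : ℕ∞) : WithBot ℕ∞) ≤
      polyhedronDim {z ∈ N | f z = f x} := by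
    refine le_iSup₂_of_le ({x, y} : Finset V) (Finset.insert_nonempty _ _) ?_
    refine le_iSup₂_of_le ?_ ?_ le_rfl
    · refine affineIndependent_of_isBary_unique fun w w' z hw hw' => ?_
      have e1 := hw.eq
      have e2 := hw'.eq
      have e3 := hw.sum
      have e4 := hw'.sum
      rw [Finset.sum_pair hne] at e1 e2 e3 e4
      have e5 : (w x - w' x) • (x - y) = 0 := by
        have h1 : w y = 1 - w x := by linarith
        have h2 : w' y = 1 - w' x := by linarith
        rw [h1] at e1
        rw [h2] at e2
        have e6 : w x • x + (1 - w x) • y = w' x • x + (1 - w' x) • y := e1.trans e2.symm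
        rw [← sub_eq_zero] at e6
        rw [← e6]
        module
      have e7 : w x = w' x := by
        rcases smul_eq_zero.1 e5 with h1 | h1
        · exact sub_eq_zero.1 h1
        · exact absurd (sub_eq_zero.1 h1) hne
      funext v
      by_cases hvx : v = x
      · rw [hvx, e7]
      by_cases hvy : v = y
      · rw [hvy]; linarith
      · rw [hw.supp v (by simp [hvx, hvy]), hw'.supp v (by simp [hvx, hvy])]
    · rw [Finset.coe_pair, convexHull_pair]
      rintro _ ⟨a, b, ha, hb, hab, rfl⟩
      refine ⟨hCN (hC hx hy ha hb hab), ?_⟩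
      rw [hf x hx y hy a b ha hb hab, ← hxy, ← add_smul, hab, one_smul]
  rw [Finset.card_pair hne] at hle
  have h01 := hle.trans hdim
  norm_num at h01

/-! ### From height functions back to embedded lifts. -/

section Main

universe u v

variable {V : Type u} {W : Type v} [NormedAddCommGroup V] [NormedSpace ℝ V] [FiniteDimensional ℝ V]
  [NormedAddCommGroup W] [NormedSpace ℝ W] [FiniteDimensional ℝ W]
  {N : Set V} {M : Set W} {f : V → W} {k : ℕ}

open Classical in
/-- The `ℝᵏ`-component of a lift, extended by zero. -/
noncomputable def EmbeddedLifts.height (e : EmbeddedLifts f N M k) (x : V) :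
    EuclideanSpace ℝ (Fin k) :=
  if h : x ∈ N then (e.1 ⟨x, h⟩).2 else 0

theorem EmbeddedLifts.height_eq (e : EmbeddedLifts f N M k) (p : N) :
    e.height p = (e.1 p).2 := by
  simp [EmbeddedLifts.height]

theorem EmbeddedLifts.continuousOn_height (e : EmbeddedLifts f N M k) :
    ContinuousOn e.height N := by
  rw [continuousOn_iff_continuous_domRestrict]
  have : N.domRestrict e.height = fun p => (e.1 p).2 := funext fun p => e.height_eq p
  rw [this]
  exact continuous_snd.comp e.1.continuous

theorem EmbeddedLifts.fibInj_height (e : EmbeddedLifts f N M k) : FibInj f N e.height := by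
  intro x hx y hy hf he
  have h1 := e.height_eq ⟨x, hx⟩
  have h2 := e.height_eq ⟨y, hy⟩
  simp only at h1 h2
  rw [h1, h2] at he
  have h3 : (e.1 ⟨x, hx⟩).1 = (e.1 ⟨y, hy⟩).1 :=
    Subtype.ext ((e.2.2 ⟨x, hx⟩).trans (hf.trans (e.2.2 ⟨y, hy⟩).symm))
  exact congrArg Subtype.val (e.2.1.injective (Prod.ext h3 he))

theorem EmbeddedLifts.dist_apply (e e' : EmbeddedLifts f N M k) (p : N) :
    dist (e.1 p) (e'.1 p) = dist (e.height p) (e'.height p) := by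
  have h3 : (e.1 p).1 = (e'.1 p).1 := Subtype.ext ((e.2.2 p).trans (e'.2.2 p).symm)
  rw [Prod.dist_eq, h3, dist_self, e.height_eq, e'.height_eq]
  exact max_eq_right dist_nonneg

/-- The contraction property is applied to the tautological family parametrised by a ball about `e`
in the space of lifts. Continuous lifts separating the points of fibres are injective, hence
embeddings by compactness of `N`. -/
theorem locallyContractibleSpace_embeddedLifts (hN : IsCompact N)
    (h : ∀ e : EmbeddedLifts f N M k, ∀ ε > (0 : ℝ),
      ContractsTop.{max u v} f e.height N (fun x => Metric.ball (e.height x) ε)) :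
    LocallyContractibleSpace (EmbeddedLifts f N M k) := by
  have : CompactSpace N := isCompact_iff_compactSpace.1 hN
  intro e U hU
  obtain ⟨u, hu, huU⟩ := mem_nhds_subtype _ _ _ |>.1 hU
  obtain ⟨ε, hε, hεu⟩ := Metric.mem_nhds_iff.1 hu
  have hmemU : ∀ e' : EmbeddedLifts f N M k,
      (∀ p : N, dist (e'.height p) (e.height p) < ε) → e' ∈ U := by
    intro e' he'
    refine huU (hεu ?_)
    rw [Metric.mem_ball, ContinuousMap.dist_lt_iff hε]
    intro p
    rw [e'.dist_apply e p]
    exact he' p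
  obtain ⟨δ, hδ, H⟩ := h e ε hε
  set Z : Set (EmbeddedLifts f N M k) := {e' | dist e'.1 e.1 < min δ ε} with hZ
  have hZdist : ∀ z ∈ Z, ∀ p : N, dist (z.height p) (e.height p) < min δ ε := by
    intro z hz p
    rw [← z.dist_apply e p]
    exact (ContinuousMap.dist_lt_iff (lt_min hδ hε)).1 hz p
  have hZU : Z ⊆ U := fun z hz => hmemU z fun p => (hZdist z hz p).trans_le (min_le_right _ _)
  have hZn : Z ∈ 𝓝 e := by
    have hopen : IsOpen Z := isOpen_lt (continuous_subtype_val.dist continuous_const)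
      continuous_const
    exact hopen.mem_nhds (by simp [hZ, hδ, hε])
  refine ⟨Z, hZU, hZn, ?_⟩
  obtain ⟨Φ, h1, h2, h3, h4, h5⟩ := H Z (fun z => z.1.height) (by
      rw [continuousOn_iff_continuous_domRestrict]
      have heq : ((univ : Set Z) ×ˢ N).domRestrict (fun p => p.1.1.height p.2) =
          fun q => (q.1.1.1.1 ⟨q.1.2, q.2.2⟩).2 := by
        funext q
        exact q.1.1.1.height_eq ⟨q.1.2, q.2.2⟩
      rw [heq]
      refine continuous_snd.comp (Continuous.eval ?_ ?_)
      · fun_prop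
      · exact Continuous.subtype_mk (by fun_prop) _)
    (fun z => z.1.fibInj_height)
    (fun z x hx => (hZdist z.1 z.2 ⟨x, hx⟩).trans_le (min_le_left _ _))
  have hI : ∀ t : unitInterval, ‖(1 - t : ℝ)‖ ≤ 1 := fun t => by
    rw [Real.norm_eq_abs, abs_le]
    constructor <;> linarith [t.2.1, t.2.2]
  -- The homotopy runs through the parameter `1 - t`: at `1` the given lift, at `0` a lift
  -- independent of it. Currying makes it continuous into the space of maps.
  let Ψ : C((unitInterval × Z) × N, M × EuclideanSpace ℝ (Fin k)) :=
    { toFun := fun q => ((e.1 q.2).1, Φ q.1.2 q.2 (1 - q.1.1))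
      continuous_toFun := by
        refine Continuous.prodMk (by fun_prop) ?_
        exact h1.comp_continuous
          (f := fun q : (unitInterval × Z) × N => (q.1.2, (q.2 : V), (1 - q.1.1 : ℝ)))
          (by fun_prop) fun q =>
            ⟨mem_univ _, q.2.2, mem_closedBall_zero_iff.2 (hI _)⟩ }
  have hlift : ∀ q : unitInterval × Z, IsEmbedding (Ψ.curry q) ∧
      ∀ p : N, ((Ψ.curry q p).1 : W) = f p := by
    intro q
    refine ⟨((Ψ.curry q).continuous.isClosedEmbedding ?_).isEmbedding, fun p => e.2.2 p⟩
    intro p p' hp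
    obtain ⟨hp1, hp2⟩ := Prod.mk.inj hp
    refine Subtype.ext (h2 q.2 _ (hI q.1) p p.2 p' p'.2 ?_ hp2)
    rw [← e.2.2 p, ← e.2.2 p', hp1]
  let F : unitInterval × Z → EmbeddedLifts f N M k := fun q => ⟨Ψ.curry q, hlift q⟩
  have hFh : ∀ q (p : N), (F q).height p = Φ q.2 p (1 - q.1) := fun q p => (F q).height_eq p
  have hFU : ∀ q, F q ∈ U := fun q => hmemU _ fun p => by
    rw [hFh]
    exact h3 q.2 p p.2 _ (hI q.1)
  have hFc : Continuous F := Continuous.subtype_mk Ψ.curry.continuous _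
  have hext : ∀ a b : EmbeddedLifts f N M k, (∀ p : N, a.height p = b.height p) → a = b := by
    intro a b hab
    refine Subtype.ext (ContinuousMap.ext fun p => Prod.ext ?_ ?_)
    · exact Subtype.ext ((a.2.2 p).trans (b.2.2 p).symm)
    · rw [← a.height_eq, ← b.height_eq, hab p]
  let z₀ : Z := ⟨e, mem_of_mem_nhds hZn⟩
  refine ⟨⟨F (1, z₀), hFU _⟩, ⟨{
    toFun := fun q => ⟨F q, hFU q⟩
    continuous_toFun := hFc.subtype_mk _
    map_zero_left := fun z => ?_
    map_one_left := fun z => ?_ }⟩⟩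
  · refine Subtype.ext (hext _ _ fun p => ?_)
    refine (hFh (0, z) p).trans ?_
    rw [show (1 - ((0 : unitInterval) : ℝ)) = 1 by simp]
    exact h4 z p p.2 1 (by simp)
  · refine Subtype.ext (hext _ _ fun p => ?_)
    refine (hFh (1, z) p).trans (Eq.trans ?_ (hFh (1, z₀) p).symm)
    rw [show (1 - ((1 : unitInterval) : ℝ)) = 0 by simp]
    exact h5 z z₀ p p.2

/-- Only the `ℝᵏ`-component needs extending. Since the other components record `f x` and `b`,
injectivity of the result is fibrewise injectivity of that component for each `b`. -/
theorem exists_extension_of_contractsPL (hf : HasPLCover f N) (e : EmbeddedLifts f N M k) {ε : ℝ}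
    (hε : 0 < ε) (h : ContractsPL f e.height N (fun x => Metric.ball (e.height x) ε)) :
    ∃ δ > (0 : ℝ), ∀ n : ℕ,
      ∀ E : V × (Fin n → ℝ) → W × EuclideanSpace ℝ (Fin k) × (Fin n → ℝ),
        IsPLEmbeddedLiftOver f N k n (plSphere n) E →
        IsCloseOver e.1 (plSphere n) E δ →
        ∃ E' : V × (Fin n → ℝ) → W × EuclideanSpace ℝ (Fin k) × (Fin n → ℝ),
          IsPLEmbeddedLiftOver f N k n (plBall n) E' ∧
          EqOn E' E (N ×ˢ plSphere n) ∧
          IsCloseOver e.1 (plBall n) E' ε := by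
  obtain ⟨δ, hδ, H⟩ := h
  refine ⟨δ, hδ, fun n E hE hclose => ?_⟩
  obtain ⟨⟨hEPL, E₁, -, hE₁⟩, hElift⟩ := hE
  have hE₁' := hE₁.injOn
  obtain ⟨Φ, h1, h2, h3, h4⟩ := H n (fun q => (E q).2.1)
    (hEPL.hasPLCover.linear_comp (LinearMap.fst ℝ _ _ ∘ₗ LinearMap.snd ℝ _ _))
    (by
      intro b hb x hx y hy hfxy heq
      have h5 := hElift x hx b hb
      have h6 := hElift y hy b hb
      have h7 : E (x, b) = E (y, b) := Prod.ext (by rw [h5.1, h6.1, hfxy])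
        (Prod.ext heq (by rw [h5.2, h6.2]))
      exact congrArg Prod.fst (hE₁' (x₁ := (x, b)) (x₂ := (y, b)) ⟨hx, hb⟩ ⟨hy, hb⟩ h7))
    (by
      intro b hb x hx
      have h5 := hclose ⟨x, hx⟩ b hb
      rw [← e.height_eq] at h5
      refine lt_of_le_of_lt ?_ h5
      exact (le_max_left _ _).trans (le_max_right _ _))
  refine ⟨fun q => (f q.1, Φ q, q.2), ⟨?_, fun p _ b _ => ⟨rfl, rfl⟩⟩, ?_, ?_⟩
  · refine HasPLCover.isPLEmbeddingOn ?_ ?_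
    · exact (hf.comp_fst_prod (isPolyhedral_plBall n)).prodMk (h1.prodMk
        (h1.isPolyhedral.hasPLCover_affine (LinearMap.snd ℝ V (Fin n → ℝ)).toAffineMap))
    · rintro ⟨x, b⟩ ⟨hx, hb⟩ ⟨y, b'⟩ ⟨hy, -⟩ heq
      obtain ⟨h5, h6⟩ := Prod.mk.inj heq
      obtain ⟨h6, h7⟩ := Prod.mk.inj h6
      simp only at h5 h6 h7 hx hb hy
      subst h7
      rw [h2 b hb x hx y hy h5 h6]
  · rintro ⟨x, b⟩ ⟨hx, hb⟩
    have h5 := hElift x hx b hb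
    refine Prod.ext h5.1.symm (Prod.ext (h4 ⟨hx, hb⟩) h5.2.symm)
  · intro p b hb
    have h5 := h3 b hb p p.2
    rw [Metric.mem_ball, e.height_eq] at h5
    rw [Prod.dist_eq, Prod.dist_eq, e.2.2 p]
    simp only [dist_self]
    exact max_lt hε (max_lt h5 hε)

end Main

theorem mainTheorem3 {V W : Type*}
    [NormedAddCommGroup V] [NormedSpace ℝ V] [FiniteDimensional ℝ V]
    [NormedAddCommGroup W] [NormedSpace ℝ W] [FiniteDimensional ℝ W]
    (N : Set V) (M : Set W) (hN : IsCompactPolyhedron N) (hM : IsCompactPolyhedron M)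
    (f : V → W) (hf : IsPLMap f N M) (hnd : IsNondegenerate f N M) (k : ℕ) :
    LocallyContractibleSpace (EmbeddedLifts f N M k) ∧
    ∀ e : EmbeddedLifts f N M k, ∀ ε > (0 : ℝ), ∃ δ > (0 : ℝ), ∀ n : ℕ,
      ∀ E : V × (Fin n → ℝ) → W × EuclideanSpace ℝ (Fin k) × (Fin n → ℝ),
        IsPLEmbeddedLiftOver f N k n (plSphere n) E →
        IsCloseOver e.1 (plSphere n) E δ →
        ∃ E' : V × (Fin n → ℝ) → W × EuclideanSpace ℝ (Fin k) × (Fin n → ℝ),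
          IsPLEmbeddedLiftOver f N k n (plBall n) E' ∧
          EqOn E' E (N ×ˢ plSphere n) ∧
          IsCloseOver e.1 (plBall n) E' ε := by
  have hcover := hf.1.hasPLCover
  obtain ⟨K, hK, rfl, hφ⟩ := hf.1
  have haff : ∀ s ∈ K.faces, ConvexAffineOn f (convexHull ℝ (s : Set V)) := fun s hs => by
    obtain ⟨φ, hφ⟩ := hφ s hs
    exact (φ.convexAffineOn _).congr (convex_convexHull ℝ _) hφ
  have hinj : ∀ s ∈ K.faces, InjOn f (convexHull ℝ (s : Set V)) := fun s hs =>
    hnd.injOn hf.2 (Geometry.SimplicialComplex.convexHull_subset_space hs)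
      (convex_convexHull ℝ _) (haff s hs)
  have hcontr := fun (e : EmbeddedLifts f K.space M k) (ε : ℝ) (hε : ε > 0) =>
    contracts hK haff hinj e.continuousOn_height e.fibInj_height hε
  exact ⟨locallyContractibleSpace_embeddedLifts hcover.isPolyhedral.isCompact
    fun e ε hε => (hcontr e ε hε).1,
    fun e ε hε => exists_extension_of_contractsPL hcover e hε (hcontr e ε hε).2⟩
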